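/- Let $\mathcal C$ be a small category with duality: a small category with a contravariant functor $x\mapsto x^\vee$ and a natural isomorphism $\epsilon_x\colon x\to x^{\vee\vee}$ such that $(\epsilon_x)^\vee\circ\epsilon_{x^\vee}=\mathrm{id}_{x^\vee}$ for all $x$. Let $\mathcal E$ be a cocomplete symmetric monoidal category whose tensor product preserves colimits in each variable. **Graphs.** A graph $\Gamma$ consists of finite sets $F$ of flags and $V$ of vertices, a map $h\colon F\to V$ and an involution $\tau$ of $F$; the fixed points of $\tau$ are the legs, and its two-element orbits are the edges. Write $n(v)=|h^{-1}(v)|$. A stable $\mathcal C$-graph is a graph with a genus function $g\colon V\to\{0,1,2,\dots\}$ such that $2g(v)-2+n(v)>0$ for all $v$, an object $A_x$ of $\mathcal C$ for every flag $x$, and for every edge $\{x,y\}$ a pairing $A_x\to A_y^\vee$ (equivalently, the corresponding $A_y\to A_x^\vee$). A morphism $\Gamma\to\Gamma'$ consists of maps $f_*\colon V\to V'$ and $f^*\colon F'\to F$ and morphisms $q_x\colon A_{f^*(x)}\to A_x$ for $x\in F'$ such that: $f^*$ is injective, commutes with the involutions and is bijective on legs; $f_*(h(f^*(x)))=h'(x)$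 for $x\in F'$; $f_*$ is the coequalizer of $h,h\tau\colon F\setminus f^*(F')\to V$; $2g(v')-2+n(v')=\sum_{f_*(v)=v'}(2g(v)-2+n(v))$ for all $v'\in V'$; and for every edge $\{x,y\}$ of $\Gamma'$ the pairing of $A_{f^*(x)}$ and $A_{f^*(y)}$ is the composite $A_{f^*(x)}\xrightarrow{q_x}A_x\to A_y^\vee\xrightarrow{q_y^\vee}A_{f^*(y)}^\vee$. Let $\mathbf S$ be the resulting category, $\mathbf S^0$ its full subcategory of corollas (graphs with one vertex and no edges), and $\mathrm{Bij}(\mathbf S)$ the subcategory of $\mathbf S$ with all objects and with the morphisms that do not contract any edge ($f^*$ is surjective). For a vertex $v$ of $\Gamma$ let $\gamma(v)$ be the corolla of genus $g(v)$ with set of flags $h^{-1}(v)$. **The functor.** A stable $\mathcal C\mathbb S$-module is a functor $V\colon\mathbf S^0\to\mathcal E$. It extends to $\mathrm{Bij}(\mathbf S)$ by the unordered tensor product $V(\Gamma)=\bigotimes_{v}V(\gamma(v))$ over the vertices of $\Gamma$. Define an endofunctor $\mathcal M$ of $[\mathbf S^0,\mathcal E]$ by $$\mathcal M V(\gamma)=\operatorname{colim}_{(\Gamma\to\gamma)\in\mathrm{Bij}(\mathbf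 S)\downarrow\gamma}V(\Gamma),$$ where the objects of $\mathrm{Bij}(\mathbf S)\downarrow\gamma$ are the morphisms $\Gamma\to\gamma$ of $\mathbf S$ and its morphisms are the non-contracting morphisms over $\gamma$. Given $\Gamma\in\mathbf S$ and morphisms $\Gamma_v\to\gamma(v)$ in $\mathbf S$ for all vertices $v$ of $\Gamma$, let $\Gamma\{\Gamma_v\}$ be the graph obtained by substituting $\Gamma_v$ for $v$ and identifying the legs of $\Gamma_v$ with the flags of $\Gamma$ at $v$; a flag coming from a leg of $\Gamma_v$ has the color it has in $\Gamma_v$, and an edge $\{x,y\}$ of $\Gamma$ is given the pairing composed with $q_x$ and $q_y^\vee$. There is a canonical morphism $\Gamma\{\Gamma_v\}\to\Gamma$. **Proposition.** 1. There is a unique natural transformation $\eta\colon\mathrm{id}\to\mathcal M$ whose component $V(\gamma)\to\mathcal M V(\gamma)$ is, for every $V$ and $\gamma$, the canonical map to the colimit belonging to the object $\mathrm{id}_\gamma$. 2. There is a unique natural transformation $\mu\colon\mathcal M^2\to\mathcal M$ (erasing braces) such that for all $V$, all $\Gamma\to\gamma$ and all families $\Gamma_v\to\gamma(v)$ the composite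 $\bigotimes_vV(\Gamma_v)\to\bigotimes_v\mathcal M V(\gamma(v))=(\mathcal M V)(\Gamma)\to\mathcal M^2V(\gamma)\xrightarrow{\mu}\mathcal M V(\gamma)$ is the canonical isomorphism $\bigotimes_vV(\Gamma_v)\cong V(\Gamma\{\Gamma_v\})$ followed by the canonical map to the colimit belonging to $\Gamma\{\Gamma_v\}\to\Gamma\to\gamma$. 3. $(\mathcal M,\eta,\mu)$ is a monad: $\mu\circ\mathcal M\mu=\mu\circ\mu\mathcal M$ and $\mu\circ\eta\mathcal M=\mathrm{id}=\mu\circ\mathcal M\eta$. -/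

import Mathlib

open CategoryTheory Limits MonoidalCategory Opposite

universe u v w

namespace ModularOperad

/-! ### Categories with duality -/

/-- A category with duality: a contravariant functor `x ↦ x^∨`, and a natural isomorphism
`id ≅ ∨ ∘ ∨` such that `x^∨ ⟶ x^∨∨∨ ⟶ x^∨` is the identity. -/
class CategoryWithDuality (C : Type u) [Category.{v} C] where
  /-- the contravariant functor `x ↦ x^∨` -/
  dual : Cᵒᵖ ⥤ C
  /-- the natural isomorphism `x ≅ x^∨∨` -/
  bidual : 𝟭 C ≅ dual.rightOp ⋙ dual
  triangle : ∀ x : C,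
    bidual.hom.app (dual.obj (op x)) ≫ dual.map (bidual.hom.app x).op = 𝟙 (dual.obj (op x))

section Duality

variable {C : Type u} [Category.{v} C] [CategoryWithDuality C]

/-- The dual `x^∨` of an object. -/
def dualObj (x : C) : C := CategoryWithDuality.dual.obj (op x)

/-- The dual `f^∨ : y^∨ ⟶ x^∨` of a morphism `f : x ⟶ y`. -/
def dualMap {x y : C} (f : x ⟶ y) : dualObj y ⟶ dualObj x := CategoryWithDuality.dual.map f.op

/-- The component `x ⟶ x^∨∨` of the biduality isomorphism. -/
def bidualMap (x : C) : x ⟶ dualObj (dualObj x) := CategoryWithDuality.bidual.hom.app x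

theorem dualMap_id (x : C) : dualMap (𝟙 x) = 𝟙 (dualObj x) :=
  CategoryWithDuality.dual.map_id _

theorem dualMap_comp {x y z : C} (f : x ⟶ y) (g : y ⟶ z) :
    dualMap (f ≫ g) = dualMap g ≫ dualMap f :=
  CategoryWithDuality.dual.map_comp g.op f.op

theorem bidualMap_naturality {x y : C} (f : x ⟶ y) :
    f ≫ bidualMap y = bidualMap x ≫ dualMap (dualMap f) :=
  CategoryWithDuality.bidual.hom.naturality f

theorem pairing_id_aux {x y : C} (p : x ⟶ dualObj y) : p = 𝟙 x ≫ p ≫ dualMap (𝟙 y) := by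
  rw [dualMap_id, Category.comp_id, Category.id_comp]

theorem pairing_comp_aux {x y x' y' x'' y'' : C} {p : x ⟶ dualObj y} {p' : x' ⟶ dualObj y'}
    {p'' : x'' ⟶ dualObj y''} {a : x ⟶ x'} {b : y ⟶ y'} {a' : x' ⟶ x''} {b' : y' ⟶ y''}
    (h : p = a ≫ p' ≫ dualMap b) (h' : p' = a' ≫ p'' ≫ dualMap b') :
    p = (a ≫ a') ≫ p'' ≫ dualMap (b ≫ b') := by
  rw [h, h', dualMap_comp]
  simp only [Category.assoc]

end Duality

/-! ### Graphs -/

/-- A graph: finite sets of flags and vertices, the map sending a flag to the vertex it is attached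
to, and an involution on the flags. Fixed flags of the involution are the legs, its orbits of
length two are the edges. -/
structure FlagGraph where
  Flag : Type u
  Vert : Type u
  [finiteFlag : Finite Flag]
  [finiteVert : Finite Vert]
  root : Flag → Vert
  inv : Flag → Flag
  inv_inv : ∀ x, inv (inv x) = x

attribute [instance] FlagGraph.finiteFlag FlagGraph.finiteVert

theorem FlagGraph.inv_injective (Γ : FlagGraph.{u}) : Function.Injective Γ.inv :=
  Function.LeftInverse.injective Γ.inv_inv

/-- A morphism of graphs: a map on vertices and a map backwards on flags. The map on flags is
injective, commutes with the involutions and hits all legs (so it is a bijection on legs and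
injective on edges), it is compatible with the attaching maps, and the map on vertices is the
coequalizer of `h, h ∘ τ` on the set of flags outside of the image of the map on flags. -/
structure FlagGraph.Hom (Γ Γ' : FlagGraph.{u}) where
  vert : Γ.Vert → Γ'.Vert
  flag : Γ'.Flag → Γ.Flag
  flag_injective : Function.Injective flag
  inv_flag : ∀ x, Γ.inv (flag x) = flag (Γ'.inv x)
  leg_mem : ∀ x, Γ.inv x = x → x ∈ Set.range flag
  vert_root : ∀ x, vert (Γ.root (flag x)) = Γ'.root x
  vert_surjective : Function.Surjective vert
  vert_eq_iff : ∀ v w, vert v = vert w ↔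
    Relation.EqvGen (fun a b => ∃ x, x ∉ Set.range flag ∧ Γ.root x = a ∧ Γ.root (Γ.inv x) = b) v w

/-- The identity morphism of a graph. -/
def FlagGraph.Hom.id (Γ : FlagGraph.{u}) : FlagGraph.Hom Γ Γ where
  vert := fun v => v
  flag := fun x => x
  flag_injective := fun _ _ h => h
  inv_flag := fun _ => rfl
  leg_mem := fun x _ => ⟨x, rfl⟩
  vert_root := fun _ => rfl
  vert_surjective := fun v => ⟨v, rfl⟩
  vert_eq_iff := fun v w => by
    constructor
    · rintro rfl
      exact Relation.EqvGen.refl _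
    · intro h
      induction h with
      | rel a b h => obtain ⟨x, hx, -⟩ := h; exact absurd ⟨x, rfl⟩ hx
      | refl a => rfl
      | symm a b _ ih => exact ih.symm
      | trans a b c _ _ ih ih' => exact ih.trans ih'

/-- Composition of morphisms of graphs. -/
def FlagGraph.Hom.comp {Γ Γ' Γ'' : FlagGraph.{u}} (f : FlagGraph.Hom Γ Γ')
    (g : FlagGraph.Hom Γ' Γ'') : FlagGraph.Hom Γ Γ'' where
  vert := fun v => g.vert (f.vert v)
  flag := fun x => f.flag (g.flag x)
  flag_injective := fun _ _ h => g.flag_injective (f.flag_injective h)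
  inv_flag := fun x => by rw [f.inv_flag, g.inv_flag]
  leg_mem := fun x hx => by
    obtain ⟨y, rfl⟩ := f.leg_mem x hx
    rw [f.inv_flag] at hx
    obtain ⟨z, rfl⟩ := g.leg_mem y (f.flag_injective hx)
    exact ⟨z, rfl⟩
  vert_root := fun x => by rw [f.vert_root, g.vert_root]
  vert_surjective := g.vert_surjective.comp f.vert_surjective
  vert_eq_iff := fun v w => by
    have lift : ∀ a b, f.vert a = f.vert b → Relation.EqvGen
        (fun a b => ∃ x, x ∉ Set.range (fun x => f.flag (g.flag x)) ∧ Γ.root x = a ∧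
          Γ.root (Γ.inv x) = b) a b := by
      intro a b h
      refine Relation.EqvGen.mono (fun a b h => ?_) _ _ ((f.vert_eq_iff a b).1 h)
      obtain ⟨x, hx, h⟩ := h
      exact ⟨x, fun ⟨y, hy⟩ => hx ⟨_, hy⟩, h⟩
    constructor
    · intro h
      have key : ∀ a' b', Relation.EqvGen (fun a b => ∃ x, x ∉ Set.range g.flag ∧
          Γ'.root x = a ∧ Γ'.root (Γ'.inv x) = b) a' b' → ∀ a b, f.vert a = a' → f.vert b = b' →
          Relation.EqvGen (fun a b => ∃ x, x ∉ Set.range (fun x => f.flag (g.flag x)) ∧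
            Γ.root x = a ∧ Γ.root (Γ.inv x) = b) a b := by
        intro a' b' h
        induction h with
        | rel a' b' h =>
          obtain ⟨x, hx, rfl, rfl⟩ := h
          intro a b ha hb
          refine (lift a (Γ.root (f.flag x)) (by rw [ha, f.vert_root])).trans _ _ _ ?_
          refine Relation.EqvGen.trans _ _ _ (Relation.EqvGen.rel _ _ ⟨f.flag x, ?_, rfl, rfl⟩)
            (lift _ b (by rw [hb, f.inv_flag, f.vert_root]))
          rintro ⟨y, hy⟩
          exact hx ⟨y, f.flag_injective hy⟩
        | refl a' => intro a b ha hb; exact lift a b (ha.trans hb.symm)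
        | symm a' b' _ ih => intro a b ha hb; exact (ih b a hb ha).symm
        | trans a' b' c' _ _ ih ih' =>
          intro a c ha hc
          obtain ⟨b, hb⟩ := f.vert_surjective b'
          exact (ih a b ha hb).trans _ _ _ (ih' b c hb hc)
      exact key _ _ ((g.vert_eq_iff _ _).1 h) v w rfl rfl
    · intro h
      induction h with
      | rel a b h =>
        obtain ⟨x, hx, rfl, rfl⟩ := h
        by_cases hx' : x ∈ Set.range f.flag
        · obtain ⟨y, rfl⟩ := hx'
          rw [f.inv_flag, f.vert_root, f.vert_root]
          refine (g.vert_eq_iff _ _).2 (Relation.EqvGen.rel _ _ ⟨y, ?_, rfl, rfl⟩)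
          rintro ⟨z, rfl⟩
          exact hx ⟨z, rfl⟩
        · rw [(f.vert_eq_iff _ _).2 (Relation.EqvGen.rel _ _ ⟨x, hx', rfl, rfl⟩)]
      | refl a => rfl
      | symm a b _ ih => exact ih.symm
      | trans a b c _ _ ih ih' => exact ih.trans ih'

/-- The number `n(v)` of flags at a vertex. -/
noncomputable def FlagGraph.valence (Γ : FlagGraph.{u}) (v : Γ.Vert) : ℕ :=
  Nat.card {x : Γ.Flag // Γ.root x = v}

/-! ### The category of stable `C`-graphs -/

/-- A stable `C`-graph: a graph with a genus function such that `2 g(v) - 2 + n(v) > 0` for all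
vertices, an object of `C` for every flag, and a pairing `A_x ⟶ (A_y)^∨` for every edge `{x, y}`;
the pairings read off from the two orientations of an edge correspond to each other under
`Hom(x, y^∨) ≅ Hom(y, x^∨)`. -/
structure CGraph (C : Type u) [SmallCategory C] [CategoryWithDuality C] extends FlagGraph.{u} where
  genus : Vert → ℕ
  stable : ∀ v, 0 < 2 * (genus v : ℤ) - 2 + (toFlagGraph.valence v : ℤ)
  color : Flag → C
  pairing : ∀ x y, inv x = y → x ≠ y → (color x ⟶ dualObj (color y))
  pairing_symm : ∀ x y (h : inv x = y) (h' : inv y = x) (hne : x ≠ y),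
    pairing y x h' hne.symm = bidualMap (color y) ≫ dualMap (pairing x y h hne)

variable {C : Type u} [SmallCategory C] [CategoryWithDuality C]

/-- The number `2 g(v) - 2 + n(v)`. -/
noncomputable def CGraph.euler (Γ : CGraph C) (v : Γ.Vert) : ℤ :=
  2 * (Γ.genus v : ℤ) - 2 + (Γ.valence v : ℤ)

/-- A morphism of stable `C`-graphs: a morphism of graphs for which `2g - 2 + n` is additive along
the fibres of the map on vertices, with morphisms `q_x : A_{f^*(x)} ⟶ A_x` compatible with the
pairings. -/
structure CGraph.Hom (Γ Γ' : CGraph C) extends FlagGraph.Hom Γ.toFlagGraph Γ'.toFlagGraph where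
  euler_eq : ∀ v', Γ'.euler v' = ∑ᶠ v : {v : Γ.Vert // vert v = v'}, Γ.euler v.1
  q : ∀ x, Γ.color (flag x) ⟶ Γ'.color x
  pairing_comm : ∀ x y (h : Γ'.inv x = y) (hne : x ≠ y),
    Γ.pairing (flag x) (flag y) ((inv_flag x).trans (congrArg flag h)) (flag_injective.ne hne) =
      q x ≫ Γ'.pairing x y h hne ≫ dualMap (q y)

theorem finsum_fiber {A B D : Type u} [Finite A] [Finite B] (f : A → B) (g : B → D) (e : A → ℤ)
    (d : D) : ∑ᶠ a : {a // g (f a) = d}, e a.1 =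
      ∑ᶠ b : {b // g b = d}, ∑ᶠ a : {a // f a = b.1}, e a.1 := by
  classical
  have := Fintype.ofFinite A
  have := Fintype.ofFinite B
  let φ : {a // g (f a) = d} ≃ Σ b : {b // g b = d}, {a // f a = b.1} :=
    { toFun := fun a => ⟨⟨f a.1, a.2⟩, ⟨a.1, rfl⟩⟩
      invFun := fun p => ⟨p.2.1, by rw [p.2.2]; exact p.1.2⟩
      left_inv := fun a => rfl
      right_inv := by rintro ⟨⟨b, hb⟩, ⟨a, ha⟩⟩; dsimp only at ha; subst ha; rfl }
  simp only [finsum_eq_sum_of_fintype]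
  rw [← Fintype.sum_sigma' (fun (b : {b // g b = d}) (a : {a // f a = b.1}) => e a.1)]
  exact Fintype.sum_equiv φ _ _ (fun _ => rfl)

theorem finsum_fiber_id {A : Type u} (e : A → ℤ) (a : A) :
    e a = ∑ᶠ b : {b : A // b = a}, e b.1 := by
  have : Unique {b : A // b = a} := ⟨⟨⟨a, rfl⟩⟩, fun b => Subtype.ext b.2⟩
  rw [finsum_unique]
  exact (congrArg e (default : {b : A // b = a}).2).symm

/-- The identity morphism of a stable `C`-graph. -/
def CGraph.Hom.id (Γ : CGraph C) : CGraph.Hom Γ Γ where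
  toHom := FlagGraph.Hom.id Γ.toFlagGraph
  euler_eq := fun v => finsum_fiber_id _ v
  q := fun x => 𝟙 (Γ.color x)
  pairing_comm := fun x y h hne => pairing_id_aux (Γ.pairing x y h hne)

/-- Composition of morphisms of stable `C`-graphs. -/
def CGraph.Hom.comp {Γ Γ' Γ'' : CGraph C} (f : CGraph.Hom Γ Γ') (g : CGraph.Hom Γ' Γ'') :
    CGraph.Hom Γ Γ'' where
  toHom := f.toHom.comp g.toHom
  euler_eq := fun v => by
    rw [g.euler_eq]
    simp_rw [f.euler_eq]
    exact (finsum_fiber f.vert g.vert _ v).symm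
  q := fun x => f.q (g.flag x) ≫ g.q x
  pairing_comm := fun x y h hne =>
    pairing_comp_aux (f.pairing_comm (g.flag x) (g.flag y)
      ((g.inv_flag x).trans (congrArg g.flag h)) (g.flag_injective.ne hne))
      (g.pairing_comm x y h hne)

theorem CGraph.Hom.ext' {Γ Γ' : CGraph C} {f g : CGraph.Hom Γ Γ'} (hv : f.vert = g.vert)
    (hf : f.flag = g.flag)
    (hq : ∀ x, f.q x = eqToHom (by rw [hf]) ≫ g.q x) : f = g := by
  obtain ⟨f, _, _, _⟩ := f
  obtain ⟨g, _, _, _⟩ := g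
  obtain ⟨_, _, _, _, _, _, _, _⟩ := f
  obtain ⟨_, _, _, _, _, _, _, _⟩ := g
  dsimp only at hv hf
  subst hv hf
  congr 1
  funext x
  exact (hq x).trans (Category.id_comp _)

/-- The category of stable `C`-graphs. -/
instance : Category.{u} (CGraph C) where
  Hom := CGraph.Hom
  id := CGraph.Hom.id
  comp := CGraph.Hom.comp
  id_comp _ := CGraph.Hom.ext' rfl rfl fun _ => rfl
  comp_id _ := CGraph.Hom.ext' rfl rfl fun _ =>
    (Category.comp_id _).trans (Category.id_comp _).symm
  assoc _ _ _ := CGraph.Hom.ext' rfl rfl fun _ =>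
    (Category.assoc _ _ _).trans (Category.id_comp _).symm

/-- A corolla is a graph with one vertex and no edges. -/
def IsCorolla (C : Type u) [SmallCategory C] [CategoryWithDuality C] :
    ObjectProperty (CGraph C) :=
  fun Γ => (∃! _v : Γ.Vert, True) ∧ ∀ x, Γ.inv x = x

/-- The full subcategory of corollas. -/
abbrev Corolla (C : Type u) [SmallCategory C] [CategoryWithDuality C] :=
  (IsCorolla C).FullSubcategory

/-- The morphisms which do not contract any edge. -/
def nonContracting (C : Type u) [SmallCategory C] [CategoryWithDuality C] :
    MorphismProperty (CGraph C) :=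
  fun _ _ f => Function.Surjective f.flag

instance : (nonContracting C).IsMultiplicative where
  id_mem Γ := fun x => ⟨x, rfl⟩
  comp_mem f g hf hg := fun x => by
    obtain ⟨y, rfl⟩ := hf x
    obtain ⟨z, rfl⟩ := hg y
    exact ⟨z, rfl⟩

/-- The wide subcategory of stable `C`-graphs and non-contracting morphisms. -/
abbrev BijGraph (C : Type u) [SmallCategory C] [CategoryWithDuality C] :=
  WideSubcategory (nonContracting C)

/-- The inclusion of the category of non-contracting morphisms. -/
abbrev bijIncl (C : Type u) [SmallCategory C] [CategoryWithDuality C] : BijGraph C ⥤ CGraph C :=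
  wideSubcategoryInclusion (nonContracting C)

theorem vert_bijective {Γ Γ' : CGraph C} (f : Γ ⟶ Γ') (hf : nonContracting C f) :
    Function.Bijective f.vert := by
  refine ⟨fun v w h => ?_, f.vert_surjective⟩
  have key : ∀ a b, Relation.EqvGen (fun a b => ∃ x, x ∉ Set.range f.flag ∧ Γ.root x = a ∧
      Γ.root (Γ.inv x) = b) a b → a = b := by
    intro a b h
    induction h with
    | rel a b h => obtain ⟨x, hx, -⟩ := h; exact absurd (hf x) hx
    | refl a => rfl
    | symm a b _ ih => exact ih.symm
    | trans a b c _ _ ih ih' => exact ih.trans ih'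
  exact key v w ((f.vert_eq_iff v w).1 h)

/-! ### The corolla of a vertex -/

/-- The corolla `γ(v)` of a vertex `v`, with set of flags the flags at `v`. -/
def CGraph.star (Γ : CGraph C) (v : Γ.Vert) : CGraph C where
  Flag := {x : Γ.Flag // Γ.root x = v}
  Vert := PUnit
  root := fun _ => PUnit.unit
  inv := fun x => x
  inv_inv := fun _ => rfl
  genus := fun _ => Γ.genus v
  stable := fun _ => by
    have h := Γ.stable v
    rwa [FlagGraph.valence, ← Nat.card_congr (Equiv.subtypeUnivEquiv
      (p := fun _ : {x : Γ.Flag // Γ.root x = v} => PUnit.unit.{u + 1} = PUnit.unit)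
      (fun _ => rfl))] at h
  color := fun x => Γ.color x.1
  pairing := fun _ _ h hne => absurd h hne
  pairing_symm := fun _ _ h _ hne => absurd h hne

/-- The corolla of a vertex as an object of the category of corollas. -/
def CGraph.corolla (Γ : CGraph C) (v : Γ.Vert) : Corolla C :=
  ⟨Γ.star v, ⟨PUnit.unit, trivial, fun _ _ => rfl⟩, fun _ => rfl⟩

theorem CGraph.euler_star (Γ : CGraph C) (v : Γ.Vert) (w : (Γ.star v).Vert) :
    (Γ.star v).euler w = Γ.euler v := by
  have : (Γ.star v).valence w = Γ.valence v :=
    Nat.card_congr (Equiv.subtypeUnivEquiv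
      (p := fun _ : {x : Γ.Flag // Γ.root x = v} => PUnit.unit.{u + 1} = w) (fun _ => rfl))
  unfold CGraph.euler
  rw [this]
  rfl

theorem euler_vert {Γ Γ' : CGraph C} (f : Γ ⟶ Γ') (hf : nonContracting C f) (v : Γ.Vert) :
    Γ'.euler (f.vert v) = Γ.euler v := by
  rw [f.euler_eq]
  have : Unique {w : Γ.Vert // f.vert w = f.vert v} :=
    ⟨⟨⟨v, rfl⟩⟩, fun b => Subtype.ext ((vert_bijective f hf).1 b.2)⟩
  rw [finsum_unique]
  exact congrArg Γ.euler ((vert_bijective f hf).1 (default : {w // f.vert w = f.vert v}).2)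

/-- A non-contracting morphism `f : Γ ⟶ Γ'` restricts to morphisms `γ(v) ⟶ γ(f_*(v))`. -/
def starMap {Γ Γ' : CGraph C} (f : Γ ⟶ Γ') (hf : nonContracting C f) (v : Γ.Vert) :
    Γ.star v ⟶ Γ'.star (f.vert v) where
  vert := fun w => w
  flag := fun x => ⟨f.flag x.1, (vert_bijective f hf).1 ((f.vert_root x.1).trans x.2)⟩
  flag_injective := fun _ _ h => Subtype.ext (f.flag_injective (congrArg Subtype.val h))
  inv_flag := fun _ => rfl
  leg_mem := fun x _ => by
    obtain ⟨y, hy⟩ := hf x.1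
    refine ⟨⟨y, ?_⟩, Subtype.ext hy⟩
    rw [← f.vert_root, hy, x.2]
  vert_root := fun _ => rfl
  vert_surjective := fun v => ⟨v, rfl⟩
  vert_eq_iff := fun v w => ⟨fun _ => Relation.EqvGen.refl _, fun _ => rfl⟩
  euler_eq := fun w => by
    refine (CGraph.euler_star Γ' _ w).trans ((euler_vert f hf v).trans ?_)
    exact (CGraph.euler_star Γ v w).symm.trans (finsum_fiber_id (Γ.star v).euler w)
  q := fun x => f.q x.1
  pairing_comm := fun _ _ h hne => absurd h hne

/-- The morphism `γ(v) ⟶ γ(f_*(v))` in the category of corollas. -/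
def corollaMap {Γ Γ' : BijGraph C} (f : Γ ⟶ Γ') (v : Γ.obj.Vert) :
    Γ.obj.corolla v ⟶ Γ'.obj.corolla (f.hom.vert v) :=
  ObjectProperty.homMk (starMap f.hom f.property v)

/-! ### Unordered tensor products -/

section Tensor

variable {E : Type w} [Category.{v} E] [MonoidalCategory E]

/-- The tensor product `X i₁ ⊗ (X i₂ ⊗ ⋯ ⊗ 𝟙_ E)` along a list of indices. -/
def listTensor {I : Type u} (X : I → E) : List I → E
  | [] => 𝟙_ E
  | i :: l => X i ⊗ listTensor X l

/-- Functoriality of `listTensor` in the factors. -/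
def listTensorMap {I : Type u} {X Y : I → E} (f : ∀ i, X i ⟶ Y i) :
    ∀ l : List I, listTensor X l ⟶ listTensor Y l
  | [] => 𝟙 (𝟙_ E)
  | i :: l => f i ⊗ₘ listTensorMap f l

/-- The canonical isomorphism relabelling the indices (an identity in each factor). -/
def listTensorReindex {I J : Type u} (σ : I → J) (Y : J → E) :
    ∀ l : List I, listTensor (fun i => Y (σ i)) l ⟶ listTensor Y (l.map σ)
  | [] => 𝟙 (𝟙_ E)
  | i :: l => Y (σ i) ◁ listTensorReindex σ Y l

/-- The canonical isomorphism given by the associators for the concatenation of two lists. -/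
def listTensorAppend {I : Type u} (X : I → E) (l' : List I) :
    ∀ l : List I, listTensor X l ⊗ listTensor X l' ⟶ listTensor X (l ++ l')
  | [] => (λ_ (listTensor X l')).hom
  | i :: l => (α_ (X i) (listTensor X l) (listTensor X l')).hom ≫ X i ◁ listTensorAppend X l' l

/-- The canonical isomorphism from an iterated tensor product to a single tensor product over the
lexicographically ordered list of pairs, obtained by removing the parentheses. -/
def listTensorFlatten {I : Type u} {J : I → Type u} (X : (Σ i, J i) → E) (m : ∀ i, List (J i)) :
    ∀ l : List I, listTensor (fun i => listTensor (fun j => X ⟨i, j⟩) (m i)) l ⟶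
      listTensor X (l.sigma m)
  | [] => 𝟙 (𝟙_ E)
  | i :: l => (listTensorReindex (Sigma.mk i) X (m i) ⊗ₘ listTensorFlatten X m l) ≫
      listTensorAppend X (l.sigma m) ((m i).map (Sigma.mk i))

theorem swap_naturality_cons {a a' c c' d d' : E} (f : a ⟶ a') {g : c ⟶ c'} {t' : c' ⟶ d'}
    {t : c ⟶ d} {g' : d ⟶ d'} (h : g ≫ t' = t ≫ g') :
    (f ⊗ₘ g) ≫ a' ◁ t' = a ◁ t ≫ (f ⊗ₘ g') := by
  rw [← id_tensorHom, ← id_tensorHom, tensorHom_comp_tensorHom, tensorHom_comp_tensorHom, h,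
    Category.comp_id, Category.id_comp]

/-- The identity of `listTensor X l` for two names `l`, `l'` of the same list. -/
def listTensorCast {I : Type u} (X : I → E) {l l' : List I} (h : l = l') :
    listTensor X l ⟶ listTensor X l' :=
  eqToHom (congrArg (listTensor X) h)

theorem listTensorCast_cons {I : Type u} (X : I → E) {l l' : List I} (h : l = l') (i : I) :
    X i ◁ listTensorCast X h = listTensorCast X (congrArg (List.cons i) h) := by
  subst h
  exact whiskerLeft_id _ _

theorem listTensorMap_id {I : Type u} (X : I → E) : ∀ l : List I,
    listTensorMap (fun i => 𝟙 (X i)) l = 𝟙 (listTensor X l)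
  | [] => rfl
  | i :: l => by
    refine Eq.trans ?_ (id_tensorHom_id (X i) (listTensor X l))
    exact congrArg (𝟙 (X i) ⊗ₘ ·) (listTensorMap_id X l)

theorem listTensorReindex_id {I : Type u} (X : I → E) : ∀ (l : List I) (h : l = l.map (fun i => i)),
    listTensorReindex (fun i => i) X l = listTensorCast X h
  | [], _ => rfl
  | i :: l, h => (congrArg (X i ◁ ·) (listTensorReindex_id X l (List.cons.inj h).2)).trans
      (listTensorCast_cons X _ i)

theorem listTensorMap_comp {I : Type u} {X Y Z : I → E} (f : ∀ i, X i ⟶ Y i)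
    (g : ∀ i, Y i ⟶ Z i) : ∀ l : List I,
    listTensorMap (fun i => f i ≫ g i) l = listTensorMap f l ≫ listTensorMap g l
  | [] => (Category.id_comp _).symm
  | i :: l => (congrArg (f i ≫ g i ⊗ₘ ·) (listTensorMap_comp f g l)).trans
      (tensorHom_comp_tensorHom _ _ _ _).symm

theorem listTensorMap_reindex {I J : Type u} (σ : I → J) {Y Z : J → E} (g : ∀ j, Y j ⟶ Z j) :
    ∀ l : List I, listTensorReindex σ Y l ≫ listTensorMap g (l.map σ) =
      listTensorMap (fun i => g (σ i)) l ≫ listTensorReindex σ Z l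
  | [] => rfl
  | i :: l => (swap_naturality_cons (g (σ i)) (listTensorMap_reindex σ g l).symm).symm

theorem listTensorReindex_comp {I J K : Type u} (σ : I → J) (τ : J → K) (Z : K → E) :
    ∀ (l : List I) (h : (l.map σ).map τ = l.map (fun i => τ (σ i))),
    listTensorReindex σ (fun j => Z (τ j)) l ≫ listTensorReindex τ Z (l.map σ) ≫
      listTensorCast Z h = listTensorReindex (fun i => τ (σ i)) Z l
  | [], _ => (Category.id_comp _).trans (Category.id_comp _)
  | i :: l, h => by
    have e := congrArg (Z (τ (σ i)) ◁ ·) (listTensorReindex_comp σ τ Z l (List.cons.inj h).2)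
    simp only [MonoidalCategory.whiskerLeft_comp, listTensorCast_cons] at e
    exact e

variable [SymmetricCategory E]

/-- Interchanging two neighbouring factors by means of the symmetry. -/
def listTensorSwap {I : Type u} (X : I → E) (a b : I) (l₂ : List I) :
    ∀ l₁ : List I, listTensor X (l₁ ++ a :: b :: l₂) ⟶ listTensor X (l₁ ++ b :: a :: l₂)
  | [] => (α_ (X a) (X b) (listTensor X l₂)).inv ≫ (β_ (X a) (X b)).hom ▷ listTensor X l₂ ≫
      (α_ (X b) (X a) (listTensor X l₂)).hom
  | i :: l₁ => X i ◁ listTensorSwap X a b l₂ l₁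

theorem swap_naturality_nil {a b c a' b' c' : E} (f : a ⟶ a') (g : b ⟶ b') (h : c ⟶ c') :
    (f ⊗ₘ (g ⊗ₘ h)) ≫ (α_ a' b' c').inv ≫ (β_ a' b').hom ▷ c' ≫ (α_ b' a' c').hom =
      ((α_ a b c).inv ≫ (β_ a b).hom ▷ c ≫ (α_ b a c).hom) ≫ (g ⊗ₘ (f ⊗ₘ h)) := by
  rw [associator_inv_naturality_assoc]
  simp only [Category.assoc, ← associator_naturality, ← tensorHom_id,
    tensorHom_comp_tensorHom_assoc, Category.comp_id, Category.id_comp, BraidedCategory.braiding_naturality]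

theorem listTensorMap_swap {I : Type u} {X Y : I → E} (f : ∀ i, X i ⟶ Y i) (a b : I)
    (l₂ : List I) : ∀ l₁ : List I, listTensorMap f (l₁ ++ a :: b :: l₂) ≫
      listTensorSwap Y a b l₂ l₁ = listTensorSwap X a b l₂ l₁ ≫ listTensorMap f (l₁ ++ b :: a :: l₂)
  | [] => swap_naturality_nil (f a) (f b) (listTensorMap f l₂)
  | i :: l₁ => swap_naturality_cons (f i) (listTensorMap_swap f a b l₂ l₁)

theorem listTensorReindex_swap {I J : Type u} (σ : I → J) (Y : J → E) (a b : I) (l₂ : List I) :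
    ∀ (l₁ : List I) (h : l₁.map σ ++ σ a :: σ b :: l₂.map σ = (l₁ ++ a :: b :: l₂).map σ)
      (h' : (l₁ ++ b :: a :: l₂).map σ = l₁.map σ ++ σ b :: σ a :: l₂.map σ),
      listTensorSwap (fun i => Y (σ i)) a b l₂ l₁ ≫ listTensorReindex σ Y (l₁ ++ b :: a :: l₂) ≫
        listTensorCast Y h' =
      (listTensorReindex σ Y (l₁ ++ a :: b :: l₂) ≫ listTensorCast Y h.symm) ≫
        listTensorSwap Y (σ a) (σ b) (l₂.map σ) (l₁.map σ)
  | [], _, _ => by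
    have e := swap_naturality_nil (𝟙 (Y (σ a))) (𝟙 (Y (σ b))) (listTensorReindex σ Y l₂)
    simp only [id_tensorHom] at e
    refine (congrArg _ (Category.comp_id _)).trans (e.symm.trans ?_)
    exact congrArg (· ≫ _) (Category.comp_id _).symm
  | i :: l₁, h, h' => by
    have e := listTensorReindex_swap σ Y a b l₂ l₁ (List.cons.inj h).2 (List.cons.inj h').2
    have e' := congrArg (Y (σ i) ◁ ·) e
    simp only [MonoidalCategory.whiskerLeft_comp, listTensorCast_cons] at e'
    exact e'

/-- A list which enumerates every element of `I` exactly once. -/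
def IsOrdering {I : Type u} (l : List I) : Prop := l.Nodup ∧ ∀ i, i ∈ l

/-- The orderings of `I`. -/
abbrev Enumeration (I : Type u) := {l : List I // IsOrdering l}

/-- An ordering `l₁ ++ a :: b :: l₂` with a pair of neighbouring elements `a, b` singled out. -/
structure MarkedOrdering (I : Type u) where
  l₁ : List I
  a : I
  b : I
  l₂ : List I
  isOrdering : IsOrdering (l₁ ++ a :: b :: l₂)

theorem IsOrdering.perm {I : Type u} {l l' : List I} (h : IsOrdering l) (p : l.Perm l') :
    IsOrdering l' :=
  ⟨p.nodup_iff.1 h.1, fun i => p.mem_iff.1 (h.2 i)⟩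

theorem IsOrdering.map {I J : Type u} {σ : I → J} (hσ : Function.Bijective σ) {l : List I}
    (h : IsOrdering l) : IsOrdering (l.map σ) :=
  ⟨h.1.map hσ.1, fun j => by
    obtain ⟨i, rfl⟩ := hσ.2 j
    exact List.mem_map_of_mem (h.2 i)⟩

theorem IsOrdering.sigma {I : Type u} {J : I → Type u} {l : List I} {m : ∀ i, List (J i)}
    (h : IsOrdering l) (hm : ∀ i, IsOrdering (m i)) : IsOrdering (l.sigma m) :=
  ⟨h.1.sigma fun i => (hm i).1, fun p => List.mem_sigma.2 ⟨h.2 p.1, (hm p.1).2 p.2⟩⟩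

/-- The diagram of the ordered tensor products of `X` for all orderings of `I`, with the
identifications given by interchanging neighbouring factors. -/
def tensorIndex {I : Type u} (X : I → E) :
    MultispanIndex (C := E) (J :=
      { L := MarkedOrdering I
        R := Enumeration I
        fst := fun s => ⟨s.l₁ ++ s.a :: s.b :: s.l₂, s.isOrdering⟩
        snd := fun s => ⟨s.l₁ ++ s.b :: s.a :: s.l₂,
          s.isOrdering.perm ((List.Perm.swap s.b s.a s.l₂).append_left s.l₁)⟩ }) where
  left s := listTensor X (s.l₁ ++ s.a :: s.b :: s.l₂)
  right l := listTensor X l.1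
  fst _ := 𝟙 _
  snd s := listTensorSwap X s.a s.b s.l₂ s.l₁

variable [HasColimitsOfSize.{u, u} E]

/-- The unordered tensor product `⨂_{i ∈ I} X i` of a family indexed by a finite set `I`: the
colimit of the ordered tensor products over all orderings of `I`, any two of which are identified
by means of the symmetry of `E`. -/
noncomputable def unorderedTensor {I : Type u} (X : I → E) : E := multicoequalizer (tensorIndex X)

/-- The canonical map from the tensor product in a given order to the unordered one. -/
noncomputable def unorderedTensor.ι {I : Type u} (X : I → E) (l : List I) (hl : IsOrdering l) :
    listTensor X l ⟶ unorderedTensor X :=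
  Multicoequalizer.π (tensorIndex X) ⟨l, hl⟩

theorem unorderedTensor.hom_ext {I : Type u} {X : I → E} {Z : E} {f g : unorderedTensor X ⟶ Z}
    (h : ∀ l hl, unorderedTensor.ι X l hl ≫ f = unorderedTensor.ι X l hl ≫ g) : f = g :=
  Multicoequalizer.hom_ext _ _ _ fun l => h l.1 l.2

theorem unorderedTensor.swap {I : Type u} (X : I → E) (l₁ : List I) (a b : I) (l₂ : List I)
    (h : IsOrdering (l₁ ++ a :: b :: l₂)) (h' : IsOrdering (l₁ ++ b :: a :: l₂)) :
    listTensorSwap X a b l₂ l₁ ≫ unorderedTensor.ι X (l₁ ++ b :: a :: l₂) h' =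
      unorderedTensor.ι X (l₁ ++ a :: b :: l₂) h := by
  have := Multicoequalizer.condition (tensorIndex X) ⟨l₁, a, b, l₂, h⟩
  exact this.symm.trans (Category.id_comp _)

theorem listTensorCast_ι {I : Type u} (X : I → E) {l l' : List I} (h : l = l')
    (hl : IsOrdering l) (hl' : IsOrdering l') :
    listTensorCast X h ≫ unorderedTensor.ι X l' hl' = unorderedTensor.ι X l hl := by
  subst h
  exact Category.id_comp _

/-- The map of unordered tensor products induced by a bijection of index sets and a morphism in
each factor. -/
noncomputable def unorderedTensor.map {I J : Type u} {X : I → E} {Y : J → E} (σ : I → J)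
    (hσ : Function.Bijective σ) (f : ∀ i, X i ⟶ Y (σ i)) : unorderedTensor X ⟶ unorderedTensor Y :=
  Multicoequalizer.desc (tensorIndex X) _
    (fun l => listTensorMap f l.1 ≫ listTensorReindex σ Y l.1 ≫
      unorderedTensor.ι Y (l.1.map σ) (l.2.map hσ))
    (fun s => by
      obtain ⟨l₁, a, b, l₂, hl⟩ := s
      have hl' : IsOrdering (l₁ ++ b :: a :: l₂) :=
        hl.perm ((List.Perm.swap b a l₂).append_left l₁)
      have h : l₁.map σ ++ σ a :: σ b :: l₂.map σ = (l₁ ++ a :: b :: l₂).map σ := by simp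
      have h' : (l₁ ++ b :: a :: l₂).map σ = l₁.map σ ++ σ b :: σ a :: l₂.map σ := by simp
      have k : IsOrdering (l₁.map σ ++ σ a :: σ b :: l₂.map σ) := by rw [h]; exact hl.map hσ
      have k' : IsOrdering (l₁.map σ ++ σ b :: σ a :: l₂.map σ) := by rw [← h']; exact hl'.map hσ
      have e₁ := listTensorMap_swap f a b l₂ l₁
      have e₂ := listTensorReindex_swap σ Y a b l₂ l₁ h h'
      have e₃ := unorderedTensor.swap Y (l₁.map σ) (σ a) (σ b) (l₂.map σ) k k'
      have e₄ := listTensorCast_ι Y h' (hl'.map hσ) k'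
      have e₅ := listTensorCast_ι Y h.symm (hl.map hσ) k
      refine (Category.id_comp _).trans ?_
      change listTensorMap f (l₁ ++ a :: b :: l₂) ≫ listTensorReindex σ Y (l₁ ++ a :: b :: l₂) ≫
        unorderedTensor.ι Y _ (hl.map hσ) = listTensorSwap X a b l₂ l₁ ≫
        listTensorMap f (l₁ ++ b :: a :: l₂) ≫ listTensorReindex σ Y (l₁ ++ b :: a :: l₂) ≫
        unorderedTensor.ι Y _ (hl'.map hσ)
      rw [← reassoc_of% e₁, ← e₄, ← e₅, ← e₃]
      have e₆ := congrArg (listTensorMap f (l₁ ++ a :: b :: l₂) ≫ · ≫ unorderedTensor.ι Y _ k') e₂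
      simp only [Category.assoc] at e₆
      exact e₆.symm)

theorem unorderedTensor.ι_map {I J : Type u} {X : I → E} {Y : J → E} (σ : I → J)
    (hσ : Function.Bijective σ) (f : ∀ i, X i ⟶ Y (σ i)) (l : List I) (hl : IsOrdering l) :
    unorderedTensor.ι X l hl ≫ unorderedTensor.map σ hσ f =
      listTensorMap f l ≫ listTensorReindex σ Y l ≫ unorderedTensor.ι Y (l.map σ) (hl.map hσ) :=
  Multicoequalizer.π_desc _ _ _ _ _

theorem unorderedTensor.map_id {I : Type u} (X : I → E)
    (h : Function.Bijective (fun i : I => i)) :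
    unorderedTensor.map (fun i => i) h (fun i => 𝟙 (X i)) = 𝟙 (unorderedTensor X) :=
  unorderedTensor.hom_ext fun l hl => by
    have e : l = l.map (fun i => i) := (List.map_id' l).symm
    rw [unorderedTensor.ι_map, listTensorMap_id, Category.comp_id, Category.id_comp,
      listTensorReindex_id X l e, listTensorCast_ι X e hl]

theorem unorderedTensor.map_comp {I J K : Type u} {X : I → E} {Y : J → E} {Z : K → E}
    (σ : I → J) (hσ : Function.Bijective σ) (f : ∀ i, X i ⟶ Y (σ i))
    (τ : J → K) (hτ : Function.Bijective τ) (g : ∀ j, Y j ⟶ Z (τ j))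
    (h : Function.Bijective (fun i => τ (σ i))) :
    unorderedTensor.map (fun i => τ (σ i)) h (fun i => f i ≫ g (σ i)) =
      unorderedTensor.map σ hσ f ≫ unorderedTensor.map τ hτ g :=
  unorderedTensor.hom_ext fun l hl => by
    have e : (l.map σ).map τ = l.map (fun i => τ (σ i)) := List.map_map
    rw [← Category.assoc, unorderedTensor.ι_map, unorderedTensor.ι_map, Category.assoc,
      Category.assoc, unorderedTensor.ι_map, ← Category.assoc (listTensorReindex σ Y l),
      listTensorMap_reindex σ g l, ← listTensorReindex_comp σ τ Z l e, listTensorMap_comp,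
      ← listTensorCast_ι Z e ((hl.map hσ).map hτ) (hl.map h)]
    simp only [Category.assoc]

end Tensor

/-! ### Smallness of the category of stable `C`-graphs -/

/-- A stable `C`-graph whose flags and vertices are the elements of `Fin n` and `Fin m`. -/
structure GraphCode (C : Type u) [SmallCategory C] [CategoryWithDuality C] where
  n : ℕ
  m : ℕ
  root : ULift.{u} (Fin n) → ULift.{u} (Fin m)
  inv : ULift.{u} (Fin n) → ULift.{u} (Fin n)
  inv_inv : ∀ x, inv (inv x) = x
  genus : ULift.{u} (Fin m) → ℕ
  stable : ∀ v, 0 < 2 * (genus v : ℤ) - 2 + ((FlagGraph.mk _ _ root inv inv_inv).valence v : ℤ)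
  color : ULift.{u} (Fin n) → C
  pairing : ∀ x y, inv x = y → x ≠ y → (color x ⟶ dualObj (color y))
  pairing_symm : ∀ x y (h : inv x = y) (h' : inv y = x) (hne : x ≠ y),
    pairing y x h' hne.symm = bidualMap (color y) ≫ dualMap (pairing x y h hne)

/-- The stable `C`-graph given by a code. -/
def GraphCode.toCGraph (c : GraphCode C) : CGraph C where
  Flag := ULift.{u} (Fin c.n)
  Vert := ULift.{u} (Fin c.m)
  root := c.root
  inv := c.inv
  inv_inv := c.inv_inv
  genus := c.genus
  stable := c.stable
  color := c.color
  pairing := c.pairing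
  pairing_symm := c.pairing_symm

theorem valence_relabel {Γ Γ' : FlagGraph.{u}} (e : Γ'.Flag ≃ Γ.Flag) (e' : Γ.Vert ≃ Γ'.Vert)
    (h : ∀ x, e' (Γ.root (e x)) = Γ'.root x) (v : Γ.Vert) : Γ'.valence (e' v) = Γ.valence v :=
  Nat.card_congr (e.subtypeEquiv fun x => by rw [← h x, e'.apply_eq_iff_eq])

/-- Relabelling the flags and the vertices of a stable `C`-graph. -/
def CGraph.relabel (Γ : CGraph C) {F V : Type u} [Finite F] [Finite V] (e : F ≃ Γ.Flag)
    (e' : Γ.Vert ≃ V) : CGraph C where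
  Flag := F
  Vert := V
  root := fun x => e' (Γ.root (e x))
  inv := fun x => e.symm (Γ.inv (e x))
  inv_inv := fun x => by simp [Γ.inv_inv]
  genus := fun v => Γ.genus (e'.symm v)
  stable := fun v => by
    obtain ⟨v, rfl⟩ := e'.surjective v
    rw [valence_relabel (Γ := Γ.toFlagGraph) (Γ' := ⟨F, V, _, _, _⟩) e e' (fun _ => rfl) v,
      e'.symm_apply_apply]
    exact Γ.stable v
  color := fun x => Γ.color (e x)
  pairing := fun x y h hne => Γ.pairing (e x) (e y) ((e.symm_apply_eq).1 h) (e.injective.ne hne)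
  pairing_symm := fun _ _ _ _ _ => Γ.pairing_symm _ _ _ _ _

/-- The morphism of stable `C`-graphs given by a relabelling of flags and vertices. -/
def CGraph.homOfEquiv {Γ Γ' : CGraph C} (e : Γ'.Flag ≃ Γ.Flag) (e' : Γ.Vert ≃ Γ'.Vert)
    (hroot : ∀ x, e' (Γ.root (e x)) = Γ'.root x) (hinv : ∀ x, Γ.inv (e x) = e (Γ'.inv x))
    (hgenus : ∀ v, Γ'.genus (e' v) = Γ.genus v) (q : ∀ x, Γ.color (e x) ⟶ Γ'.color x)
    (hq : ∀ x y (h : Γ'.inv x = y) (hne : x ≠ y),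
      Γ.pairing (e x) (e y) ((hinv x).trans (congrArg e h)) (e.injective.ne hne) =
        q x ≫ Γ'.pairing x y h hne ≫ dualMap (q y)) : Γ ⟶ Γ' where
  vert := e'
  flag := e
  flag_injective := e.injective
  inv_flag := hinv
  leg_mem := fun x _ => e.surjective x
  vert_root := hroot
  vert_surjective := e'.surjective
  vert_eq_iff := fun v w => by
    constructor
    · intro h
      rw [e'.injective h]
      exact Relation.EqvGen.refl _
    · intro h
      induction h with
      | rel a b h => obtain ⟨x, hx, -⟩ := h; exact absurd (e.surjective x) hx
      | refl a => rfl
      | symm a b _ ih => exact ih.symm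
      | trans a b c _ _ ih ih' => exact ih.trans ih'
  euler_eq := fun v' => by
    obtain ⟨v, rfl⟩ := e'.surjective v'
    have : Unique {w : Γ.Vert // e' w = e' v} :=
      ⟨⟨⟨v, rfl⟩⟩, fun b => Subtype.ext (e'.injective b.2)⟩
    rw [finsum_unique]
    have h := e'.injective (default : {w : Γ.Vert // e' w = e' v}).2
    rw [h, CGraph.euler, CGraph.euler, valence_relabel e e' hroot v, hgenus]
  q := q
  pairing_comm := hq

theorem pairing_congr (Γ : CGraph C) {x y x' y' : Γ.Flag} (hx : x = x') (hy : y = y')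
    (h : Γ.inv x = y) (hne : x ≠ y) (h' : Γ.inv x' = y') (hne' : x' ≠ y') :
    Γ.pairing x y h hne = eqToHom (congrArg Γ.color hx) ≫ Γ.pairing x' y' h' hne' ≫
      dualMap (eqToHom (congrArg Γ.color hy)) := by
  subst hx hy
  exact pairing_id_aux _

theorem relabel_iso (Γ : CGraph C) {F V : Type u} [Finite F] [Finite V] (e : F ≃ Γ.Flag)
    (e' : Γ.Vert ≃ V) : Nonempty ((⟨Γ⟩ : BijGraph C) ≅ ⟨Γ.relabel e e'⟩) := by
  let f : Γ ⟶ Γ.relabel e e' := CGraph.homOfEquiv (Γ' := Γ.relabel e e') e e' (fun _ => rfl)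
    (fun x => (e.apply_symm_apply _).symm) (fun v => congrArg Γ.genus (e'.symm_apply_apply v))
    (fun x => 𝟙 (Γ.color (e x))) (fun x y h hne => pairing_id_aux _)
  let g : Γ.relabel e e' ⟶ Γ := CGraph.homOfEquiv (Γ := Γ.relabel e e') e.symm e'.symm
    (fun x => by
      change e'.symm (e' (Γ.root (e (e.symm x)))) = _
      rw [e'.symm_apply_apply, e.apply_symm_apply])
    (fun x => by
      change e.symm (Γ.inv (e (e.symm x))) = e.symm (Γ.inv x)
      rw [e.apply_symm_apply])
    (fun _ => rfl)
    (fun x => eqToHom (congrArg Γ.color (e.apply_symm_apply x)))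
    (fun x y h hne => pairing_congr Γ (e.apply_symm_apply x) (e.apply_symm_apply y) _ _ h hne)
  refine ⟨WideSubcategory.isoMk (P := nonContracting C) ⟨f, g, ?_, ?_⟩ e.surjective
    e.symm.surjective⟩
  · refine CGraph.Hom.ext' (funext e'.symm_apply_apply) (funext e.apply_symm_apply) fun x => ?_
    exact (Category.id_comp _).trans (Category.comp_id _).symm
  · refine CGraph.Hom.ext' (funext e'.apply_symm_apply) (funext e.symm_apply_apply) fun x => rfl

theorem exists_code (Γ : BijGraph C) : ∃ c : GraphCode C, Nonempty (Γ ≅ ⟨c.toCGraph⟩) := by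
  obtain ⟨n, ⟨e⟩⟩ := Finite.exists_equiv_fin Γ.obj.Flag
  obtain ⟨m, ⟨e'⟩⟩ := Finite.exists_equiv_fin Γ.obj.Vert
  let Γ' := Γ.obj.relabel (Equiv.ulift.{u}.trans e.symm) (e'.trans Equiv.ulift.{u}.symm)
  exact ⟨⟨n, m, Γ'.root, Γ'.inv, Γ'.inv_inv, Γ'.genus, Γ'.stable, Γ'.color, Γ'.pairing,
    Γ'.pairing_symm⟩, relabel_iso Γ.obj _ _⟩

instance : EssentiallySmall.{u} (BijGraph C) := by
  refine (essentiallySmall_iff _).2 ⟨?_, inferInstance⟩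
  refine small_of_surjective (α := GraphCode C)
    (f := fun c => (toSkeleton (⟨c.toCGraph⟩ : BijGraph C))) fun X => ?_
  obtain ⟨c, ⟨i⟩⟩ := exists_code ((fromSkeleton (BijGraph C)).obj X)
  refine ⟨c, ?_⟩
  exact toSkeleton_eq_iff.2 ⟨i.symm⟩

/-! ### The endofunctor -/

section Monad

variable {E : Type w} [Category.{v} E] [MonoidalCategory E] [SymmetricCategory E]
  [HasColimitsOfSize.{u, u} E]

/-- The extension of a functor `V` on corollas to the category of stable `C`-graphs and
non-contracting morphisms, `V(Γ) = ⨂_{v} V(γ(v))`. -/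
noncomputable def extend (V : Corolla C ⥤ E) : BijGraph C ⥤ E where
  obj Γ := unorderedTensor fun v : Γ.obj.Vert => V.obj (Γ.obj.corolla v)
  map f := unorderedTensor.map f.hom.vert (vert_bijective f.hom f.property)
    fun v => V.map (corollaMap f v)
  map_id Γ := by
    refine Eq.trans ?_ (unorderedTensor.map_id _ Function.bijective_id)
    exact congrArg (unorderedTensor.map _ _) (funext fun v => V.map_id _)
  map_comp {Γ₁ Γ₂ Γ₃} f g := by
    refine Eq.trans ?_ (unorderedTensor.map_comp f.hom.vert (vert_bijective f.hom f.property) _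
      g.hom.vert (vert_bijective g.hom g.property) _
      ((vert_bijective g.hom g.property).comp (vert_bijective f.hom f.property)))
    exact congrArg (unorderedTensor.map _ _) (funext fun v => V.map_comp (corollaMap f v)
      (corollaMap g (f.hom.vert v)))

/-- Functoriality of the extension: a natural transformation acts on every tensor factor. -/
noncomputable def extendMap {V W : Corolla C ⥤ E} (α : V ⟶ W) : extend V ⟶ extend W where
  app Γ := unorderedTensor.map (fun v => v) Function.bijective_id
    fun v => α.app (Γ.obj.corolla v)
  naturality {Γ Γ'} f := by
    have hf := vert_bijective f.hom f.property
    refine (unorderedTensor.map_comp f.hom.vert hf _ (fun v => v) Function.bijective_id _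
      hf).symm.trans (Eq.trans ?_ (unorderedTensor.map_comp (fun v => v) Function.bijective_id _
      f.hom.vert hf _ hf))
    exact congrArg (unorderedTensor.map _ _) (funext fun v => α.naturality (corollaMap f v))

/-- The slice category over `γ`: its objects are stable `C`-graphs with a morphism to `γ`, its
morphisms are the non-contracting morphisms over `γ`. -/
abbrev Slice (γ : CGraph C) := CostructuredArrow (bijIncl C) γ

instance hasColimitsOfShape_slice (γ : CGraph C) : HasColimitsOfShape (Slice γ) E :=
  hasColimitsOfShape_of_essentiallySmall.{u} (Slice γ) E

/-- The diagram `Γ ↦ V(Γ)` on the slice category over `γ`. -/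
noncomputable abbrev sliceDiagram (V : Corolla C ⥤ E) (γ : CGraph C) : Slice γ ⥤ E :=
  CostructuredArrow.proj (bijIncl C) γ ⋙ extend V

/-- The canonical map from `V(Γ)` to the colimit, for a morphism `p : Γ ⟶ γ`. -/
noncomputable def sliceι (V : Corolla C ⥤ E) {γ : CGraph C} (Γ : BijGraph C) (p : Γ.obj ⟶ γ) :
    (extend V).obj Γ ⟶ colimit (sliceDiagram V γ) :=
  colimit.ι (sliceDiagram V γ) (CostructuredArrow.mk (S := bijIncl C) p)

theorem sliceι_naturality (V : Corolla C ⥤ E) {γ : CGraph C} {Γ Γ' : BijGraph C} (f : Γ ⟶ Γ')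
    (p' : Γ'.obj ⟶ γ) : (extend V).map f ≫ sliceι V Γ' p' = sliceι V Γ (f.hom ≫ p') :=
  colimit.w (sliceDiagram V γ) (CostructuredArrow.homMk f rfl :
    CostructuredArrow.mk (S := bijIncl C) (Y := Γ) (f.hom ≫ p') ⟶ CostructuredArrow.mk (Y := Γ') p')

theorem slice_hom_ext {V : Corolla C ⥤ E} {γ : CGraph C} {Z : E}
    {f g : colimit (sliceDiagram V γ) ⟶ Z}
    (h : ∀ (Γ : BijGraph C) (p : Γ.obj ⟶ γ), sliceι V Γ p ≫ f = sliceι V Γ p ≫ g) : f = g :=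
  colimit.hom_ext fun X => h X.left X.hom

/-- Maps out of the colimit are compatible families of maps out of the `V(Γ)`. -/
noncomputable def sliceDesc (V : Corolla C ⥤ E) {γ : CGraph C} {Z : E}
    (k : ∀ (Γ : BijGraph C), (Γ.obj ⟶ γ) → ((extend V).obj Γ ⟶ Z))
    (hk : ∀ (Γ Γ' : BijGraph C) (f : Γ ⟶ Γ') (p' : Γ'.obj ⟶ γ),
      (extend V).map f ≫ k Γ' p' = k Γ (f.hom ≫ p')) : colimit (sliceDiagram V γ) ⟶ Z :=
  colimit.desc (sliceDiagram V γ) (Cocone.mk Z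
    { app := fun X => k X.left X.hom
      naturality := fun X Y f => by
        refine Eq.trans (hk _ _ f.left Y.hom) (Eq.trans ?_ (Category.comp_id _).symm)
        exact congrArg (k X.left) (CostructuredArrow.w f) })

theorem sliceι_desc (V : Corolla C ⥤ E) {γ : CGraph C} {Z : E}
    (k : ∀ (Γ : BijGraph C), (Γ.obj ⟶ γ) → ((extend V).obj Γ ⟶ Z))
    (hk : ∀ (Γ Γ' : BijGraph C) (f : Γ ⟶ Γ') (p' : Γ'.obj ⟶ γ),
      (extend V).map f ≫ k Γ' p' = k Γ (f.hom ≫ p')) (Γ : BijGraph C) (p : Γ.obj ⟶ γ) :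
    sliceι V Γ p ≫ sliceDesc V k hk = k Γ p :=
  colimit.ι_desc _ _

/-- The map of colimits induced by a morphism `f : γ ⟶ γ'`, that is by the functor
`(Γ ⟶ γ) ↦ (Γ ⟶ γ ⟶ γ')` between the slice categories. -/
noncomputable def sliceMap (V : Corolla C ⥤ E) {γ γ' : CGraph C} (f : γ ⟶ γ') :
    colimit (sliceDiagram V γ) ⟶ colimit (sliceDiagram V γ') :=
  sliceDesc V (fun Γ p => sliceι V Γ (p ≫ f)) fun _ _ g p' => by
    rw [sliceι_naturality, Category.assoc]

theorem sliceι_map (V : Corolla C ⥤ E) {γ γ' : CGraph C} (f : γ ⟶ γ') (Γ : BijGraph C)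
    (p : Γ.obj ⟶ γ) : sliceι V Γ p ≫ sliceMap V f = sliceι V Γ (p ≫ f) :=
  sliceι_desc _ _ _ _ _

/-- The functor `γ ↦ colim_{Γ → γ} V(Γ)` on corollas. -/
noncomputable def freeModularObj (V : Corolla C ⥤ E) : Corolla C ⥤ E where
  obj γ := colimit (sliceDiagram V γ.obj)
  map f := sliceMap V f.hom
  map_id γ := slice_hom_ext fun Γ p => by
    rw [sliceι_map, Category.comp_id]
    exact congrArg (sliceι V Γ) (Category.comp_id p)
  map_comp f g := slice_hom_ext fun Γ p => by
    rw [← Category.assoc, sliceι_map, sliceι_map, sliceι_map, Category.assoc]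
    rfl

/-- The map of colimits induced by a natural transformation. -/
noncomputable def sliceTrans {V W : Corolla C ⥤ E} (α : V ⟶ W) (γ : CGraph C) :
    colimit (sliceDiagram V γ) ⟶ colimit (sliceDiagram W γ) :=
  sliceDesc V (fun Γ p => (extendMap α).app Γ ≫ sliceι W Γ p) fun _ _ f p' => by
    rw [← Category.assoc, (extendMap α).naturality, Category.assoc, sliceι_naturality]

theorem sliceι_trans {V W : Corolla C ⥤ E} (α : V ⟶ W) {γ : CGraph C} (Γ : BijGraph C)
    (p : Γ.obj ⟶ γ) : sliceι V Γ p ≫ sliceTrans α γ = (extendMap α).app Γ ≫ sliceι W Γ p :=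
  sliceι_desc _ _ _ _ _

theorem extendMap_id (V : Corolla C ⥤ E) (Γ : BijGraph C) :
    (extendMap (𝟙 V)).app Γ = 𝟙 ((extend V).obj Γ) :=
  unorderedTensor.map_id _ Function.bijective_id

theorem extendMap_comp {U V W : Corolla C ⥤ E} (α : U ⟶ V) (β : V ⟶ W) (Γ : BijGraph C) :
    (extendMap (α ≫ β)).app Γ = (extendMap α).app Γ ≫ (extendMap β).app Γ :=
  unorderedTensor.map_comp (fun v => v) Function.bijective_id _
    (fun v => v) Function.bijective_id _ Function.bijective_id

/-- The endofunctor `𝓜` of the category of stable `C𝕊`-modules,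
`𝓜 V (γ) = colim_{Γ → γ} V(Γ)`. -/
noncomputable def freeModular (C : Type u) [SmallCategory C] [CategoryWithDuality C]
    (E : Type w) [Category.{v} E] [MonoidalCategory E] [SymmetricCategory E]
    [HasColimitsOfSize.{u, u} E] : (Corolla C ⥤ E) ⥤ (Corolla C ⥤ E) where
  obj V := freeModularObj V
  map {V W} α :=
    { app := fun γ => sliceTrans α γ.obj
      naturality := fun γ γ' f => slice_hom_ext fun Γ p => by
        change sliceι V Γ p ≫ sliceMap V f.hom ≫ sliceTrans α γ'.obj =
          sliceι V Γ p ≫ sliceTrans α γ.obj ≫ sliceMap W f.hom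
        rw [← Category.assoc, ← Category.assoc, sliceι_map, sliceι_trans, sliceι_trans,
          Category.assoc, sliceι_map] }
  map_id V := NatTrans.ext (funext fun γ => slice_hom_ext fun Γ p => by
    refine (sliceι_trans _ _ _).trans ?_
    rw [extendMap_id]
    exact (Category.id_comp _).trans (Category.comp_id _).symm)
  map_comp {U V W} α β := NatTrans.ext (funext fun γ => slice_hom_ext fun Γ p => by
    change sliceι U Γ p ≫ sliceTrans (α ≫ β) γ.obj =
      sliceι U Γ p ≫ sliceTrans α γ.obj ≫ sliceTrans β γ.obj
    rw [← Category.assoc, sliceι_trans, sliceι_trans, extendMap_comp, Category.assoc,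
      Category.assoc, sliceι_trans])

/-! ### The unit -/

/-- For a corolla `γ` with vertex `v`, the canonical isomorphism `γ ⟶ γ(v)`. -/
def toStar (γ : Corolla C) (v : γ.obj.Vert) : γ ⟶ γ.obj.corolla v :=
  have hv : ∀ w, w = v := fun _ => γ.property.1.unique trivial trivial
  ObjectProperty.homMk (CGraph.homOfEquiv (Γ := γ.obj) (Γ' := γ.obj.star v)
    (Equiv.subtypeUnivEquiv fun x => hv (γ.obj.root x))
    ⟨fun _ => PUnit.unit, fun _ => v, fun t => (hv t).symm, fun _ => rfl⟩
    (fun _ => rfl) (fun x => γ.property.2 x.1) (fun _ => congrArg γ.obj.genus (hv _).symm)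
    (fun x => 𝟙 (γ.obj.color x.1)) (fun _ _ h hne => absurd h hne))

/-- The component `V(γ) ⟶ 𝓜 V(γ)` of the unit: the canonical map to the colimit which belongs to
the object `id_γ` of the slice category; here `V(γ)` is identified with `⨂_{w} V(γ(w))`, a tensor
product with the single factor `V(γ(v))`, `v` being the vertex of `γ`. -/
noncomputable def unitApp (V : Corolla C ⥤ E) (γ : Corolla C) (v : γ.obj.Vert) :
    V.obj γ ⟶ ((freeModular C E).obj V).obj γ :=
  V.map (toStar γ v) ≫ (ρ_ (V.obj (γ.obj.corolla v))).inv ≫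
    unorderedTensor.ι (fun w => V.obj (γ.obj.corolla w)) [v]
      ⟨List.nodup_singleton v, fun _ => List.mem_singleton.2 (γ.property.1.unique trivial trivial)⟩ ≫
    sliceι V ⟨γ.obj⟩ (𝟙 γ.obj)

end Monad

/-! ### Erasing braces -/

section Graft

variable (Γ : CGraph C) (Y : Γ.Vert → CGraph C) (f : ∀ v, Y v ⟶ Γ.star v)

/-- The flags of the graph obtained by substituting the graphs `Y v` for the vertices of `Γ`. This
is the disjoint union of the sets of flags of the graphs `Y v`, except that the leg `f_v^*(x)` of
`Y v` is represented by the corresponding flag `x` of `Γ`. -/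
abbrev GraftFlag := Γ.Flag ⊕ (Σ v, {y : (Y v).Flag // (Y v).inv y ≠ y})

/-- The identification of `GraftFlag` with the disjoint union of the flags of the graphs `Y v`. -/
def graftEmb : GraftFlag Γ Y → Σ v, (Y v).Flag
  | Sum.inl x => ⟨Γ.root x, (f (Γ.root x)).flag ⟨x, rfl⟩⟩
  | Sum.inr y => ⟨y.1, y.2.1⟩

/-- The involution on the flags belonging to edges of the graphs `Y v`. -/
def innerInv (y : Σ v, {y : (Y v).Flag // (Y v).inv y ≠ y}) :
    Σ v, {y : (Y v).Flag // (Y v).inv y ≠ y} :=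
  ⟨y.1, (Y y.1).inv y.2.1, fun h => y.2.2 ((Y y.1).inv_injective h)⟩

/-- The involution: two flags of `Γ` are interchanged if they form an edge of `Γ`, the other flags
form edges as in `Y v`. -/
def graftInv : GraftFlag Γ Y → GraftFlag Γ Y
  | Sum.inl x => Sum.inl (Γ.inv x)
  | Sum.inr y => Sum.inr (innerInv Γ Y y)

theorem innerInv_innerInv (y : Σ v, {y : (Y v).Flag // (Y v).inv y ≠ y}) :
    innerInv Γ Y (innerInv Γ Y y) = y := by
  obtain ⟨v, y, hy⟩ := y
  exact congrArg (Sigma.mk v) (Subtype.ext ((Y v).inv_inv y))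

theorem graftEmb_injective : Function.Injective (graftEmb Γ Y f) := by
  have key : ∀ (v v' : Γ.Vert) (x : (Γ.star v).Flag) (x' : (Γ.star v').Flag),
      (⟨v, (f v).flag x⟩ : Σ v, (Y v).Flag) = ⟨v', (f v').flag x'⟩ → x.1 = x'.1 := by
    intro v v' x x' h
    obtain rfl : v = v' := congrArg Sigma.fst h
    exact congrArg Subtype.val ((f v).flag_injective (eq_of_heq (Sigma.mk.inj h).2))
  have key' : ∀ (v v' : Γ.Vert) (x : (Γ.star v).Flag) (y : (Y v').Flag),
      (⟨v, (f v).flag x⟩ : Σ v, (Y v).Flag) = ⟨v', y⟩ → (Y v').inv y = y := by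
    intro v v' x y h
    obtain rfl : v = v' := congrArg Sigma.fst h
    obtain rfl := eq_of_heq (Sigma.mk.inj h).2
    exact (f v).inv_flag x
  rintro (x | ⟨v, y, hy⟩) (x' | ⟨v', y', hy'⟩) h
  · exact congrArg Sum.inl (key _ _ _ _ h)
  · exact absurd (key' _ _ _ _ h) hy'
  · exact absurd (key' _ _ _ _ h.symm) hy
  · obtain rfl : v = v' := congrArg Sigma.fst h
    obtain rfl : y = y' := eq_of_heq (Sigma.mk.inj h).2
    rfl

theorem graftEmb_surjective : Function.Surjective (graftEmb Γ Y f) := by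
  rintro ⟨v, y⟩
  by_cases hy : (Y v).inv y = y
  · obtain ⟨⟨x, rfl⟩, rfl⟩ := (f v).leg_mem y hy
    exact ⟨Sum.inl x, rfl⟩
  · exact ⟨Sum.inr ⟨v, y, hy⟩, rfl⟩

/-- The flags of the grafted graph at `⟨v, w⟩` are identified with the flags of `Y v` at `w`. -/
noncomputable def graftFlagEquiv (v : Γ.Vert) (w : (Y v).Vert) :
    {z : GraftFlag Γ Y // (⟨(graftEmb Γ Y f z).1, (Y _).root (graftEmb Γ Y f z).2⟩ :
      Σ v, (Y v).Vert) = ⟨v, w⟩} ≃ {y : (Y v).Flag // (Y v).root y = w} :=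
  let φ := Equiv.ofBijective (graftEmb Γ Y f)
    ⟨graftEmb_injective Γ Y f, graftEmb_surjective Γ Y f⟩
  (Equiv.ofBijective
    (fun y : {y : (Y v).Flag // (Y v).root y = w} =>
      (⟨φ.symm ⟨v, y.1⟩, by
        change (⟨(φ (φ.symm ⟨v, y.1⟩)).1, (Y _).root (φ (φ.symm ⟨v, y.1⟩)).2⟩ :
          Σ v, (Y v).Vert) = _
        rw [φ.apply_symm_apply, y.2]⟩ :
      {z : GraftFlag Γ Y // (⟨(graftEmb Γ Y f z).1, (Y _).root (graftEmb Γ Y f z).2⟩ :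
        Σ v, (Y v).Vert) = ⟨v, w⟩}))
    ⟨fun y y' h => by
      have h' : (⟨v, y.1⟩ : Σ v, (Y v).Flag) = ⟨v, y'.1⟩ :=
        φ.symm.injective (Subtype.ext_iff.1 h)
      exact Subtype.ext (eq_of_heq (Sigma.mk.inj h').2),
    fun ⟨z, hz⟩ => by
      obtain ⟨⟨v', y⟩, rfl⟩ := φ.symm.surjective z
      have e : graftEmb Γ Y f (φ.symm ⟨v', y⟩) = ⟨v', y⟩ := φ.apply_symm_apply _
      rw [e] at hz
      obtain rfl : v' = v := congrArg Sigma.fst hz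
      exact ⟨⟨y, eq_of_heq (Sigma.mk.inj hz).2⟩, rfl⟩⟩).symm

theorem graftFlagEquiv_spec (v : Γ.Vert) (w : (Y v).Vert) (z) :
    graftEmb Γ Y f z.1 = ⟨v, (graftFlagEquiv Γ Y f v w z).1⟩ := by
  obtain ⟨y, rfl⟩ := (graftFlagEquiv Γ Y f v w).symm.surjective z
  rw [Equiv.apply_symm_apply]
  exact Equiv.apply_symm_apply (Equiv.ofBijective (graftEmb Γ Y f)
    ⟨graftEmb_injective Γ Y f, graftEmb_surjective Γ Y f⟩) ⟨v, y.1⟩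

/-- The pairing belonging to an edge of the grafted graph. For an edge of `Γ` between `x` and `y`
it is `A_{f^*(x)} ⟶ A_x ⟶ (A_y)^∨ ⟶ (A_{f^*(y)})^∨`, for an edge of `Y v` it is the given one. -/
def graftPairing : ∀ (z z' : GraftFlag Γ Y), graftInv Γ Y z = z' → z ≠ z' →
    ((Y _).color (graftEmb Γ Y f z).2 ⟶ dualObj ((Y _).color (graftEmb Γ Y f z').2))
  | Sum.inl x, Sum.inl y, h, hne => (f (Γ.root x)).q ⟨x, rfl⟩ ≫
      Γ.pairing x y (Sum.inl.inj h) (fun e => hne (congrArg Sum.inl e)) ≫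
      dualMap ((f (Γ.root y)).q ⟨y, rfl⟩)
  | Sum.inl _, Sum.inr _, h, _ => absurd h Sum.inl_ne_inr
  | Sum.inr _, Sum.inl _, h, _ => absurd h Sum.inr_ne_inl
  | Sum.inr y, Sum.inr _, h, _ => (Y y.1).pairing y.2.1 ((Y y.1).inv y.2.1) rfl y.2.2.symm ≫
      eqToHom (congrArg (fun z : Σ v, {y : (Y v).Flag // (Y v).inv y ≠ y} =>
        dualObj ((Y z.1).color z.2.1)) (Sum.inr.inj h))

theorem pairing_eqToHom (Γ : CGraph C) {x y y' : Γ.Flag} (hy : y = y') (h : Γ.inv x = y)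
    (hne : x ≠ y) (h' : Γ.inv x = y') (hne' : x ≠ y')
    (e : dualObj (Γ.color y) = dualObj (Γ.color y')) :
    Γ.pairing x y h hne ≫ eqToHom e = Γ.pairing x y' h' hne' := by
  subst hy
  exact Category.comp_id _

theorem pairing_symm_aux {x y x' y' : C} (a : x ⟶ x') (b : y ⟶ y') (p : x' ⟶ dualObj y') :
    b ≫ (bidualMap y' ≫ dualMap p) ≫ dualMap a =
      bidualMap y ≫ dualMap (a ≫ p ≫ dualMap b) := by
  rw [dualMap_comp, dualMap_comp, ← Category.assoc, ← Category.assoc, bidualMap_naturality]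
  simp only [Category.assoc]

/-- The stable `C`-graph obtained from `Γ` by substituting `Y v` for the vertex `v`, for all
vertices `v`; the legs of `Y v` are identified with the flags of `Γ` at `v` by means of
`f v : Y v ⟶ γ(v)`. -/
def CGraph.graft : CGraph C where
  Flag := GraftFlag Γ Y
  Vert := Σ v, (Y v).Vert
  root := fun z => ⟨(graftEmb Γ Y f z).1, (Y _).root (graftEmb Γ Y f z).2⟩
  inv := graftInv Γ Y
  inv_inv := by
    rintro (x | y)
    · exact congrArg Sum.inl (Γ.inv_inv x)
    · exact congrArg Sum.inr (innerInv_innerInv Γ Y y)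
  genus := fun p => (Y p.1).genus p.2
  stable := fun ⟨v, w⟩ => by
    have h := (Y v).stable w
    rwa [FlagGraph.valence, ← Nat.card_congr (graftFlagEquiv Γ Y f v w)] at h
  color := fun z => (Y _).color (graftEmb Γ Y f z).2
  pairing := graftPairing Γ Y f
  pairing_symm := by
    rintro (x | y) (x' | y') h h' hne
    · refine Eq.trans ?_ (pairing_symm_aux ((f _).q ⟨x, rfl⟩) ((f _).q ⟨x', rfl⟩)
        (Γ.pairing x x' (Sum.inl.inj h) fun e => hne (congrArg Sum.inl e)))
      exact congrArg (fun t => (f (Γ.root x')).q ⟨x', rfl⟩ ≫ t ≫ dualMap ((f (Γ.root x)).q ⟨x, rfl⟩))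
        (Γ.pairing_symm x x' (Sum.inl.inj h) (Sum.inl.inj h') fun e => hne (congrArg Sum.inl e))
    · exact absurd h Sum.inl_ne_inr
    · exact absurd h Sum.inr_ne_inl
    · obtain rfl := Sum.inr.inj h
      obtain ⟨v, y, hy⟩ := y
      refine (pairing_eqToHom (Y v) ((Y v).inv_inv y) _ _ ((Y v).inv_inv y) hy _).trans ?_
      refine ((Y v).pairing_symm y ((Y v).inv y) rfl ((Y v).inv_inv y) hy.symm).trans ?_
      exact congrArg (fun t => bidualMap _ ≫ dualMap t) (Category.comp_id _).symm

theorem CGraph.euler_graft (v : Γ.Vert) (w : (Y v).Vert) :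
    (Γ.graft Y f).euler ⟨v, w⟩ = (Y v).euler w := by
  have h : (Γ.graft Y f).valence ⟨v, w⟩ = (Y v).valence w :=
    Nat.card_congr (graftFlagEquiv Γ Y f v w)
  unfold CGraph.euler
  rw [h]
  rfl

/-- The morphism from the grafted graph to `Γ` which contracts all edges of the graphs `Y v`. -/
def CGraph.graftHom : Γ.graft Y f ⟶ Γ where
  vert := Sigma.fst
  flag := Sum.inl
  flag_injective := Sum.inl_injective
  inv_flag := fun _ => rfl
  leg_mem := by
    rintro (x | ⟨v, y, hy⟩) h
    · exact ⟨x, rfl⟩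
    · refine absurd ?_ hy
      exact congrArg Subtype.val (eq_of_heq (Sigma.mk.inj (Sum.inr.inj h)).2)
  vert_root := fun _ => rfl
  vert_surjective := fun v => by
    obtain ⟨w, -⟩ := (f v).vert_surjective PUnit.unit
    exact ⟨⟨v, w⟩, rfl⟩
  vert_eq_iff := by
    rintro ⟨v, w⟩ ⟨v', w'⟩
    constructor
    · intro h
      obtain rfl : v = v' := h
      have h' := ((f v).vert_eq_iff w w').1 rfl
      induction h' with
      | rel a b h =>
        obtain ⟨y, hy, rfl, rfl⟩ := h
        refine Relation.EqvGen.rel _ _ ⟨Sum.inr ⟨v, y, fun e => hy ((f v).leg_mem y e)⟩, ?_, rfl,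
          rfl⟩
        rintro ⟨x, hx⟩
        exact Sum.inl_ne_inr hx
      | refl a => exact Relation.EqvGen.refl _
      | symm a b _ ih => exact ih.symm
      | trans a b c _ _ ih ih' => exact ih.trans _ _ _ ih'
    · intro h
      generalize (⟨v, w⟩ : (Γ.graft Y f).Vert) = a, (⟨v', w'⟩ : (Γ.graft Y f).Vert) = b at h ⊢
      induction h with
      | rel a b h =>
        obtain ⟨z, hz, rfl, rfl⟩ := h
        obtain (x | y) := z
        · exact absurd ⟨x, rfl⟩ hz
        · rfl
      | refl a => rfl
      | symm a b _ ih => exact ih.symm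
      | trans a b c _ _ ih ih' => exact ih.trans ih'
  euler_eq := fun v => by
    refine (CGraph.euler_star Γ v PUnit.unit).symm.trans (((f v).euler_eq PUnit.unit).trans ?_)
    refine finsum_eq_of_bijective (fun w => ⟨⟨v, w.1⟩, rfl⟩) ⟨fun w w' h => ?_, ?_⟩
      fun w => (CGraph.euler_graft Γ Y f v w.1).symm
    · exact Subtype.ext (eq_of_heq (Sigma.mk.inj (congrArg Subtype.val h)).2)
    · rintro ⟨⟨v', w⟩, h⟩
      obtain rfl : v' = v := h
      exact ⟨⟨w, rfl⟩, rfl⟩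
  q := fun x => (f (Γ.root x)).q ⟨x, rfl⟩
  pairing_comm := fun _ _ _ _ => rfl

/-- The canonical isomorphism from the corolla of `w` in `Y v` to the corolla of `⟨v, w⟩` in the
grafted graph. -/
noncomputable def graftCorolla (v : Γ.Vert) (w : (Y v).Vert) :
    (Y v).corolla w ⟶ (Γ.graft Y f).corolla ⟨v, w⟩ :=
  ObjectProperty.homMk (CGraph.homOfEquiv (Γ := (Y v).star w) (Γ' := (Γ.graft Y f).star ⟨v, w⟩)
    (graftFlagEquiv Γ Y f v w) (Equiv.refl PUnit) (fun _ => rfl) (fun _ => rfl) (fun _ => rfl)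
    (fun z => eqToHom (congrArg (fun p : Σ v, (Y v).Flag => (Y p.1).color p.2)
      (graftFlagEquiv_spec Γ Y f v w z)).symm)
    (fun _ _ h hne => absurd h hne))

end Graft

section Multiplication

variable {E : Type w} [Category.{v} E] [MonoidalCategory E] [SymmetricCategory E]
  [HasColimitsOfSize.{u, u} E]

/-- `IsUnitTransformation η` says that `η` is the natural transformation with the components
`V(γ) ⟶ 𝓜 V(γ)` given by the object `id_γ` of the slice category over `γ`. -/
def IsUnitTransformation (η : 𝟭 (Corolla C ⥤ E) ⟶ freeModular C E) : Prop :=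
  ∀ (V : Corolla C ⥤ E) (γ : Corolla C) (v : γ.obj.Vert),
    (η.app V).app γ = unitApp V γ v

/-- `IsErasingBraces μ` says that `μ : 𝓜² ⟶ 𝓜` is given by erasing braces: for a stable
`C`-graph `Γ` over `γ` and for stable `C`-graphs `Y v` over `γ(v)`, where `v` runs through the
vertices of `Γ`, the restriction of `𝓜² V (γ) ⟶ 𝓜 V (γ)` to `⨂_v V(Y v)` is the canonical
isomorphism `⨂_v ⨂_w V(γ(w)) ≅ ⨂_{(v, w)} V(γ(w))`, followed by the canonical map to `𝓜 V (γ)`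
which belongs to the graph obtained by substituting the graphs `Y v` for the vertices of `Γ`.
Here the unordered tensor products are written by means of arbitrary orderings `l`, `m v` of the
sets of vertices of `Γ`, `Y v`. -/
def IsErasingBraces (μ : freeModular C E ⋙ freeModular C E ⟶ freeModular C E) : Prop :=
  ∀ (V : Corolla C ⥤ E) (γ : Corolla C) (Γ : CGraph C) (p : Γ ⟶ γ.obj) (Y : Γ.Vert → CGraph C)
    (f : ∀ v, Y v ⟶ Γ.star v) (l : List Γ.Vert) (hl : IsOrdering l)
    (m : ∀ v, List (Y v).Vert) (hm : ∀ v, IsOrdering (m v)),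
    listTensorMap (fun v =>
        unorderedTensor.ι (fun w => V.obj ((Y v).corolla w)) (m v) (hm v) ≫ sliceι V ⟨Y v⟩ (f v)) l ≫
      unorderedTensor.ι (fun v => ((freeModular C E).obj V).obj (Γ.corolla v)) l hl ≫
      sliceι ((freeModular C E).obj V) ⟨Γ⟩ p ≫ (μ.app V).app γ =
    listTensorMap (fun v => listTensorMap (fun w => V.map (graftCorolla Γ Y f v w)) (m v)) l ≫
      listTensorFlatten (fun u => V.obj ((Γ.graft Y f).corolla u)) m l ≫
      unorderedTensor.ι (fun u => V.obj ((Γ.graft Y f).corolla u)) (l.sigma m) (hl.sigma hm) ≫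
      sliceι V ⟨Γ.graft Y f⟩ (Γ.graftHom Y f ≫ p)

end Multiplication

end ModularOperad

set_option linter.unusedSectionVars false
set_option linter.unusedVariables false

/-! A generator of `𝓜²V(γ)` has two layers: a graph `Γ` over `γ` and a graph `Y_v` over `γ(v)` for
each vertex, together with orderings of all the vertex sets. Since the tensor product preserves
colimits in each variable, a tensor product of colimits is a colimit over the product of the index
categories (`listTensorCocone_isColimit`). Hence the maps from the ordered products `⨂_v ⨂_w
V(γ(w))` to `𝓜²V(γ)` are jointly epimorphic (`slice_slice_hom_ext`). This gives uniqueness of `μ`,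
and it allows every identity between maps out of iterates of `𝓜` to be checked on generators.

For existence, the prescribed maps (`brace`) must respect all identifications made in `𝓜²V(γ)`:
reordering the vertices of the `Y_v`, replacing the `Y_v` along non-contracting morphisms,
reordering the vertices of `Γ`, and replacing `Γ` along a non-contracting morphism. When a graph is
replaced, the grafted graph changes by a non-contracting morphism over `γ` (`graftMap`,
`graftBase`), and the colimit identifies the two ends. What remains is that removing parentheses is
compatible with relabelling and permuting factors.

This last point needs no coherence theorem for symmetric monoidal categories. The unordered tensor
product absorbs every composite of neighbour swaps, so a diagram of ordered tensor products need
only commute up to some such composite, no matter which one (`PermEq`). The hexagon and the symmetry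
enter when whole blocks are exchanged (`listTensorAppend_comm`, `listCat_swap`).

The monad laws follow the same scheme. Associativity is the isomorphism `Γ{Y_v{Z_w}} ≅ Γ{Y_v}{Z_w}`
(`graftAssoc`) together with `listTensorFlatten_assoc`. The unit laws hold because substituting a
graph for the vertex of a corolla, or corollas for the vertices of a graph, returns the graph
(`graftUnitLeft`, `graftUnitRight`). The components of `η` are prescribed, so only naturality is at
stake; it holds because a morphism of corollas contracts nothing and so is itself a morphism of the
slice category. -/

namespace ModularOperad

/-! ### Colimits in all factors of a tensor product -/

section ListProduct

universe v₁ u₁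

variable {I : Type u} {J : I → Type u₁} [∀ i, Category.{v₁} (J i)]

/-- The product category of a family of categories along a list of indices. -/
instance tprodCategory : ∀ l : List I, Category.{v₁} (List.TProd J l)
  | [] =>
    { Hom := fun _ _ => PUnit
      id := fun _ => PUnit.unit
      comp := fun _ _ => PUnit.unit }
  | i :: l =>
    letI := tprodCategory l
    CategoryTheory.prod' (J i) (List.TProd J l)

/-- Morphisms in the product category along a list are lists of morphisms. -/
def tprodHomMk {j j' : ∀ i, J i} : ∀ l : List I, List.TProd (fun i => j i ⟶ j' i) l →
    (List.TProd.mk l j ⟶ List.TProd.mk l j')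
  | [], _ => PUnit.unit
  | _ :: l, t => (t.1, tprodHomMk l t.2)

/-- The list of components of a morphism in the product category along a list. -/
def tprodHomElim {j j' : ∀ i, J i} : ∀ l : List I, (List.TProd.mk l j ⟶ List.TProd.mk l j') →
    List.TProd (fun i => j i ⟶ j' i) l
  | [], _ => PUnit.unit
  | _ :: l, t => (t.1, tprodHomElim l t.2)

theorem tprodHomMk_elim {j j' : ∀ i, J i} : ∀ (l : List I)
    (t : List.TProd.mk l j ⟶ List.TProd.mk l j'), tprodHomMk l (tprodHomElim l t) = t
  | [], _ => rfl
  | _ :: l, t => Prod.ext rfl (tprodHomMk_elim l t.2)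

theorem tprodHomElim_mk {j j' : ∀ i, J i} : ∀ (l : List I)
    (t : List.TProd (fun i => j i ⟶ j' i) l), tprodHomElim l (tprodHomMk l t) = t
  | [], _ => rfl
  | _ :: l, t => Prod.ext rfl (tprodHomElim_mk l t.2)

theorem tprodHomMk_id (j : ∀ i, J i) : ∀ l : List I,
    tprodHomMk l (List.TProd.mk l fun i => 𝟙 (j i)) = 𝟙 (List.TProd.mk l j)
  | [] => rfl
  | _ :: l => Prod.ext rfl (tprodHomMk_id j l)

theorem tprodHomMk_comp {j j' j'' : ∀ i, J i} (f : ∀ i, j i ⟶ j' i) (g : ∀ i, j' i ⟶ j'' i) :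
    ∀ l : List I, tprodHomMk l (List.TProd.mk l fun i => f i ≫ g i) =
      tprodHomMk l (List.TProd.mk l f) ≫ tprodHomMk l (List.TProd.mk l g)
  | [] => rfl
  | _ :: l => Prod.ext rfl (tprodHomMk_comp f g l)

/-- The functor from the product of a family of categories to the product along a list. -/
def tprodFunctor (l : List I) : (∀ i, J i) ⥤ List.TProd J l where
  obj j := List.TProd.mk l j
  map f := tprodHomMk l (List.TProd.mk l f)
  map_id j := tprodHomMk_id j l
  map_comp f g := tprodHomMk_comp f g l

/-- An ordering contains every index exactly once, so a tuple along `l` and a family over `I` carry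
the same data, for objects and for morphisms. A missing index would break faithfulness, a repeated
one fullness. -/
theorem tprodFunctor_isEquivalence {l : List I} (hl : IsOrdering l) :
    (tprodFunctor (J := J) l).IsEquivalence := by
  classical
  refine { faithful := ⟨fun {j j'} f g h => ?_⟩, full := ⟨fun {j j'} t => ?_⟩, essSurj := ⟨fun t => ?_⟩ }
  · have h' := congrArg (tprodHomElim l) h
    change tprodHomElim l (tprodHomMk l _) = tprodHomElim l (tprodHomMk l _) at h'
    rw [tprodHomElim_mk, tprodHomElim_mk] at h'
    exact (List.TProd.piEquivTProd hl.1 hl.2).injective h'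
  · refine ⟨(tprodHomElim l t).elim' hl.2, ?_⟩
    change tprodHomMk l (List.TProd.mk l _) = t
    rw [List.TProd.mk_elim hl.1 hl.2]
    exact tprodHomMk_elim l t
  · exact ⟨t.elim' hl.2, ⟨eqToIso (List.TProd.mk_elim hl.1 hl.2 t)⟩⟩

variable {E : Type w} [Category.{v} E] [MonoidalCategory E]

/-- The tensor product of the values of functors along a list of indices. -/
def tprodTensor (D : ∀ i, J i ⥤ E) : ∀ l : List I, List.TProd J l ⥤ E
  | [] => (Functor.const _).obj (𝟙_ E)
  | i :: l => Functor.uncurry.obj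
      (((Functor.whiskeringLeft₂ E).obj (D i)).obj (tprodTensor D l) |>.obj (curriedTensor E))

/-- The tensor product of the components of cocones along a list of indices. -/
def tprodTensorι {D : ∀ i, J i ⥤ E} (c : ∀ i, Cocone (D i)) : ∀ (l : List I) (t : List.TProd J l),
    (tprodTensor D l).obj t ⟶ listTensor (fun i => (c i).pt) l
  | [], _ => 𝟙 (𝟙_ E)
  | i :: l, t => (c i).ι.app t.1 ⊗ₘ tprodTensorι c l t.2

theorem tprodTensor_map_cons (D : ∀ i, J i ⥤ E) (i : I) (l : List I) {t t' : List.TProd J (i :: l)}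
    (f : t ⟶ t') : (tprodTensor D (i :: l)).map f = (D i).map f.1 ⊗ₘ (tprodTensor D l).map f.2 :=
  (MonoidalCategory.tensorHom_def _ _).symm

theorem tprodTensorι_naturality {D : ∀ i, J i ⥤ E} (c : ∀ i, Cocone (D i)) : ∀ (l : List I)
    {t t' : List.TProd J l} (f : t ⟶ t'),
    (tprodTensor D l).map f ≫ tprodTensorι c l t' = tprodTensorι c l t
  | [], _, _, _ => Category.id_comp _
  | i :: l, t, t', f => by
    rw [tprodTensor_map_cons]
    refine (tensorHom_comp_tensorHom _ _ _ _).trans ?_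
    exact congrArg₂ (· ⊗ₘ ·) ((c i).w f.1) (tprodTensorι_naturality c l f.2)

/-- The cocone formed by the tensor products of the components of cocones. -/
def tprodCocone {D : ∀ i, J i ⥤ E} (c : ∀ i, Cocone (D i)) (l : List I) :
    Cocone (tprodTensor D l) where
  pt := listTensor (fun i => (c i).pt) l
  ι :=
    { app := tprodTensorι c l
      naturality := fun _ _ f => (tprodTensorι_naturality c l f).trans (Category.comp_id _).symm }

/-- Preservation is assumed for small shapes only, while slice categories are merely essentially
small; this keeps the products along a list within reach of the hypothesis. -/
theorem tprod_essentiallySmall [∀ i, EssentiallySmall.{u} (J i)] : ∀ l : List I,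
    EssentiallySmall.{u} (List.TProd J l)
  | [] => EssentiallySmall.mk' (S := Discrete PUnit.{u + 1})
      { functor := (Functor.const _).obj ⟨PUnit.unit⟩
        inverse := (Functor.const _).obj PUnit.unit
        unitIso := NatIso.ofComponents (fun _ => ⟨PUnit.unit, PUnit.unit, rfl, rfl⟩)
        counitIso := NatIso.ofComponents (fun _ => eqToIso rfl) }
  | i :: l =>
    haveI := tprod_essentiallySmall l
    EssentiallySmall.mk' ((equivSmallModel.{u} (J i)).prod (equivSmallModel.{u} (List.TProd J l)))

/-- Induction on the list: a bifunctor preserving colimits in each variable sends a pair of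
colimits, head and tail, to a colimit over the product of the shapes. Tuples along a list replace
families over `I` because the tail of an ordering of `I` is no longer an ordering of `I`. -/
theorem tprodCocone_isColimit [SymmetricCategory E]
    [∀ X : E, PreservesColimitsOfSize.{u, u} (tensorLeft X)] [∀ i, EssentiallySmall.{u} (J i)]
    {D : ∀ i, J i ⥤ E} (c : ∀ i, Cocone (D i)) (hc : ∀ i, IsColimit (c i)) :
    ∀ l : List I, Nonempty (IsColimit (tprodCocone c l))
  | [] => ⟨{ desc := fun s => s.ι.app PUnit.unit
             fac := fun s t => Category.id_comp _
             uniq := fun s m h => (Category.id_comp m).symm.trans (h PUnit.unit) }⟩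
  | i :: l => by
    obtain ⟨h⟩ := tprodCocone_isColimit c hc l
    have := tprod_essentiallySmall (J := J) l
    have : ∀ X : E, PreservesColimitsOfShape (List.TProd J l) ((curriedTensor E).obj X) :=
      fun X => preservesColimitsOfShape_of_equiv (equivSmallModel.{u} _).symm (tensorLeft X)
    have : ∀ X : E, PreservesColimitsOfShape (J i) ((curriedTensor E).flip.obj X) := fun X => by
      have : PreservesColimitsOfShape (J i) (tensorLeft X) :=
        preservesColimitsOfShape_of_equiv (equivSmallModel.{u} _).symm (tensorLeft X)
      -- Preservation is assumed in the second variable; the symmetry carries it over to the first.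
      exact preservesColimitsOfShape_of_natIso (BraidedCategory.tensorLeftIsoTensorRight X)
    refine ⟨(isColimitOfPreserves₂ (curriedTensor E) (hc i) h).ofIsoColimit
      (Cocone.ext (Iso.refl _) fun t => ?_)⟩
    refine (Category.comp_id _).trans ?_
    exact (MonoidalCategory.tensorHom_def _ _).symm

/-- The functor which sends a family of objects `j` to the tensor product of the `D i (j i)`. -/
def listTensorFunctor (D : ∀ i, J i ⥤ E) (l : List I) : (∀ i, J i) ⥤ E where
  obj j := listTensor (fun i => (D i).obj (j i)) l
  map f := listTensorMap (fun i => (D i).map (f i)) l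
  map_id j := by
    refine Eq.trans ?_ (listTensorMap_id _ l)
    exact congrArg (fun f => listTensorMap f l) (funext fun i => (D i).map_id _)
  map_comp f g := by
    refine Eq.trans ?_ (listTensorMap_comp _ _ l)
    exact congrArg (fun f => listTensorMap f l) (funext fun i => (D i).map_comp _ _)

/-- The canonical identification of two descriptions of a tensor product along a list. -/
def listTensorFunctorIso (D : ∀ i, J i ⥤ E) (j : ∀ i, J i) : ∀ l : List I,
    (tprodTensor D l).obj (List.TProd.mk l j) ≅ listTensor (fun i => (D i).obj (j i)) l
  | [] => Iso.refl _
  | i :: l => whiskerLeftIso ((D i).obj (j i)) (listTensorFunctorIso D j l)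

theorem listTensorFunctorIso_naturality (D : ∀ i, J i ⥤ E) {j j' : ∀ i, J i}
    (f : ∀ i, j i ⟶ j' i) : ∀ l : List I,
    (tprodTensor D l).map (tprodHomMk l (List.TProd.mk l f)) ≫ (listTensorFunctorIso D j' l).hom =
      (listTensorFunctorIso D j l).hom ≫ listTensorMap (fun i => (D i).map (f i)) l
  | [] => rfl
  | i :: l => by
    rw [tprodTensor_map_cons]
    exact swap_naturality_cons ((D i).map (f i)) (listTensorFunctorIso_naturality D f l)

theorem listTensorFunctorIso_ι {D : ∀ i, J i ⥤ E} (c : ∀ i, Cocone (D i)) (j : ∀ i, J i) :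
    ∀ l : List I, (listTensorFunctorIso D j l).hom ≫ listTensorMap (fun i => (c i).ι.app (j i)) l =
      tprodTensorι c l (List.TProd.mk l j)
  | [] => Category.id_comp _
  | i :: l => by
    refine Eq.trans ?_ (congrArg ((c i).ι.app (j i) ⊗ₘ ·) (listTensorFunctorIso_ι c j l))
    refine (congrArg (· ≫ _) (id_tensorHom _ _).symm).trans ?_
    refine (tensorHom_comp_tensorHom _ _ _ _).trans ?_
    exact congrArg (· ⊗ₘ _) (Category.id_comp _)

/-- The cocone over `listTensorFunctor` formed by tensor products. -/
def listTensorCocone {D : ∀ i, J i ⥤ E} (c : ∀ i, Cocone (D i)) (l : List I) :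
    Cocone (listTensorFunctor D l) where
  pt := listTensor (fun i => (c i).pt) l
  ι :=
    { app := fun j => listTensorMap (fun i => (c i).ι.app (j i)) l
      naturality := fun j j' f => by
        refine Eq.trans ?_ (Category.comp_id _).symm
        refine (listTensorMap_comp _ _ l).symm.trans ?_
        exact congrArg (fun f => listTensorMap f l) (funext fun i => (c i).w (f i)) }

/-- A tensor product of colimits is the colimit over the product category. -/
theorem listTensorCocone_isColimit [SymmetricCategory E]
    [∀ X : E, PreservesColimitsOfSize.{u, u} (tensorLeft X)] [∀ i, EssentiallySmall.{u} (J i)]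
    {D : ∀ i, J i ⥤ E} (c : ∀ i, Cocone (D i)) (hc : ∀ i, IsColimit (c i)) {l : List I}
    (hl : IsOrdering l) : Nonempty (IsColimit (listTensorCocone c l)) := by
  obtain ⟨h⟩ := tprodCocone_isColimit c hc l
  have := tprodFunctor_isEquivalence (J := J) hl
  -- An equivalence is final, so the colimit over tuples along `l` is also the colimit over
  -- families.
  have h' := (Functor.Final.isColimitWhiskerEquiv (tprodFunctor l) _).symm h
  let φ : tprodFunctor l ⋙ tprodTensor D l ≅ listTensorFunctor D l :=
    NatIso.ofComponents (fun j => listTensorFunctorIso D j l)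
      fun f => listTensorFunctorIso_naturality D f l
  refine ⟨IsColimit.equivOfNatIsoOfIso φ _ (listTensorCocone c l)
    (Cocone.ext (Iso.refl _) fun j => ?_) h'⟩
  refine (Category.comp_id _).trans ((Iso.inv_comp_eq _).2 ?_)
  exact (listTensorFunctorIso_ι c j l).symm

variable [SymmetricCategory E] [∀ X : E, PreservesColimitsOfSize.{u, u} (tensorLeft X)]
  [∀ i, EssentiallySmall.{u} (J i)]

/-- This and `listTensor_hom_ext` are the two halves of the universal property, in the form through
which preservation of colimits enters everything below. -/
theorem listTensor_exists_desc {D : ∀ i, J i ⥤ E} (c : ∀ i, Cocone (D i))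
    (hc : ∀ i, IsColimit (c i)) {l : List I} (hl : IsOrdering l) {Z : E}
    (k : ∀ j : (∀ i, J i), listTensor (fun i => (D i).obj (j i)) l ⟶ Z)
    (hk : ∀ (j j' : ∀ i, J i) (f : ∀ i, j i ⟶ j' i),
      listTensorMap (fun i => (D i).map (f i)) l ≫ k j' = k j) :
    ∃ d : listTensor (fun i => (c i).pt) l ⟶ Z,
      ∀ j : (∀ i, J i), listTensorMap (fun i => (c i).ι.app (j i)) l ≫ d = k j := by
  obtain ⟨h⟩ := listTensorCocone_isColimit c hc hl
  exact ⟨h.desc (Cocone.mk Z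
    { app := k
      naturality := fun j j' f => (hk j j' f).trans (Category.comp_id _).symm }), h.fac _⟩

theorem listTensor_hom_ext {D : ∀ i, J i ⥤ E} (c : ∀ i, Cocone (D i))
    (hc : ∀ i, IsColimit (c i)) {l : List I} (hl : IsOrdering l) {Z : E}
    {f g : listTensor (fun i => (c i).pt) l ⟶ Z}
    (h : ∀ j : (∀ i, J i), listTensorMap (fun i => (c i).ι.app (j i)) l ≫ f =
      listTensorMap (fun i => (c i).ι.app (j i)) l ≫ g) : f = g := by
  obtain ⟨hl⟩ := listTensorCocone_isColimit c hc hl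
  exact hl.hom_ext h

end ListProduct

/-! ### Permutations of the factors of a tensor product -/

section Permutation

variable {E : Type w} [Category.{v} E] [MonoidalCategory E] [SymmetricCategory E]

/-- The morphisms between ordered tensor products generated by interchanging neighbouring
factors. -/
inductive IsPerm {I : Type u} (X : I → E) :
    ∀ (l l' : List I), (listTensor X l ⟶ listTensor X l') → Prop
  | id (l : List I) : IsPerm X l l (𝟙 (listTensor X l))
  | cons (i : I) {l l' : List I} {f : listTensor X l ⟶ listTensor X l'} (hf : IsPerm X l l' f) :
      IsPerm X (i :: l) (i :: l') (X i ◁ f)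
  | swap (a b : I) (l : List I) : IsPerm X (a :: b :: l) (b :: a :: l) (listTensorSwap X a b l [])
  | comp {l l' l'' : List I} {f : listTensor X l ⟶ listTensor X l'}
      {g : listTensor X l' ⟶ listTensor X l''} (hf : IsPerm X l l' f) (hg : IsPerm X l' l'' g) :
      IsPerm X l l'' (f ≫ g)

variable {I : Type u} {X : I → E}

theorem IsPerm.listTensorSwap (a b : I) (l₂ : List I) : ∀ l₁ : List I,
    IsPerm X (l₁ ++ a :: b :: l₂) (l₁ ++ b :: a :: l₂) (ModularOperad.listTensorSwap X a b l₂ l₁)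
  | [] => .swap a b l₂
  | i :: l₁ => .cons i (IsPerm.listTensorSwap a b l₂ l₁)

theorem IsPerm.perm {l l' : List I} {f : listTensor X l ⟶ listTensor X l'} (hf : IsPerm X l l' f) :
    l.Perm l' := by
  induction hf with
  | id l => exact .refl l
  | cons i _ ih => exact .cons i ih
  | swap a b l => exact .swap b a l
  | comp _ _ ih ih' => exact ih.trans ih'

/-- The inner associators cancel and the two braidings compose to the identity. This needs a
symmetry; a braiding would not suffice. -/
theorem listTensorSwap_swap (a b : I) (l : List I) :
    listTensorSwap X a b l [] ≫ listTensorSwap X b a l [] = 𝟙 (listTensor X (a :: b :: l)) := by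
  change ((α_ (X a) (X b) (listTensor X l)).inv ≫ (β_ (X a) (X b)).hom ▷ listTensor X l ≫
      (α_ (X b) (X a) (listTensor X l)).hom) ≫ (α_ (X b) (X a) (listTensor X l)).inv ≫
      (β_ (X b) (X a)).hom ▷ listTensor X l ≫ (α_ (X a) (X b) (listTensor X l)).hom =
    𝟙 (X a ⊗ X b ⊗ listTensor X l)
  simp only [Category.assoc, Iso.hom_inv_id_assoc, ← comp_whiskerRight_assoc,
    SymmetricCategory.symmetry, id_whiskerRight, Category.id_comp, Iso.inv_hom_id]

/-- The inverse is again generated by swaps, which is what makes `PermEq` a symmetric relation. -/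
theorem IsPerm.exists_inv {l l' : List I} {f : listTensor X l ⟶ listTensor X l'}
    (hf : IsPerm X l l' f) : ∃ g, IsPerm X l' l g ∧ f ≫ g = 𝟙 _ ∧ g ≫ f = 𝟙 _ := by
  induction hf with
  | id l => exact ⟨𝟙 _, .id l, Category.id_comp _, Category.id_comp _⟩
  | cons i _ ih =>
    obtain ⟨g, hg, h, h'⟩ := ih
    refine ⟨X i ◁ g, .cons i hg, ?_, ?_⟩
    · exact (MonoidalCategory.whiskerLeft_comp _ _ _).symm.trans
        ((congrArg (X i ◁ ·) h).trans (MonoidalCategory.whiskerLeft_id _ _))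
    · exact (MonoidalCategory.whiskerLeft_comp _ _ _).symm.trans
        ((congrArg (X i ◁ ·) h').trans (MonoidalCategory.whiskerLeft_id _ _))
  | swap a b l => exact ⟨_, .swap b a l, listTensorSwap_swap a b l, listTensorSwap_swap b a l⟩
  | comp _ _ ih ih' =>
    obtain ⟨g, hg, h₁, h₂⟩ := ih
    obtain ⟨g', hg', h₁', h₂'⟩ := ih'
    refine ⟨g' ≫ g, .comp hg' hg, ?_, ?_⟩
    · rw [Category.assoc, reassoc_of% h₁', h₁]
    · rw [Category.assoc, reassoc_of% h₂, h₂']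

/-- Whiskering with the factors of a list, given in reverse order, on the left. -/
def listWhiskerLeft (X : I → E) : ∀ (l₁ : List I) {l l' : List I}
    (_ : listTensor X l ⟶ listTensor X l'),
    listTensor X (l₁.reverseAux l) ⟶ listTensor X (l₁.reverseAux l')
  | [], _, _, f => f
  | i :: l₁, l, l', f => listWhiskerLeft X l₁ (l := i :: l) (l' := i :: l') (X i ◁ f)

theorem listWhiskerLeft_id : ∀ (l₁ l : List I),
    listWhiskerLeft X l₁ (𝟙 (listTensor X l)) = 𝟙 _
  | [], _ => rfl
  | i :: l₁, l => (congrArg (listWhiskerLeft X l₁ (l := i :: l) (l' := i :: l))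
      (MonoidalCategory.whiskerLeft_id _ _)).trans (listWhiskerLeft_id l₁ (i :: l))

theorem listWhiskerLeft_comp : ∀ (l₁ : List I) {l l' l'' : List I}
    (f : listTensor X l ⟶ listTensor X l') (g : listTensor X l' ⟶ listTensor X l''),
    listWhiskerLeft X l₁ (f ≫ g) = listWhiskerLeft X l₁ f ≫ listWhiskerLeft X l₁ g
  | [], _, _, _, _, _ => rfl
  | i :: l₁, l, l', l'', _, _ =>
    (congrArg (listWhiskerLeft X l₁ (l := i :: l) (l' := i :: l''))
      (MonoidalCategory.whiskerLeft_comp _ _ _)).trans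
      (listWhiskerLeft_comp l₁ (l := i :: l) (l' := i :: l') (l'' := i :: l'') _ _)

/-! ### Families invariant under neighbour swaps are invariant under all permutations -/

section Invariance

variable {Z : E} {k : ∀ l, IsOrdering l → (listTensor X l ⟶ Z)}

theorem listWhiskerLeft_swap_comp
    (hk : ∀ (l₁ : List I) (a b : I) (l₂ : List I) (h : IsOrdering (l₁ ++ a :: b :: l₂))
      (h' : IsOrdering (l₁ ++ b :: a :: l₂)), listTensorSwap X a b l₂ l₁ ≫ k _ h' = k _ h)
    (a b : I) (l : List I) : ∀ (l₁ l₀ : List I)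
    (h : IsOrdering (l₁.reverseAux (l₀ ++ a :: b :: l)))
    (h' : IsOrdering (l₁.reverseAux (l₀ ++ b :: a :: l))),
    listWhiskerLeft X l₁ (listTensorSwap X a b l l₀) ≫ k _ h' = k _ h
  | [], l₀, h, h' => hk l₀ a b l h h'
  | i :: l₁, l₀, h, h' => listWhiskerLeft_swap_comp hk a b l l₁ (i :: l₀) h h'

/-- Under a `cons` the induction leaves the orderings, on which alone `k` is defined, so the
statement carries a prefix `l₁` that completes the list. The prefix is stored in reverse: moving `i`
from the list to the prefix is then a definitional equality, and the `cons` case is the induction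
hypothesis for `i :: l₁`. -/
theorem IsPerm.whiskerLeft_comp_eq
    (hk : ∀ (l₁ : List I) (a b : I) (l₂ : List I) (h : IsOrdering (l₁ ++ a :: b :: l₂))
      (h' : IsOrdering (l₁ ++ b :: a :: l₂)), ModularOperad.listTensorSwap X a b l₂ l₁ ≫ k _ h' = k _ h)
    {l l' : List I} {f : listTensor X l ⟶ listTensor X l'}
    (hf : IsPerm X l l' f) : ∀ (l₁ : List I) (h : IsOrdering (l₁.reverseAux l))
    (h' : IsOrdering (l₁.reverseAux l')), listWhiskerLeft X l₁ f ≫ k _ h' = k _ h := by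
  induction hf with
  | id l =>
    intro l₁ h h'
    rw [listWhiskerLeft_id, Category.id_comp]
  | cons i hf ih =>
    intro l₁ h h'
    exact ih (i :: l₁) h h'
  | swap a b l =>
    intro l₁ h h'
    exact listWhiskerLeft_swap_comp hk a b l l₁ [] h h'
  | @comp l l' l'' f g hf hg ih ih' =>
    intro l₁ h h'
    -- The middle list of a composite must be an ordering before `k` can be evaluated there; it is
    -- one because it is a permutation of the first list.
    have h'' : IsOrdering (l₁.reverseAux l') := h.perm (by
      simpa only [List.reverseAux_eq] using hf.perm.append_left _)
    rw [listWhiskerLeft_comp, Category.assoc, ih' l₁ h'' h', ih l₁ h h'']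

theorem IsPerm.comp_eq
    (hk : ∀ (l₁ : List I) (a b : I) (l₂ : List I) (h : IsOrdering (l₁ ++ a :: b :: l₂))
      (h' : IsOrdering (l₁ ++ b :: a :: l₂)), ModularOperad.listTensorSwap X a b l₂ l₁ ≫ k _ h' = k _ h)
    {l l' : List I} {f : listTensor X l ⟶ listTensor X l'}
    (hf : IsPerm X l l' f) (h : IsOrdering l) (h' : IsOrdering l') : f ≫ k l' h' = k l h :=
  hf.whiskerLeft_comp_eq hk [] h h'

end Invariance

/-- Permutations become invisible in the unordered tensor product. It is irrelevant which composite
of swaps occurs, so uniqueness of permutation isomorphisms is never needed. -/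
theorem IsPerm.comp_ι [HasColimitsOfSize.{u, u} E] {l l' : List I}
    {f : listTensor X l ⟶ listTensor X l'} (hf : IsPerm X l l' f) (h : IsOrdering l)
    (h' : IsOrdering l') :
    f ≫ unorderedTensor.ι X l' h' = unorderedTensor.ι X l h :=
  hf.comp_eq (k := unorderedTensor.ι X) (unorderedTensor.swap X) h h'

/-- Casts along propositional equalities such as `(l ++ l') ++ l'' = l ++ (l' ++ l'')` count as
permutations, so `PermEq` also hides all transport between lists. -/
theorem IsPerm.cast {l l' : List I} (h : l = l') : IsPerm X l l' (listTensorCast X h) := by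
  subst h
  exact .id l

/-- Two morphisms to ordered tensor products agree up to a permutation of the factors. -/
def PermEq {A : E} {l l' : List I} (f : A ⟶ listTensor X l) (g : A ⟶ listTensor X l') : Prop :=
  ∃ c, IsPerm X l l' c ∧ f ≫ c = g

namespace PermEq

variable {A B D : E} {l l' l'' : List I} {f : A ⟶ listTensor X l} {g : A ⟶ listTensor X l'}
  {h : A ⟶ listTensor X l''}

theorem of_eq {f f' : A ⟶ listTensor X l} (h : f = f') : PermEq f f' :=
  ⟨𝟙 _, .id l, (Category.comp_id _).trans h⟩

theorem refl (f : A ⟶ listTensor X l) : PermEq f f := of_eq rfl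

theorem symm (e : PermEq f g) : PermEq g f := by
  obtain ⟨c, hc, rfl⟩ := e
  obtain ⟨d, hd, h, -⟩ := hc.exists_inv
  exact ⟨d, hd, by rw [Category.assoc, h, Category.comp_id]⟩

theorem trans (e : PermEq f g) (e' : PermEq g h) : PermEq f h := by
  obtain ⟨c, hc, rfl⟩ := e
  obtain ⟨d, hd, rfl⟩ := e'
  exact ⟨c ≫ d, .comp hc hd, (Category.assoc _ _ _).symm⟩

theorem comp_left (k : B ⟶ A) (e : PermEq f g) : PermEq (k ≫ f) (k ≫ g) := by
  obtain ⟨c, hc, rfl⟩ := e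
  exact ⟨c, hc, Category.assoc _ _ _⟩

theorem comp_ι [HasColimitsOfSize.{u, u} E] (e : PermEq f g) (hl : IsOrdering l)
    (hl' : IsOrdering l') :
    f ≫ unorderedTensor.ι X l hl = g ≫ unorderedTensor.ι X l' hl' := by
  obtain ⟨c, hc, rfl⟩ := e
  rw [Category.assoc, hc.comp_ι hl hl']

theorem cons (i : I) (e : PermEq f g) :
    PermEq (X := X) (l := i :: l) (l' := i :: l') (X i ◁ f) (X i ◁ g) := by
  obtain ⟨c, hc, rfl⟩ := e
  exact ⟨_, .cons i hc, (MonoidalCategory.whiskerLeft_comp _ _ _).symm⟩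

end PermEq

/-! ### Concatenation -/

theorem listTensorAppend_naturality {Y : I → E} (f : ∀ i, X i ⟶ Y i) (l' : List I) :
    ∀ l : List I, (listTensorMap f l ⊗ₘ listTensorMap f l') ≫ listTensorAppend Y l' l =
      listTensorAppend X l' l ≫ listTensorMap f (l ++ l')
  | [] => by
    change (𝟙 (𝟙_ E) ⊗ₘ listTensorMap f l') ≫ (λ_ (listTensor Y l')).hom =
      (λ_ (listTensor X l')).hom ≫ listTensorMap f l'
    rw [id_tensorHom, leftUnitor_naturality]
  | i :: l => by
    have h := listTensorAppend_naturality f l' l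
    change ((f i ⊗ₘ listTensorMap f l) ⊗ₘ listTensorMap f l') ≫
        (α_ (Y i) (listTensor Y l) (listTensor Y l')).hom ≫ Y i ◁ listTensorAppend Y l' l =
      ((α_ (X i) (listTensor X l) (listTensor X l')).hom ≫ X i ◁ listTensorAppend X l' l) ≫
        (f i ⊗ₘ listTensorMap f (l ++ l'))
    rw [associator_naturality_assoc, Category.assoc]
    exact congrArg _ (swap_naturality_cons (f i) h)

/-- An exchange of the first two factors commutes with whatever acts behind them. It brings the maps
into the same order on both sides, so that only associators remain to be compared. -/
theorem interchange_naturality {a b c c' : E} (s : a ⊗ b ⟶ b ⊗ a) (t : c ⟶ c') :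
    a ◁ b ◁ t ≫ (α_ a b c').inv ≫ s ▷ c' ≫ (α_ b a c').hom =
      ((α_ a b c).inv ≫ s ▷ c ≫ (α_ b a c).hom) ≫ b ◁ a ◁ t := by
  rw [associator_inv_naturality_right_assoc, whisker_exchange_assoc, associator_naturality_right]
  simp only [Category.assoc]

/-- A permutation of the left block extends to the concatenation. Concatenation recurses on the left
list, so each generator of `IsPerm` has to be moved past the associators; for the right block this
is mere naturality. -/
theorem IsPerm.exists_append_right (l₂ : List I) {l l' : List I}
    {f : listTensor X l ⟶ listTensor X l'} (hf : IsPerm X l l' f) :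
    ∃ g, IsPerm X (l ++ l₂) (l' ++ l₂) g ∧
      listTensorAppend X l₂ l ≫ g = f ▷ listTensor X l₂ ≫ listTensorAppend X l₂ l' := by
  induction hf with
  | id l => exact ⟨𝟙 _, .id _, by rw [Category.comp_id, id_whiskerRight, Category.id_comp]⟩
  | @cons i l l' f hf ih =>
    obtain ⟨g, hg, h⟩ := ih
    refine ⟨X i ◁ g, .cons i hg, ?_⟩
    change ((α_ (X i) (listTensor X l) (listTensor X l₂)).hom ≫ X i ◁ listTensorAppend X l₂ l) ≫
      X i ◁ g = (X i ◁ f) ▷ listTensor X l₂ ≫ (α_ (X i) (listTensor X l') (listTensor X l₂)).hom ≫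
        X i ◁ listTensorAppend X l₂ l'
    rw [Category.assoc, ← MonoidalCategory.whiskerLeft_comp, h,
      MonoidalCategory.whiskerLeft_comp, associator_naturality_middle_assoc]
  | swap a b l =>
    refine ⟨_, .swap a b (l ++ l₂), ?_⟩
    change ((α_ (X a) (X b ⊗ listTensor X l) (listTensor X l₂)).hom ≫ X a ◁
        ((α_ (X b) (listTensor X l) (listTensor X l₂)).hom ≫ X b ◁ listTensorAppend X l₂ l)) ≫
        (α_ (X a) (X b) (listTensor X (l ++ l₂))).inv ≫
          (β_ (X a) (X b)).hom ▷ listTensor X (l ++ l₂) ≫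
          (α_ (X b) (X a) (listTensor X (l ++ l₂))).hom =
      ((α_ (X a) (X b) (listTensor X l)).inv ≫ (β_ (X a) (X b)).hom ▷ listTensor X l ≫
        (α_ (X b) (X a) (listTensor X l)).hom) ▷ listTensor X l₂ ≫
      (α_ (X b) (X a ⊗ listTensor X l) (listTensor X l₂)).hom ≫ X b ◁
        ((α_ (X a) (listTensor X l) (listTensor X l₂)).hom ≫ X a ◁ listTensorAppend X l₂ l)
    -- Nothing specific to these two maps is used any more; for arbitrary `s` and `t` the sides
    -- agree by naturality and coherence of associators.
    generalize listTensorAppend X l₂ l = t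
    generalize (β_ (X a) (X b)).hom = s
    simp only [MonoidalCategory.whiskerLeft_comp, Category.assoc]
    rw [interchange_naturality]
    monoidal
  | comp _ _ ih ih' =>
    obtain ⟨g, hg, h⟩ := ih
    obtain ⟨g', hg', h'⟩ := ih'
    exact ⟨g ≫ g', .comp hg hg', by
      rw [reassoc_of% h, h', comp_whiskerRight, Category.assoc]⟩

theorem IsPerm.exists_append_left {l l' : List I} {f : listTensor X l ⟶ listTensor X l'}
    (hf : IsPerm X l l' f) : ∀ l₁ : List I, ∃ g, IsPerm X (l₁ ++ l) (l₁ ++ l') g ∧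
      listTensorAppend X l l₁ ≫ g = listTensor X l₁ ◁ f ≫ listTensorAppend X l' l₁
  | [] => ⟨f, hf, (leftUnitor_naturality f).symm⟩
  | i :: l₁ => by
    obtain ⟨g, hg, h⟩ := hf.exists_append_left l₁
    refine ⟨X i ◁ g, .cons i hg, ?_⟩
    change ((α_ (X i) (listTensor X l₁) (listTensor X l)).hom ≫ X i ◁ listTensorAppend X l l₁) ≫
      X i ◁ g = (X i ⊗ listTensor X l₁) ◁ f ≫ (α_ (X i) (listTensor X l₁) (listTensor X l')).hom ≫
        X i ◁ listTensorAppend X l' l₁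
    rw [Category.assoc, ← MonoidalCategory.whiskerLeft_comp, h,
      MonoidalCategory.whiskerLeft_comp, associator_naturality_right_assoc]

/-- The concatenation of two morphisms to ordered tensor products. -/
def listCat {A B : E} {l l' : List I} (f : A ⟶ listTensor X l) (g : B ⟶ listTensor X l') :
    A ⊗ B ⟶ listTensor X (l ++ l') :=
  (f ⊗ₘ g) ≫ listTensorAppend X l' l

/-- The left block is permuted first, then the right one; bifunctoriality of the tensor product
makes the two steps independent. Together with `comp_left` this turns `PermEq` into a calculus for
rewriting under concatenation. -/
theorem PermEq.listCat {A B : E} {l l' m m' : List I} {f : A ⟶ listTensor X l}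
    {f' : A ⟶ listTensor X l'} {g : B ⟶ listTensor X m} {g' : B ⟶ listTensor X m'}
    (e : PermEq f f') (e' : PermEq g g') :
    PermEq (ModularOperad.listCat f g) (ModularOperad.listCat f' g') := by
  obtain ⟨c, hc, rfl⟩ := e
  obtain ⟨d, hd, rfl⟩ := e'
  obtain ⟨c', hc', h⟩ := hc.exists_append_right m
  obtain ⟨d', hd', h'⟩ := hd.exists_append_left l'
  refine ⟨c' ≫ d', .comp hc' hd', ?_⟩
  unfold ModularOperad.listCat
  rw [Category.assoc, reassoc_of% h, h', ← tensorHom_comp_tensorHom]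
  simp only [MonoidalCategory.tensorHom_def, Category.assoc, whisker_exchange_assoc]

theorem comp_listCat {A A' B B' : E} {l l' : List I} (f : A ⟶ listTensor X l)
    (g : B ⟶ listTensor X l') (a : A' ⟶ A) (b : B' ⟶ B) :
    (a ⊗ₘ b) ≫ listCat f g = listCat (a ≫ f) (b ≫ g) := by
  unfold listCat
  rw [tensorHom_comp_tensorHom_assoc]

/-- The lists `l ++ []` and `l` agree only propositionally, so an equation of morphisms would not
even typecheck; `PermEq` absorbs the difference. -/
theorem listTensorAppend_nil : ∀ l : List I,
    PermEq (listTensorAppend X [] l) (ρ_ (listTensor X l)).hom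
  | [] => .of_eq (by
      change (λ_ (𝟙_ E)).hom = (ρ_ (𝟙_ E)).hom
      exact unitors_equal)
  | i :: l => by
    have h := (listTensorAppend_nil l).cons i
    refine (h.comp_left (α_ (X i) (listTensor X l) (𝟙_ E)).hom).trans (.of_eq ?_)
    change _ = (ρ_ (X i ⊗ listTensor X l)).hom
    monoidal

theorem listTensorAppend_assoc (l' l'' : List I) : ∀ l : List I,
    PermEq (listTensorAppend X l' l ▷ listTensor X l'' ≫ listTensorAppend X l'' (l ++ l'))
      ((α_ (listTensor X l) (listTensor X l') (listTensor X l'')).hom ≫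
        listTensor X l ◁ listTensorAppend X l'' l' ≫ listTensorAppend X (l' ++ l'') l)
  | [] => .of_eq (by
      change (λ_ (listTensor X l')).hom ▷ listTensor X l'' ≫ listTensorAppend X l'' l' =
        (α_ (𝟙_ E) (listTensor X l') (listTensor X l'')).hom ≫
        (𝟙_ E) ◁ listTensorAppend X l'' l' ≫ (λ_ (listTensor X (l' ++ l''))).hom
      generalize listTensorAppend X l'' l' = t
      monoidal)
  | i :: l => by
    have h := (listTensorAppend_assoc l' l'' l).cons i
    have h' := h.comp_left ((α_ (X i ⊗ listTensor X l) (listTensor X l') (listTensor X l'')).hom ≫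
      (α_ (X i) (listTensor X l) (listTensor X l' ⊗ listTensor X l'')).hom ≫
      X i ◁ (α_ (listTensor X l) (listTensor X l') (listTensor X l'')).inv)
    refine (PermEq.of_eq ?_).trans (h'.trans (PermEq.of_eq ?_))
    · change ((α_ (X i) (listTensor X l) (listTensor X l')).hom ≫ X i ◁ listTensorAppend X l' l) ▷
          listTensor X l'' ≫ (α_ (X i) (listTensor X (l ++ l')) (listTensor X l'')).hom ≫
          X i ◁ listTensorAppend X l'' (l ++ l') = _
      generalize listTensorAppend X l' l = s
      generalize listTensorAppend X l'' (l ++ l') = t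
      monoidal
    · change _ = (α_ (X i ⊗ listTensor X l) (listTensor X l') (listTensor X l'')).hom ≫
        (X i ⊗ listTensor X l) ◁ listTensorAppend X l'' l' ≫
        (α_ (X i) (listTensor X l) (listTensor X (l' ++ l''))).hom ≫
        X i ◁ listTensorAppend X (l' ++ l'') l
      generalize listTensorAppend X l'' l' = s
      generalize listTensorAppend X (l' ++ l'') l = t
      monoidal

/-- The factor `i`, standing behind the block `l'`, is brought to the front by passing one element
of `l'` at a time; by the hexagon the braiding with the whole block is the composite of these swaps.
-/
theorem listTensorAppend_cons (i : I) (l : List I) : ∀ l' : List I,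
    PermEq (listTensorAppend X (i :: l) l')
      (X := X) (l' := i :: (l' ++ l)) ((α_ (listTensor X l') (X i) (listTensor X l)).inv ≫
        (β_ (listTensor X l') (X i)).hom ▷ listTensor X l ≫
        (α_ (X i) (listTensor X l') (listTensor X l)).hom ≫ X i ◁ listTensorAppend X l l')
  | [] => .of_eq (by
      change (λ_ (X i ⊗ listTensor X l)).hom = (α_ (𝟙_ E) (X i) (listTensor X l)).inv ≫
        (β_ (𝟙_ E) (X i)).hom ▷ listTensor X l ≫
        (α_ (X i) (𝟙_ E) (listTensor X l)).hom ≫ X i ◁ (λ_ (listTensor X l)).hom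
      rw [braiding_tensorUnit_left]
      monoidal)
  | j :: l' => by
    have h := ((listTensorAppend_cons i l l').cons j).comp_left
      (α_ (X j) (listTensor X l') (X i ⊗ listTensor X l)).hom
    -- After the induction hypothesis `i` stands directly behind `j`, and one further swap moves it
    -- to the front.
    refine PermEq.trans h ⟨_, .swap j i _, ?_⟩
    change ((α_ (X j) (listTensor X l') (X i ⊗ listTensor X l)).hom ≫
      X j ◁ ((α_ (listTensor X l') (X i) (listTensor X l)).inv ≫
        (β_ (listTensor X l') (X i)).hom ▷ listTensor X l ≫
        (α_ (X i) (listTensor X l') (listTensor X l)).hom ≫ X i ◁ listTensorAppend X l l')) ≫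
      (α_ (X j) (X i) (listTensor X (l' ++ l))).inv ≫
        (β_ (X j) (X i)).hom ▷ listTensor X (l' ++ l) ≫
        (α_ (X i) (X j) (listTensor X (l' ++ l))).hom =
      (α_ (X j ⊗ listTensor X l') (X i) (listTensor X l)).inv ≫
        (β_ (X j ⊗ listTensor X l') (X i)).hom ▷ listTensor X l ≫
        (α_ (X i) (X j ⊗ listTensor X l') (listTensor X l)).hom ≫
        X i ◁ ((α_ (X j) (listTensor X l') (listTensor X l)).hom ≫ X j ◁ listTensorAppend X l l')
    rw [BraidedCategory.braiding_tensor_left_hom]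
    generalize listTensorAppend X l l' = t
    generalize (β_ (X j) (X i)).hom = s
    generalize (β_ (listTensor X l') (X i)).hom = s'
    simp only [MonoidalCategory.whiskerLeft_comp, Category.assoc]
    rw [interchange_naturality]
    monoidal

/-- Exchanging two blocks is a composite of neighbour swaps. The first block is taken apart one
factor at a time, each factor being moved by `listTensorAppend_cons`. -/
theorem listTensorAppend_comm (l' : List I) : ∀ l : List I,
    PermEq (listTensorAppend X l' l)
      ((β_ (listTensor X l) (listTensor X l')).hom ≫ listTensorAppend X l l')
  | [] => by
    refine PermEq.trans (.of_eq ?_)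
      ((listTensorAppend_nil l').symm.comp_left (β_ (𝟙_ E) (listTensor X l')).hom)
    change (λ_ (listTensor X l')).hom = _
    rw [braiding_tensorUnit_left, Category.assoc, Iso.inv_hom_id, Category.comp_id]
  | i :: l => by
    have h := ((listTensorAppend_comm l' l).cons i).comp_left
      (α_ (X i) (listTensor X l) (listTensor X l')).hom
    refine h.trans (PermEq.trans (.of_eq ?_) ((listTensorAppend_cons i l l').symm.comp_left
      (β_ (X i ⊗ listTensor X l) (listTensor X l')).hom))
    change (α_ (X i) (listTensor X l) (listTensor X l')).hom ≫
        X i ◁ ((β_ (listTensor X l) (listTensor X l')).hom ≫ listTensorAppend X l l') =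
      (β_ (X i ⊗ listTensor X l) (listTensor X l')).hom ≫
        (α_ (listTensor X l') (X i) (listTensor X l)).inv ≫
        (β_ (listTensor X l') (X i)).hom ▷ listTensor X l ≫
        (α_ (X i) (listTensor X l') (listTensor X l)).hom ≫ X i ◁ listTensorAppend X l l'
    -- The hexagon carries `X i` past the block `l'` and `listTensorAppend_cons` carries it back;
    -- the symmetry cancels the two.
    have e : (β_ (X i) (listTensor X l')).hom ≫ (β_ (listTensor X l') (X i)).hom = 𝟙 _ :=
      SymmetricCategory.symmetry _ _
    rw [BraidedCategory.braiding_tensor_left_hom, MonoidalCategory.whiskerLeft_comp]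
    simp only [Category.assoc, Iso.hom_inv_id_assoc]
    rw [← comp_whiskerRight_assoc, e, id_whiskerRight, Category.id_comp, Iso.inv_hom_id_assoc]

/-! ### Reindexing and removing parentheses -/

theorem IsPerm.exists_reindex {J : Type u} (σ : I → J) (Y : J → E) {l l' : List I}
    {f : listTensor (fun i => Y (σ i)) l ⟶ listTensor (fun i => Y (σ i)) l'}
    (hf : IsPerm (fun i => Y (σ i)) l l' f) : ∃ g, IsPerm Y (l.map σ) (l'.map σ) g ∧
      listTensorReindex σ Y l ≫ g = f ≫ listTensorReindex σ Y l' := by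
  induction hf with
  | id l => exact ⟨𝟙 _, .id _, by rw [Category.comp_id, Category.id_comp]⟩
  | cons i hf ih =>
    obtain ⟨g, hg, h⟩ := ih
    exact ⟨Y (σ i) ◁ g, .cons (σ i) hg, (MonoidalCategory.whiskerLeft_comp _ _ _).symm.trans
      ((congrArg (Y (σ i) ◁ ·) h).trans (MonoidalCategory.whiskerLeft_comp _ _ _))⟩
  | swap a b l =>
    refine ⟨_, .swap (σ a) (σ b) _, ?_⟩
    have e := swap_naturality_nil (𝟙 (Y (σ a))) (𝟙 (Y (σ b))) (listTensorReindex σ Y l)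
    simp only [id_tensorHom] at e
    exact e
  | comp _ _ ih ih' =>
    obtain ⟨g, hg, h⟩ := ih
    obtain ⟨g', hg', h'⟩ := ih'
    exact ⟨g ≫ g', .comp hg hg', by rw [reassoc_of% h, h', Category.assoc]⟩

theorem whiskerLeft_tensor_assoc_comp {a b c b' c' d : E} (f : b ⟶ b') (g : c ⟶ c')
    (t : b' ⊗ c' ⟶ d) :
    (a ◁ f ⊗ₘ g) ≫ (α_ a b' c').hom ≫ a ◁ t = (α_ a b c).hom ≫ a ◁ ((f ⊗ₘ g) ≫ t) := by
  rw [← id_tensorHom, associator_naturality_assoc, id_tensorHom,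
    MonoidalCategory.whiskerLeft_comp]

theorem listTensorAppend_reindex {J : Type u} (σ : I → J) (Y : J → E) (l' : List I) :
    ∀ l : List I, PermEq (listTensorAppend (fun i => Y (σ i)) l' l ≫
        listTensorReindex σ Y (l ++ l'))
      (listCat (listTensorReindex σ Y l) (listTensorReindex σ Y l'))
  | [] => .of_eq (by
      change (λ_ (listTensor (fun i => Y (σ i)) l')).hom ≫ listTensorReindex σ Y l' =
        (𝟙 (𝟙_ E) ⊗ₘ listTensorReindex σ Y l') ≫ (λ_ (listTensor Y (l'.map σ))).hom
      rw [id_tensorHom, leftUnitor_naturality])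
  | i :: l => by
    have h := ((listTensorAppend_reindex σ Y l' l).cons (σ i)).comp_left
      (α_ (Y (σ i)) (listTensor (fun i => Y (σ i)) l) (listTensor (fun i => Y (σ i)) l')).hom
    refine (PermEq.of_eq ?_).trans (h.trans (PermEq.of_eq ?_))
    · change ((α_ (Y (σ i)) _ _).hom ≫ Y (σ i) ◁ listTensorAppend (fun i => Y (σ i)) l' l) ≫
        Y (σ i) ◁ listTensorReindex σ Y (l ++ l') = _
      rw [Category.assoc, ← MonoidalCategory.whiskerLeft_comp]
      rfl
    · change _ = (Y (σ i) ◁ listTensorReindex σ Y l ⊗ₘ listTensorReindex σ Y l') ≫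
        (α_ _ _ _).hom ≫ Y (σ i) ◁ listTensorAppend Y (l'.map σ) (l.map σ)
      exact (whiskerLeft_tensor_assoc_comp _ _ _).symm

theorem listCat_reindex {J : Type u} (σ : I → J) (Y : J → E) {A B : E} {l l' : List I}
    (f : A ⟶ listTensor (fun i => Y (σ i)) l) (g : B ⟶ listTensor (fun i => Y (σ i)) l') :
    PermEq (listCat (X := fun i => Y (σ i)) f g ≫ listTensorReindex σ Y (l ++ l'))
      (listCat (f ≫ listTensorReindex σ Y l) (g ≫ listTensorReindex σ Y l')) := by
  rw [← comp_listCat]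
  unfold listCat
  rw [Category.assoc]
  exact (listTensorAppend_reindex σ Y l' l).comp_left _

theorem listTensorReindex_reindex {J K : Type u} (σ : I → J) (τ : J → K) (Z : K → E) (l : List I) :
    PermEq (listTensorReindex σ (fun j => Z (τ j)) l ≫ listTensorReindex τ Z (l.map σ))
      (listTensorReindex (fun i => τ (σ i)) Z l) :=
  ⟨listTensorCast Z List.map_map, .cast _, by
    rw [Category.assoc]
    exact listTensorReindex_comp σ τ Z l _⟩

theorem listCat_assoc {A B D : E} {l l' l'' : List I} (f : A ⟶ listTensor X l)
    (g : B ⟶ listTensor X l') (h : D ⟶ listTensor X l'') :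
    PermEq (listCat (listCat f g) h) ((α_ A B D).hom ≫ listCat f (listCat g h)) := by
  have e := (listTensorAppend_assoc (X := X) l' l'' l).comp_left ((f ⊗ₘ g) ⊗ₘ h)
  refine (PermEq.of_eq ?_).trans (e.trans (PermEq.of_eq ?_))
  · unfold listCat
    simp only [MonoidalCategory.tensorHom_def, comp_whiskerRight, Category.assoc]
    rw [whisker_exchange_assoc]
  · unfold listCat
    rw [associator_naturality_assoc, ← id_tensorHom, tensorHom_comp_tensorHom_assoc,
      Category.comp_id]

theorem listCat_comm {A B : E} {l l' : List I} (f : A ⟶ listTensor X l)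
    (g : B ⟶ listTensor X l') : PermEq (listCat f g) ((β_ A B).hom ≫ listCat g f) := by
  unfold listCat
  rw [← BraidedCategory.braiding_naturality_assoc]
  exact (listTensorAppend_comm l' l).comp_left _

/-- Exchanging two vertices of the outer graph exchanges the whole blocks of vertices substituted
for them, so a block version of the neighbour swap is required. -/
theorem listCat_swap {A B D : E} {l l' l'' : List I} (f : A ⟶ listTensor X l)
    (g : B ⟶ listTensor X l') (h : D ⟶ listTensor X l'') :
    PermEq (((α_ A B D).inv ≫ (β_ A B).hom ▷ D ≫ (α_ B A D).hom) ≫ listCat g (listCat f h))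
      (listCat f (listCat g h)) := by
  have e₁ := (listCat_assoc g f h).comp_left ((α_ A B D).inv ≫ (β_ A B).hom ▷ D)
  have e₂ := ((listCat_comm f g).listCat (.refl h)).comp_left (α_ A B D).inv
  have e₃ := (listCat_assoc f g h).comp_left (α_ A B D).inv
  rw [Iso.inv_hom_id_assoc] at e₃
  refine (PermEq.trans (.of_eq ?_) e₁.symm).trans
    (PermEq.trans (.of_eq ?_) (e₂.symm.trans e₃))
  · simp only [Category.assoc]
  · rw [Category.assoc, ← tensorHom_id, comp_listCat, Category.id_comp]

variable {J : I → Type u} {Y : (Σ i, J i) → E}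

theorem listTensorFlatten_naturality {Z : (Σ i, J i) → E} (f : ∀ p, Y p ⟶ Z p)
    (m : ∀ i, List (J i)) : ∀ l : List I,
    listTensorMap (fun i => listTensorMap (fun j => f ⟨i, j⟩) (m i)) l ≫ listTensorFlatten Z m l =
      listTensorFlatten Y m l ≫ listTensorMap f (l.sigma m)
  | [] => rfl
  | i :: l => by
    refine (tensorHom_comp_tensorHom_assoc _ _ _ _ _).trans ?_
    rw [listTensorFlatten_naturality f m l, ← listTensorMap_reindex]
    refine (tensorHom_comp_tensorHom_assoc _ _ _ _ _).symm.trans ?_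
    refine Eq.trans ?_ (Category.assoc _ _ _).symm
    exact congrArg _ (listTensorAppend_naturality f (l.sigma m) _)

/-- Invariance under reordering the vertices of each substituted graph: a permutation inside a block
extends to the concatenation of the blocks. -/
theorem listTensorFlatten_perm_fiber {m m' : ∀ i, List (J i)}
    (φ : ∀ i, listTensor (fun j => Y ⟨i, j⟩) (m i) ⟶ listTensor (fun j => Y ⟨i, j⟩) (m' i))
    (hφ : ∀ i, IsPerm (fun j => Y ⟨i, j⟩) (m i) (m' i) (φ i)) : ∀ l : List I,
    PermEq (listTensorMap φ l ≫ listTensorFlatten Y m' l) (listTensorFlatten Y m l)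
  | [] => .of_eq (Category.id_comp _)
  | i :: l => by
    refine (PermEq.of_eq (comp_listCat (listTensorReindex (Sigma.mk i) Y (m' i))
      (listTensorFlatten Y m' l) (φ i) (listTensorMap φ l))).trans
      (PermEq.listCat ?_ (listTensorFlatten_perm_fiber φ hφ l))
    obtain ⟨d, hd, h⟩ := (hφ i).exists_reindex (Sigma.mk i) Y
    exact PermEq.symm ⟨d, hd, h⟩

/-- Invariance under reordering the vertices of the outer graph; the essential case is
`listCat_swap`. -/
theorem listTensorFlatten_perm (m : ∀ i, List (J i)) {l l' : List I}
    {f : listTensor (fun i => listTensor (fun j => Y ⟨i, j⟩) (m i)) l ⟶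
      listTensor (fun i => listTensor (fun j => Y ⟨i, j⟩) (m i)) l'} (hf : IsPerm _ l l' f) :
    PermEq (f ≫ listTensorFlatten Y m l') (listTensorFlatten Y m l) := by
  induction hf with
  | id l => exact .of_eq (Category.id_comp _)
  | @cons i l l' f hf ih =>
    refine (PermEq.of_eq ?_).trans ((PermEq.refl (listTensorReindex (Sigma.mk i) Y (m i))).listCat ih)
    refine Eq.trans ?_ ((comp_listCat (listTensorReindex (Sigma.mk i) Y (m i))
      (listTensorFlatten Y m l') (𝟙 _) f).trans (congrArg (listCat · _) (Category.id_comp _)))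
    rw [id_tensorHom]
    rfl
  | swap a b l =>
    exact listCat_swap (listTensorReindex (Sigma.mk a) Y (m a))
      (listTensorReindex (Sigma.mk b) Y (m b)) (listTensorFlatten Y m l)
  | @comp l l' l'' f g hf hg ih ih' =>
    rw [Category.assoc]
    exact (ih'.comp_left f).trans ih

theorem listTensorFlatten_append (m : ∀ i, List (J i)) (l' : List I) : ∀ l : List I,
    PermEq (listTensorAppend (fun i => listTensor (fun j => Y ⟨i, j⟩) (m i)) l' l ≫
        listTensorFlatten Y m (l ++ l'))
      (listCat (listTensorFlatten Y m l) (listTensorFlatten Y m l'))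
  | [] => .of_eq (by
      change (λ_ _).hom ≫ listTensorFlatten Y m l' =
        (𝟙 (𝟙_ E) ⊗ₘ listTensorFlatten Y m l') ≫ (λ_ _).hom
      rw [id_tensorHom, leftUnitor_naturality])
  | i :: l => by
    have h := ((PermEq.refl (listTensorReindex (Sigma.mk i) Y (m i))).listCat
      (listTensorFlatten_append m l' l)).comp_left (α_ _ _ _).hom
    refine (PermEq.of_eq ?_).trans (h.trans (listCat_assoc (listTensorReindex (Sigma.mk i) Y (m i))
      (listTensorFlatten Y m l) (listTensorFlatten Y m l')).symm)
    refine (Category.assoc _ _ _).trans (congrArg ((α_ _ _ _).hom ≫ ·) ?_)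
    refine Eq.trans ?_ ((comp_listCat (listTensorReindex (Sigma.mk i) Y (m i))
      (listTensorFlatten Y m (l ++ l')) (𝟙 _) _).trans (congrArg (listCat · _) (Category.id_comp _)))
    rw [id_tensorHom]
    rfl

/-- Relabelling of the outer indices, needed when the base graph is replaced by an equivalent one.
-/
theorem listTensorFlatten_reindex {I' : Type u} {J' : I' → Type u} (σ : I → I')
    (Y : (Σ i, J' i) → E) (m : ∀ i, List (J' i)) : ∀ l : List I,
    PermEq (listTensorReindex σ (fun i' => listTensor (fun j => Y ⟨i', j⟩) (m i')) l ≫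
        listTensorFlatten Y m (l.map σ))
      (listTensorFlatten (fun p : Σ i, J' (σ i) => Y ⟨σ p.1, p.2⟩) (fun i => m (σ i)) l ≫
        listTensorReindex (fun p : Σ i, J' (σ i) => (⟨σ p.1, p.2⟩ : Σ i, J' i)) Y
          (l.sigma fun i => m (σ i)))
  | [] => .of_eq rfl
  | i :: l => by
    refine (PermEq.of_eq ?_).trans (PermEq.trans
      ((listTensorReindex_reindex (Sigma.mk i) (fun p : Σ i, J' (σ i) => (⟨σ p.1, p.2⟩ : Σ i, J' i))
        Y (m (σ i))).symm.listCat (listTensorFlatten_reindex σ Y m l))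
      (listCat_reindex (fun p : Σ i, J' (σ i) => (⟨σ p.1, p.2⟩ : Σ i, J' i)) Y
        (listTensorReindex (Sigma.mk i) (fun p : Σ i, J' (σ i) => Y ⟨σ p.1, p.2⟩) (m (σ i)))
        (listTensorFlatten (fun p : Σ i, J' (σ i) => Y ⟨σ p.1, p.2⟩) (fun i => m (σ i)) l)).symm)
    refine Eq.trans ?_ ((comp_listCat (listTensorReindex (Sigma.mk (σ i)) Y (m (σ i)))
      (listTensorFlatten Y m (l.map σ)) (𝟙 _) _).trans (congrArg (listCat · _) (Category.id_comp _)))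
    rw [id_tensorHom]
    rfl

/-- Relabelling of the inner indices, needed when the substituted graphs are replaced. -/
theorem listTensorFlatten_reindex_fiber {J' : I → Type u} (σ : ∀ i, J i → J' i)
    (Y : (Σ i, J' i) → E) (m : ∀ i, List (J i)) : ∀ l : List I,
    PermEq (listTensorMap (fun i => listTensorReindex (σ i) (fun j => Y ⟨i, j⟩) (m i)) l ≫
        listTensorFlatten Y (fun i => (m i).map (σ i)) l)
      (listTensorFlatten (fun p : Σ i, J i => Y ⟨p.1, σ p.1 p.2⟩) m l ≫
        listTensorReindex (fun p : Σ i, J i => (⟨p.1, σ p.1 p.2⟩ : Σ i, J' i)) Y (l.sigma m))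
  | [] => .of_eq rfl
  | i :: l => by
    refine (PermEq.of_eq (comp_listCat _ _ _ _)).trans (PermEq.trans
      (PermEq.listCat ?_ (listTensorFlatten_reindex_fiber σ Y m l))
      (listCat_reindex (fun p : Σ i, J i => (⟨p.1, σ p.1 p.2⟩ : Σ i, J' i)) Y
        (listTensorReindex (Sigma.mk i) (fun p : Σ i, J i => Y ⟨p.1, σ p.1 p.2⟩) (m i))
        (listTensorFlatten (fun p : Σ i, J i => Y ⟨p.1, σ p.1 p.2⟩) m l)).symm)
    exact (listTensorReindex_reindex (σ i) (Sigma.mk i) Y (m i)).trans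
      (listTensorReindex_reindex (Sigma.mk i)
        (fun p : Σ i, J i => (⟨p.1, σ p.1 p.2⟩ : Σ i, J' i)) Y (m i)).symm

/-- The tensor half of the associativity law. Removing the outer or the inner parentheses first
produces the triples in the same lexicographic order, nested differently as indices; the final
reindexing accounts for the nesting. The induction splits off the first block by
`listTensorFlatten_append`. -/
theorem listTensorFlatten_assoc {K : (Σ i, J i) → Type u} (Y : (Σ p, K p) → E)
    (m : ∀ i, List (J i)) (n : ∀ p, List (K p)) : ∀ l : List I,
    PermEq (listTensorFlatten (fun p => listTensor (fun k => Y ⟨p, k⟩) (n p)) m l ≫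
        listTensorFlatten Y n (l.sigma m))
      (listTensorMap (fun i => listTensorFlatten (fun q : Σ j, K ⟨i, j⟩ => Y ⟨⟨i, q.1⟩, q.2⟩)
          (fun j => n ⟨i, j⟩) (m i)) l ≫
        listTensorFlatten (fun r : Σ i, Σ j, K ⟨i, j⟩ => Y ⟨⟨r.1, r.2.1⟩, r.2.2⟩)
          (fun i => (m i).sigma fun j => n ⟨i, j⟩) l ≫
        listTensorReindex (fun r : Σ i, Σ j, K ⟨i, j⟩ => (⟨⟨r.1, r.2.1⟩, r.2.2⟩ : Σ p, K p)) Y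
          (l.sigma fun i => (m i).sigma fun j => n ⟨i, j⟩))
  | [] => .of_eq (by
      change 𝟙 (𝟙_ E) ≫ 𝟙 (𝟙_ E) = 𝟙 (𝟙_ E) ≫ 𝟙 (𝟙_ E) ≫ 𝟙 (𝟙_ E)
      rw [Category.comp_id, Category.comp_id])
  | i :: l => by
    have h₁ := (listTensorFlatten_append n (l.sigma m) ((m i).map (Sigma.mk i))
      (Y := Y)).comp_left (listTensorReindex (Sigma.mk i) (fun p => listTensor (fun k => Y ⟨p, k⟩)
        (n p)) (m i) ⊗ₘ listTensorFlatten (fun p => listTensor (fun k => Y ⟨p, k⟩) (n p)) m l)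
    have h₂ := listTensorFlatten_reindex (Sigma.mk i) Y n (m i)
    refine (PermEq.of_eq (Category.assoc _ _ _)).trans (h₁.trans ?_)
    rw [comp_listCat]
    refine (h₂.listCat (listTensorFlatten_assoc Y m n l)).trans (PermEq.symm ?_)
    let τ := fun r : Σ i, Σ j, K ⟨i, j⟩ => (⟨⟨r.1, r.2.1⟩, r.2.2⟩ : Σ p, K p)
    have h₄ := (listCat_reindex τ Y
      (listTensorReindex (Sigma.mk i) (fun r : Σ i, Σ j, K ⟨i, j⟩ => Y (τ r))
        ((m i).sigma fun j => n ⟨i, j⟩))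
      (listTensorFlatten (fun r => Y (τ r)) (fun i => (m i).sigma fun j => n ⟨i, j⟩) l)).comp_left
      (listTensorMap (fun i => listTensorFlatten (fun q : Σ j, K ⟨i, j⟩ => Y ⟨⟨i, q.1⟩, q.2⟩)
          (fun j => n ⟨i, j⟩) (m i)) (i :: l))
    refine h₄.trans ?_
    refine (PermEq.of_eq (comp_listCat _ _ _ _)).trans (PermEq.listCat ?_ (.refl _))
    exact (listTensorReindex_reindex (Sigma.mk i) τ Y _).comp_left _

/-- The case of a single block, which occurs when the outer graph is a corolla (left unit law). -/
theorem listTensorFlatten_singleton (m : ∀ i, List (J i)) (i : I) :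
    PermEq (listTensorFlatten Y m [i])
      ((ρ_ (listTensor (fun j => Y ⟨i, j⟩) (m i))).hom ≫ listTensorReindex (Sigma.mk i) Y (m i)) := by
  refine ((listTensorAppend_nil ((m i).map (Sigma.mk i))).comp_left
    (listTensorReindex (Sigma.mk i) Y (m i) ⊗ₘ 𝟙 (𝟙_ E))).trans (.of_eq ?_)
  rw [tensorHom_id]
  exact rightUnitor_naturality _

theorem rightUnitor_tensor_whiskerLeft {a b c d : E} (t : b ⟶ c) (t' : c ⟶ d) :
    (a ◁ 𝟙 (𝟙_ E) ⊗ₘ (t ≫ t')) ≫ (α_ a (𝟙_ E) d).hom ≫ a ◁ (λ_ d).hom =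
      ((ρ_ a).hom ⊗ₘ t) ≫ a ◁ t' := by
  rw [MonoidalCategory.whiskerLeft_id, MonoidalCategory.triangle, ← tensorHom_id,
    tensorHom_comp_tensorHom, ← id_tensorHom, tensorHom_comp_tensorHom, Category.comp_id,
    Category.id_comp, Category.comp_id]

/-- The case of blocks of length one, which occurs when corollas are substituted (right unit law).
-/
theorem listTensorFlatten_section (s : ∀ i, J i) : ∀ l : List I,
    PermEq (listTensorFlatten Y (fun i => [s i]) l)
      (listTensorMap (fun i => (ρ_ (Y ⟨i, s i⟩)).hom) l ≫ listTensorReindex (fun i => ⟨i, s i⟩) Y l)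
  | [] => .of_eq (Category.comp_id _).symm
  | i :: l => by
    have h := (PermEq.refl (listTensorReindex (Sigma.mk i) Y [s i])).listCat
      (listTensorFlatten_section s l)
    refine h.trans (.of_eq ?_)
    change (Y ⟨i, s i⟩ ◁ 𝟙 (𝟙_ E) ⊗ₘ _) ≫ (α_ (Y ⟨i, s i⟩) (𝟙_ E) _).hom ≫
      Y ⟨i, s i⟩ ◁ (λ_ _).hom = ((ρ_ (Y ⟨i, s i⟩)).hom ⊗ₘ _) ≫ Y ⟨i, s i⟩ ◁ _
    generalize listTensorMap (fun i => (ρ_ (Y ⟨i, s i⟩)).hom) l = t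
    generalize listTensorReindex (fun i => (⟨i, s i⟩ : Σ i, J i)) Y l = t'
    exact rightUnitor_tensor_whiskerLeft t t'

instance isIso_listTensorReindex {J : Type u} (σ : I → J) (Y : J → E) : ∀ l : List I,
    IsIso (listTensorReindex σ Y l)
  | [] => inferInstanceAs (IsIso (𝟙 (𝟙_ E)))
  | i :: l =>
    haveI := isIso_listTensorReindex σ Y l
    inferInstanceAs (IsIso (Y (σ i) ◁ listTensorReindex σ Y l))

instance isIso_listTensorAppend (l' : List I) : ∀ l : List I, IsIso (listTensorAppend X l' l)
  | [] => inferInstanceAs (IsIso (λ_ (listTensor X l')).hom)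
  | i :: l =>
    haveI := isIso_listTensorAppend l' l
    inferInstanceAs (IsIso ((α_ (X i) (listTensor X l) (listTensor X l')).hom ≫
      X i ◁ listTensorAppend X l' l))

/-- Every ingredient is structural, hence invertible. This lets a test for equality on a flat tensor
product be transported to a nested one in `listTensor_nested_hom_ext`. -/
instance isIso_listTensorFlatten (m : ∀ i, List (J i)) : ∀ l : List I,
    IsIso (listTensorFlatten Y m l)
  | [] => inferInstanceAs (IsIso (𝟙 (𝟙_ E)))
  | i :: l =>
    haveI := isIso_listTensorFlatten m l
    inferInstanceAs (IsIso ((listTensorReindex (Sigma.mk i) Y (m i) ⊗ₘ listTensorFlatten Y m l) ≫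
      listTensorAppend Y (l.sigma m) ((m i).map (Sigma.mk i))))

/-! ### Tensor products of unordered tensor products -/

section Unordered

variable [HasColimitsOfSize.{u, u} E] [∀ X : E, PreservesColimitsOfSize.{u, u} (tensorLeft X)]
  (W : ∀ i, J i → E)

theorem unorderedTensor_ι_map_id {X' : I → E} (f : ∀ i, X i ⟶ X' i) (l : List I)
    (hl : IsOrdering l) :
    unorderedTensor.ι X l hl ≫ unorderedTensor.map (fun i => i) Function.bijective_id f =
      listTensorMap f l ≫ unorderedTensor.ι X' l hl := by
  have e : l = l.map (fun i => i) := (List.map_id' l).symm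
  rw [unorderedTensor.ι_map, listTensorReindex_id X' l e, listTensorCast_ι X' e hl]

/-- The shape of the diagram which defines the unordered tensor product. -/
abbrev tensorShape (I : Type u) : MultispanShape where
  L := MarkedOrdering I
  R := Enumeration I
  fst := fun s => ⟨s.l₁ ++ s.a :: s.b :: s.l₂, s.isOrdering⟩
  snd := fun s => ⟨s.l₁ ++ s.b :: s.a :: s.l₂,
    s.isOrdering.perm ((List.Perm.swap s.b s.a s.l₂).append_left s.l₁)⟩

/-- The ordering belonging to an object of the index category of the unordered tensor product. -/
def shapeOrdering {I : Type u} : WalkingMultispan (tensorShape I) → Enumeration I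
  | .left s => ⟨s.l₁ ++ s.a :: s.b :: s.l₂, s.isOrdering⟩
  | .right l => l

/-- The identification of the values of the diagram which defines the unordered tensor product. -/
def shapeMap (X : I → E) : ∀ j : WalkingMultispan (tensorShape I),
    (tensorIndex X).multispan.obj j ⟶ listTensor X (shapeOrdering j).1
  | .left s => 𝟙 (listTensor X (s.l₁ ++ s.a :: s.b :: s.l₂))
  | .right l => 𝟙 (listTensor X l.1)

/-- With a marked ordering read as the list in which `a` precedes `b`, one leg of the multispan is
an identity and the other a swap, so all arrows of the diagram are permutations. -/
theorem shapeMap_naturality {j j' : WalkingMultispan (tensorShape I)} (f : j ⟶ j') :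
    ∃ φ, IsPerm X (shapeOrdering j).1 (shapeOrdering j').1 φ ∧
      (tensorIndex X).multispan.map f ≫ shapeMap X j' = shapeMap X j ≫ φ := by
  obtain j | s | s := f
  · refine ⟨𝟙 _, .id _, ?_⟩
    refine (congrArg (· ≫ _) ((tensorIndex X).multispan.map_id j)).trans ?_
    exact (Category.id_comp _).trans (Category.comp_id _).symm
  · exact ⟨𝟙 _, .id _, rfl⟩
  · refine ⟨listTensorSwap X s.a s.b s.l₂ s.l₁, IsPerm.listTensorSwap s.a s.b s.l₂ s.l₁, ?_⟩
    exact (Category.comp_id _).trans (Category.id_comp _).symm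

theorem shapeMap_ι (j : WalkingMultispan (tensorShape I)) :
    shapeMap X j ≫ unorderedTensor.ι X _ (shapeOrdering j).2 =
      colimit.ι (tensorIndex X).multispan j := by
  obtain s | l := j
  · refine Eq.trans ?_ (colimit.w (tensorIndex X).multispan (WalkingMultispan.Hom.fst s))
    rfl
  · exact Category.id_comp _

/-- The unordered tensor product is a colimit over a walking multispan, so the universal property of
tensor products of colimits applies with these shapes. Each object of the shape determines an
ordering, which reduces the test to orderings. -/
theorem listTensor_unordered_hom_ext {l : List I} (hl : IsOrdering l) {Z : E}
    {f g : listTensor (fun i => unorderedTensor (W i)) l ⟶ Z}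
    (h : ∀ (m : ∀ i, List (J i)) (hm : ∀ i, IsOrdering (m i)),
      listTensorMap (fun i => unorderedTensor.ι (W i) (m i) (hm i)) l ≫ f =
        listTensorMap (fun i => unorderedTensor.ι (W i) (m i) (hm i)) l ≫ g) : f = g := by
  refine listTensor_hom_ext (J := fun i => WalkingMultispan (tensorShape (J i)))
    (fun i => colimit.cocone (tensorIndex (W i)).multispan) (fun i => colimit.isColimit _) hl
    fun j => ?_
  have e : ∀ i, shapeMap (W i) (j i) ≫ unorderedTensor.ι (W i) _ (shapeOrdering (j i)).2 =
    (colimit.cocone (tensorIndex (W i)).multispan).ι.app (j i) := fun i => shapeMap_ι (j i)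
  simp_rw [← e]
  have h' := congrArg (listTensorMap (fun i => shapeMap (W i) (j i)) l ≫ ·)
    (h (fun i => (shapeOrdering (j i)).1) fun i => (shapeOrdering (j i)).2)
  rw [← Category.assoc, ← Category.assoc, ← listTensorMap_comp] at h'
  exact h'

/-- The arrows of the product of the multispans are families of permutations by
`shapeMap_naturality`, so invariance under such families is compatibility with the whole diagram. -/
theorem listTensor_unordered_exists_desc {l : List I} (hl : IsOrdering l) {Z : E}
    (k : ∀ m : (∀ i, List (J i)), (∀ i, IsOrdering (m i)) →
      (listTensor (fun i => listTensor (W i) (m i)) l ⟶ Z))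
    (hk : ∀ (m m' : ∀ i, List (J i)) (hm : ∀ i, IsOrdering (m i)) (hm' : ∀ i, IsOrdering (m' i))
      (φ : ∀ i, listTensor (W i) (m i) ⟶ listTensor (W i) (m' i)),
      (∀ i, IsPerm (W i) (m i) (m' i) (φ i)) → listTensorMap φ l ≫ k m' hm' = k m hm) :
    ∃ d : listTensor (fun i => unorderedTensor (W i)) l ⟶ Z,
      ∀ m hm, listTensorMap (fun i => unorderedTensor.ι (W i) (m i) (hm i)) l ≫ d = k m hm := by
  obtain ⟨d, hd⟩ := listTensor_exists_desc (J := fun i => WalkingMultispan (tensorShape (J i)))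
    (fun i => colimit.cocone (tensorIndex (W i)).multispan) (fun i => colimit.isColimit _) hl
    (fun j => listTensorMap (fun i => shapeMap (W i) (j i)) l ≫
      k (fun i => (shapeOrdering (j i)).1) fun i => (shapeOrdering (j i)).2)
    (fun j j' f => by
      choose φ hφ e using fun i => shapeMap_naturality (X := W i) (f i)
      rw [← Category.assoc, ← listTensorMap_comp]
      simp_rw [e]
      rw [listTensorMap_comp, Category.assoc, hk _ _ _ _ φ hφ])
  refine ⟨d, fun m hm => ?_⟩
  refine (hd fun i => .right ⟨m i, hm i⟩).trans ?_
  refine (congrArg (· ≫ _) (listTensorMap_id _ l)).trans (Category.id_comp _)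

end Unordered

end Permutation

/-! ### Tensor products of unordered tensor products and of slice colimits -/

section Slice

variable {C : Type u} [SmallCategory C] [CategoryWithDuality C]
  {E : Type w} [Category.{v} E] [MonoidalCategory E] [SymmetricCategory E]
  [HasColimitsOfSize.{u, u} E] [∀ X : E, PreservesColimitsOfSize.{u, u} (tensorLeft X)]

/-- Reordering inside the blocks changes the flattening by a permutation only, so it descends to the
unordered inner products. The outer order stays fixed here and is dealt with in `braceColimit_swap`.
-/
theorem exists_unorderedFlatten {I : Type u} {J : I → Type u} (X : (Σ i, J i) → E) {l : List I}
    (hl : IsOrdering l) :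
    ∃ d : listTensor (fun i => unorderedTensor fun j => X ⟨i, j⟩) l ⟶ unorderedTensor X,
      ∀ (m : ∀ i, List (J i)) (hm : ∀ i, IsOrdering (m i)),
        listTensorMap (fun i => unorderedTensor.ι (fun j => X ⟨i, j⟩) (m i) (hm i)) l ≫ d =
          listTensorFlatten X m l ≫ unorderedTensor.ι X (l.sigma m) (hl.sigma hm) :=
  listTensor_unordered_exists_desc (fun i j => X ⟨i, j⟩) hl
    (fun m hm => listTensorFlatten X m l ≫ unorderedTensor.ι X (l.sigma m) (hl.sigma hm))
    fun m m' hm hm' φ hφ => by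
      rw [← Category.assoc]
      exact (listTensorFlatten_perm_fiber φ hφ l).comp_ι _ _

/-- The canonical map from a tensor product of unordered tensor products to a single unordered
tensor product. -/
noncomputable def unorderedFlatten {I : Type u} {J : I → Type u} (X : (Σ i, J i) → E) (l : List I)
    (hl : IsOrdering l) :
    listTensor (fun i => unorderedTensor fun j => X ⟨i, j⟩) l ⟶ unorderedTensor X :=
  (exists_unorderedFlatten X hl).choose

theorem ι_unorderedFlatten {I : Type u} {J : I → Type u} (X : (Σ i, J i) → E) (l : List I)
    (hl : IsOrdering l) (m : ∀ i, List (J i)) (hm : ∀ i, IsOrdering (m i)) :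
    listTensorMap (fun i => unorderedTensor.ι (fun j => X ⟨i, j⟩) (m i) (hm i)) l ≫
        unorderedFlatten X l hl =
      listTensorFlatten X m l ≫ unorderedTensor.ι X (l.sigma m) (hl.sigma hm) :=
  (exists_unorderedFlatten X hl).choose_spec m hm

theorem listTensorMap_comp_assoc {I : Type u} {X Y Z : I → E} (f : ∀ i, X i ⟶ Y i)
    (g : ∀ i, Y i ⟶ Z i) (l : List I) {A : E} (q : listTensor Z l ⟶ A) :
    listTensorMap (fun i => f i ≫ g i) l ≫ q = listTensorMap f l ≫ listTensorMap g l ≫ q := by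
  rw [listTensorMap_comp, Category.assoc]

variable (V : Corolla C ⥤ E) {I : Type u} (γ : I → CGraph C)

/-- Each factor is a colimit in two layers, over graphs in a slice category and over orderings of
their vertices; the two tests are applied in succession. -/
theorem listTensor_slice_hom_ext {l : List I} (hl : IsOrdering l) {Z : E}
    {f g : listTensor (fun i => colimit (sliceDiagram V (γ i))) l ⟶ Z}
    (h : ∀ (Y : I → CGraph C) (y : ∀ i, Y i ⟶ γ i) (m : ∀ i, List (Y i).Vert)
      (hm : ∀ i, IsOrdering (m i)),
      listTensorMap (fun i => unorderedTensor.ι (fun w => V.obj ((Y i).corolla w)) (m i) (hm i) ≫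
        sliceι V ⟨Y i⟩ (y i)) l ≫ f =
      listTensorMap (fun i => unorderedTensor.ι (fun w => V.obj ((Y i).corolla w)) (m i) (hm i) ≫
        sliceι V ⟨Y i⟩ (y i)) l ≫ g) : f = g := by
  refine listTensor_hom_ext (J := fun i => Slice (γ i))
    (fun i => colimit.cocone (sliceDiagram V (γ i))) (fun i => colimit.isColimit _) hl fun j => ?_
  refine listTensor_unordered_hom_ext (J := fun i => (j i).left.obj.Vert)
    (fun i w => V.obj ((j i).left.obj.corolla w)) hl fun m hm => ?_
  exact (listTensorMap_comp_assoc _ _ l f).symm.trans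
    ((h (fun i => (j i).left.obj) (fun i => (j i).hom) m hm).trans
      (listTensorMap_comp_assoc _ _ l g))

/-- Only the layer of graphs is treated; the layer of orderings has already been absorbed into
`extend`. -/
theorem listTensor_slice_exists_desc {l : List I} (hl : IsOrdering l) {Z : E}
    (k : ∀ (Y : I → CGraph C), (∀ i, Y i ⟶ γ i) →
      (listTensor (fun i => (extend V).obj ⟨Y i⟩) l ⟶ Z))
    (hk : ∀ (Y Y' : I → CGraph C) (h : ∀ i, (⟨Y i⟩ : BijGraph C) ⟶ ⟨Y' i⟩)
      (y' : ∀ i, Y' i ⟶ γ i),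
      listTensorMap (fun i => (extend V).map (h i)) l ≫ k Y' y' =
        k Y fun i => (h i).hom ≫ y' i) :
    ∃ d : listTensor (fun i => colimit (sliceDiagram V (γ i))) l ⟶ Z,
      ∀ Y y, listTensorMap (fun i => sliceι V ⟨Y i⟩ (y i)) l ≫ d = k Y y := by
  obtain ⟨d, hd⟩ := listTensor_exists_desc (J := fun i => Slice (γ i))
    (fun i => colimit.cocone (sliceDiagram V (γ i))) (fun i => colimit.isColimit _) hl
    (fun j => k (fun i => (j i).left.obj) fun i => (j i).hom) fun j j' f => by
      refine (hk _ _ (fun i => (f i).left) fun i => (j' i).hom).trans ?_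
      exact congrArg (k _) (funext fun i => CostructuredArrow.w (f i))
  exact ⟨d, fun Y y => hd fun i => (CostructuredArrow.mk (S := bijIncl C) (Y := (⟨Y i⟩ : BijGraph C)) (y i) : Slice (γ i))⟩

end Slice

/-! ### Equality of graph morphisms with dependent colors, and functoriality of grafting -/

section GraphMorphisms

variable {C : Type u} [SmallCategory C] [CategoryWithDuality C]

/-- The type of `q x` depends on the flag map. When two flag maps agree only propositionally,
heterogeneous equality avoids explicit transports on colors. -/
theorem CGraph.hom_ext_heq {Γ Γ' : CGraph C} {f g : Γ ⟶ Γ'} (hv : f.vert = g.vert)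
    (hf : f.flag = g.flag) (hq : ∀ x, HEq (f.q x) (g.q x)) : f = g :=
  CGraph.Hom.ext' hv hf fun x => eq_of_heq ((hq x).trans (eqToHom_comp_heq _ _).symm)

/-- The target has one vertex, so the vertex maps agree automatically. -/
theorem Corolla.hom_ext_heq {γ γ' : Corolla C} {f g : γ ⟶ γ'}
    (hf : ∀ x, f.hom.flag x = g.hom.flag x) (hq : ∀ x, HEq (f.hom.q x) (g.hom.q x)) : f = g :=
  ObjectProperty.hom_ext _ (CGraph.hom_ext_heq
    (funext fun _ => γ'.property.1.unique trivial trivial) (funext hf) hq)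

theorem CGraph.Hom.q_heq {Γ Γ' : CGraph C} (f : CGraph.Hom Γ Γ') {x y : Γ'.Flag} (h : x = y) :
    HEq (f.q x) (f.q y) := by
  subst h
  rfl

theorem comp_heq_comp {x y z x' y' z' : C} {f : x ⟶ y} {g : y ⟶ z} {f' : x' ⟶ y'} {g' : y' ⟶ z'}
    (hx : x = x') (hy : y = y') (hz : z = z') (hf : HEq f f') (hg : HEq g g') :
    HEq (f ≫ g) (f' ≫ g') := by
  subst hx hy hz hf hg
  rfl

theorem CGraph.pairing_heq (Γ : CGraph C) {x y x' y' : Γ.Flag} (hx : x = x') (hy : y = y')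
    (h : Γ.inv x = y) (hne : x ≠ y) (h' : Γ.inv x' = y') (hne' : x' ≠ y') :
    HEq (Γ.pairing x y h hne) (Γ.pairing x' y' h' hne') := by
  subst hx hy
  rfl

theorem comp_pairing_comp {x x' x'' y y' y'' : C} (a : x ⟶ x') (b : x' ⟶ x'') (p : x'' ⟶ dualObj y'')
    (a' : y ⟶ y') (b' : y' ⟶ y'') :
    (a ≫ b) ≫ p ≫ dualMap (a' ≫ b') = a ≫ (b ≫ p ≫ dualMap b') ≫ dualMap a' := by
  rw [dualMap_comp]
  simp only [Category.assoc]

/-- The bijections on flags and vertices preserve `n(v)`, and `2g(v) - 2 + n(v)` is preserved, hence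
so is `g(v)`. -/
theorem genus_vert {Γ Γ' : CGraph C} (f : Γ ⟶ Γ') (hf : nonContracting C f) (v : Γ.Vert) :
    Γ'.genus (f.vert v) = Γ.genus v := by
  have h := euler_vert f hf v
  have h' : Γ'.valence (f.vert v) = Γ.valence v :=
    valence_relabel (Equiv.ofBijective f.flag ⟨f.flag_injective, hf⟩)
      (Equiv.ofBijective f.vert (vert_bijective f hf)) f.vert_root v
  unfold CGraph.euler at h
  rw [h'] at h
  omega

/-- The morphism given by a relabelling of flags and vertices which is the identity on colors. -/
def CGraph.relabelHom {Γ Γ' : CGraph C} (e : Γ'.Flag ≃ Γ.Flag) (e' : Γ.Vert ≃ Γ'.Vert)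
    (hroot : ∀ x, e' (Γ.root (e x)) = Γ'.root x) (hinv : ∀ x, Γ.inv (e x) = e (Γ'.inv x))
    (hgenus : ∀ v, Γ'.genus (e' v) = Γ.genus v) (hcolor : ∀ x, Γ.color (e x) = Γ'.color x)
    (hpairing : ∀ x y (h : Γ'.inv x = y) (hne : x ≠ y),
      HEq (Γ.pairing (e x) (e y) ((hinv x).trans (congrArg e h)) (e.injective.ne hne))
        (Γ'.pairing x y h hne)) : Γ ⟶ Γ' :=
  CGraph.homOfEquiv e e' hroot hinv hgenus (fun x => eqToHom (hcolor x)) fun x y h hne => by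
    refine eq_of_heq ((hpairing x y h hne).trans ?_)
    refine HEq.trans ?_ (eqToHom_comp_heq _ _).symm
    have aux : ∀ {a b c : C} (p : a ⟶ dualObj b) (h : c = b), HEq p (p ≫ dualMap (eqToHom h)) := by
      intro a b c p h
      subst h
      rw [eqToHom_refl, dualMap_id, Category.comp_id]
    exact aux _ _

section Graft

variable (Γ : CGraph C)

/-- The flag map of `graftCorolla` comes from inverting a bijection and does not reduce. Comparisons
are therefore made after `graftEmb`, which is explicit, among the flags of the substituted graphs.
-/
theorem graftCorolla_flag (Y : Γ.Vert → CGraph C) (f : ∀ v, Y v ⟶ Γ.star v) (v : Γ.Vert)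
    (w : (Y v).Vert) (z : ((Γ.graft Y f).star ⟨v, w⟩).Flag) :
    graftEmb Γ Y f z.1 = ⟨v, ((graftCorolla Γ Y f v w).hom.flag z).1⟩ :=
  graftFlagEquiv_spec Γ Y f v w z

theorem graftCorolla_color (Y : Γ.Vert → CGraph C) (f : ∀ v, Y v ⟶ Γ.star v) (v : Γ.Vert)
    (w : (Y v).Vert) (z : ((Γ.graft Y f).star ⟨v, w⟩).Flag) :
    (Y v).color ((graftCorolla Γ Y f v w).hom.flag z).1 = (Γ.graft Y f).color z.1 :=
  (congrArg (fun p : Σ v, (Y v).Flag => (Y p.1).color p.2) (graftCorolla_flag Γ Y f v w z)).symm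

/-- On colors `graftCorolla` is a transport, which heterogeneous equality does not see. -/
theorem graftCorolla_comp_q_heq (Y : Γ.Vert → CGraph C) (f : ∀ v, Y v ⟶ Γ.star v) (v : Γ.Vert)
    (w : (Y v).Vert) {δ : Corolla C} (g : (Γ.graft Y f).corolla ⟨v, w⟩ ⟶ δ) (z : δ.obj.Flag) :
    HEq ((graftCorolla Γ Y f v w ≫ g).hom.q z) (g.hom.q z) :=
  eqToHom_comp_heq (g.hom.q z) (graftCorolla_color Γ Y f v w (g.hom.flag z))

theorem comp_graftCorolla_q_heq (Y : Γ.Vert → CGraph C) (f : ∀ v, Y v ⟶ Γ.star v) (v : Γ.Vert)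
    (w : (Y v).Vert) {δ : Corolla C} (g : δ ⟶ (Y v).corolla w)
    (z : ((Γ.graft Y f).star ⟨v, w⟩).Flag) :
    HEq ((g ≫ graftCorolla Γ Y f v w).hom.q z)
      (g.hom.q ((graftCorolla Γ Y f v w).hom.flag z)) :=
  comp_eqToHom_heq (g.hom.q ((graftCorolla Γ Y f v w).hom.flag z)) (graftCorolla_color Γ Y f v w z)

/-! ### Functoriality of the grafted graph in the graphs substituted for the vertices -/

section Map

variable {Y Y' : Γ.Vert → CGraph C} (h : ∀ v, Y v ⟶ Y' v) (hh : ∀ v, nonContracting C (h v))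
  (f' : ∀ v, Y' v ⟶ Γ.star v)

/-- The map on flags induced by morphisms of the graphs substituted for the vertices. -/
def graftMapFlag : GraftFlag Γ Y' → GraftFlag Γ Y
  | Sum.inl x => Sum.inl x
  | Sum.inr y => Sum.inr ⟨y.1, (h y.1).flag y.2.1, fun e =>
      y.2.2 ((h y.1).flag_injective (((h y.1).inv_flag y.2.1).symm.trans e))⟩

theorem graftEmb_graftMapFlag (z : GraftFlag Γ Y') :
    graftEmb Γ Y (fun v => h v ≫ f' v) (graftMapFlag Γ h z) =
      ⟨(graftEmb Γ Y' f' z).1, (h _).flag (graftEmb Γ Y' f' z).2⟩ := by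
  obtain x | y := z <;> rfl

theorem graftMapFlag_injective : Function.Injective (graftMapFlag Γ h) := by
  rintro (x | ⟨v, y, hy⟩) (x' | ⟨v', y', hy'⟩) e
  · exact congrArg Sum.inl (Sum.inl.inj e)
  · exact absurd e Sum.inl_ne_inr
  · exact absurd e Sum.inr_ne_inl
  · have e' := Sum.inr.inj e
    obtain rfl : v = v' := congrArg Sigma.fst e'
    obtain rfl := (h v).flag_injective (congrArg Subtype.val (eq_of_heq (Sigma.mk.inj e').2))
    rfl

include hh in
theorem graftMapFlag_surjective : Function.Surjective (graftMapFlag Γ h) := by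
  rintro (x | ⟨v, y, hy⟩)
  · exact ⟨Sum.inl x, rfl⟩
  · obtain ⟨y, rfl⟩ := hh v y
    exact ⟨Sum.inr ⟨v, y, fun e => hy (((h v).inv_flag y).trans (congrArg (h v).flag e))⟩, rfl⟩

/-- The components on colors of the morphism induced by morphisms of the graphs substituted for
the vertices. -/
def graftMapColor : ∀ z : GraftFlag Γ Y',
    (Γ.graft Y fun v => h v ≫ f' v).color (graftMapFlag Γ h z) ⟶ (Γ.graft Y' f').color z
  | Sum.inl x => (h (Γ.root x)).q ((f' (Γ.root x)).flag ⟨x, rfl⟩)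
  | Sum.inr y => (h y.1).q y.2.1

/-- The morphism of grafted graphs induced by non-contracting morphisms of the graphs substituted
for the vertices. -/
noncomputable def graftMap : Γ.graft Y (fun v => h v ≫ f' v) ⟶ Γ.graft Y' f' :=
  CGraph.homOfEquiv (Γ := Γ.graft Y fun v => h v ≫ f' v) (Γ' := Γ.graft Y' f')
    (Equiv.ofBijective (graftMapFlag Γ h)
      ⟨graftMapFlag_injective Γ h, graftMapFlag_surjective Γ h hh⟩)
    (Equiv.sigmaCongrRight fun v => Equiv.ofBijective (h v).vert (vert_bijective (h v) (hh v)))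
    (fun z => by
      obtain x | y := z
      · exact congrArg (Sigma.mk (Γ.root x)) ((h (Γ.root x)).vert_root _)
      · exact congrArg (Sigma.mk y.1) ((h y.1).vert_root _))
    (fun z => by
      obtain x | ⟨v, y, hy⟩ := z
      · rfl
      · exact congrArg Sum.inr (congrArg (Sigma.mk v) (Subtype.ext ((h v).inv_flag y))))
    (fun p => genus_vert (h p.1) (hh p.1) p.2)
    (graftMapColor Γ h f')
    (fun z z' e hne => by
      obtain x | ⟨v, y, hy⟩ := z <;> obtain x' | y' := z'
      · exact comp_pairing_comp _ _ _ _ _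
      · exact absurd e Sum.inl_ne_inr
      · exact absurd e Sum.inr_ne_inl
      -- For an edge of some `Y' v` the claim is compatibility of `h v` with pairings; the far end
      -- of the edge in `Y v` is `inv (flag y)` on one side and `flag (inv y)` on the other.
      · obtain rfl := Sum.inr.inj e
        refine (pairing_eqToHom (Y v) ((h v).inv_flag y) rfl _ ((h v).inv_flag y)
          ((h v).flag_injective.ne hy.symm) _).trans ?_
        · refine ((h v).pairing_comm y ((Y' v).inv y) rfl hy.symm).trans ?_
          exact congrArg (fun t => (h v).q y ≫ t ≫ dualMap ((h v).q ((Y' v).inv y)))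
            (Category.comp_id _).symm)

theorem graftMap_nonContracting : nonContracting C (graftMap Γ h hh f') :=
  graftMapFlag_surjective Γ h hh

theorem graftMap_graftHom : graftMap Γ h hh f' ≫ Γ.graftHom Y' f' =
    Γ.graftHom Y fun v => h v ≫ f' v :=
  CGraph.hom_ext_heq rfl rfl fun _ => HEq.rfl

/-- The morphism `graftMap` as a non-contracting morphism. -/
noncomputable def graftBijMap : (⟨Γ.graft Y fun v => h v ≫ f' v⟩ : BijGraph C) ⟶ ⟨Γ.graft Y' f'⟩ :=
  ⟨graftMap Γ h hh f', graftMap_nonContracting Γ h hh f'⟩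

/-- Naturality of the identification of corollas in the substituted graphs: it makes the factors
correspond when `Y` is replaced by `Y'`. -/
theorem graftCorolla_graftMap (v : Γ.Vert) (w : (Y v).Vert) :
    graftCorolla Γ Y (fun v => h v ≫ f' v) v w ≫ corollaMap (graftBijMap Γ h hh f') ⟨v, w⟩ =
      corollaMap (Γ := ⟨Y v⟩) (Γ' := ⟨Y' v⟩) ⟨h v, hh v⟩ w ≫
        graftCorolla Γ Y' f' v ((h v).vert w) := by
  -- Both composites are computed as flags in the disjoint union, where `graftMapFlag` is just `h`;
  -- equality of second components is extracted afterwards.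
  have key : ∀ z : ((Γ.graft Y' f').star ⟨v, (h v).vert w⟩).Flag,
      (⟨v, ((graftCorolla Γ Y (fun v => h v ≫ f' v) v w).hom.flag
        ((corollaMap (graftBijMap Γ h hh f') ⟨v, w⟩).hom.flag z)).1⟩ : Σ v, (Y v).Flag) =
      ⟨v, (h v).flag ((graftCorolla Γ Y' f' v ((h v).vert w)).hom.flag z).1⟩ := by
    intro z
    refine (graftCorolla_flag Γ Y _ v w _).symm.trans ((graftEmb_graftMapFlag Γ h f' z.1).trans ?_)
    rw [graftCorolla_flag Γ Y' f' v ((h v).vert w) z]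
  refine Corolla.hom_ext_heq (fun z => Subtype.ext (eq_of_heq (Sigma.mk.inj (key z)).2)) fun z => ?_
  refine (graftCorolla_comp_q_heq Γ Y _ v w _ z).trans
    (HEq.trans ?_ (comp_graftCorolla_q_heq Γ Y' f' v _ _ z).symm)
  have e : HEq (graftMapColor Γ h f' z.1)
      ((h (graftEmb Γ Y' f' z.1).1).q (graftEmb Γ Y' f' z.1).2) := by
    obtain ⟨x | y, hz⟩ := z <;> rfl
  refine HEq.trans e ?_
  exact congr_arg_heq (fun s : Σ v, (Y' v).Flag => (h s.1).q s.2)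
    (graftCorolla_flag Γ Y' f' v ((h v).vert w) z)

end Map

end Graft

end GraphMorphisms

section GraphIsomorphisms

variable {C : Type u} [SmallCategory C] [CategoryWithDuality C]

theorem eqToHom_heq_of_eq {x y x' y' : C} (h : x = y) (h' : x' = y') (hx : x = x') :
    HEq (eqToHom h) (eqToHom h') := by
  subst hx h h'
  rfl

theorem conj_heq {x x' y y' a b : C} {q : x ⟶ a} {q' : x' ⟶ a} {r : y ⟶ b} {r' : y' ⟶ b}
    (p : a ⟶ dualObj b) (hx : x = x') (hy : y = y') (hq : HEq q q') (hr : HEq r r') :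
    HEq (q ≫ p ≫ dualMap r) (q' ≫ p ≫ dualMap r') := by
  subst hx hy hq hr
  rfl

theorem graftCorolla_flag_mk (Γ : CGraph C) (Y : Γ.Vert → CGraph C) (f : ∀ v, Y v ⟶ Γ.star v)
    (z : GraftFlag Γ Y) :
    (graftCorolla Γ Y f (graftEmb Γ Y f z).1 ((Y _).root (graftEmb Γ Y f z).2)).hom.flag
      ⟨z, rfl⟩ = ⟨(graftEmb Γ Y f z).2, rfl⟩ :=
  Subtype.ext (eq_of_heq (Sigma.mk.inj (graftCorolla_flag Γ Y f _ _ ⟨z, rfl⟩)).2).symm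

/-! ### Grafting along a corolla -/

section UnitLeft

variable (γ : Corolla C) (v : γ.obj.Vert) {Y : CGraph C} (p : Y ⟶ γ.obj)

/-- The structure maps for the substitution of a graph over `γ` for the vertex of `γ`. -/
abbrev toStarFamily (v : γ.obj.Vert) : Y ⟶ γ.obj.star v := p ≫ (toStar γ v).hom

/-- The flags of a grafted graph form the disjoint union of the flags of the substituted graphs, and
here there is only one summand, since `γ` has one vertex. -/
theorem snd_graftEmb_bijective : Function.Bijective fun z : GraftFlag γ.obj (fun _ => Y) =>
    (graftEmb γ.obj (fun _ => Y) (toStarFamily γ p) z).2 := by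
  have h : Function.Bijective (Sigma.snd : (Σ _ : γ.obj.Vert, Y.Flag) → Y.Flag) :=
    ⟨fun s t e => by
      obtain ⟨v, y⟩ := s
      obtain ⟨v', y'⟩ := t
      obtain rfl : v = v' := γ.property.1.unique trivial trivial
      obtain rfl : y = y' := e
      rfl, fun y => ⟨⟨γ.property.1.exists.choose, y⟩, rfl⟩⟩
  exact h.comp ⟨graftEmb_injective _ _ _, graftEmb_surjective _ _ _⟩

/-- The isomorphism from a graph over `γ` to the graph obtained by substituting it for the vertex
of `γ`. -/
noncomputable def graftUnitLeft : Y ⟶ γ.obj.graft (fun _ => Y) (toStarFamily γ p) :=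
  CGraph.relabelHom (Γ' := γ.obj.graft (fun _ => Y) (toStarFamily γ p))
    (Equiv.ofBijective _ (snd_graftEmb_bijective γ p))
    ⟨fun w => ⟨v, w⟩, fun s => s.2, fun _ => rfl, fun s => by
      obtain ⟨v', w⟩ := s
      obtain rfl : v = v' := γ.property.1.unique trivial trivial
      rfl⟩
    (fun z => congrArg (fun a => (⟨a, Y.root (graftEmb γ.obj (fun _ => Y)
      (toStarFamily γ p) z).2⟩ : Σ _ : γ.obj.Vert, Y.Vert))
      (γ.property.1.unique trivial trivial))
    (fun z => by
      obtain x | y := z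
      · exact p.inv_flag x
      · rfl)
    (fun w => rfl) (fun z => rfl)
    (fun z z' e hne => by
      obtain x | y := z <;> obtain x' | y' := z'
      -- A corolla has no edges, so two distinct flags of `γ` are never paired.
      · exact absurd (congrArg Sum.inl ((γ.property.2 x).symm.trans (Sum.inl.inj e))) hne
      · exact absurd e Sum.inl_ne_inr
      · exact absurd e Sum.inr_ne_inl
      · obtain rfl := Sum.inr.inj e
        exact (comp_eqToHom_heq _ _).symm)

theorem graftUnitLeft_nonContracting : nonContracting C (graftUnitLeft γ v p) :=
  (snd_graftEmb_bijective γ p).2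

theorem graftUnitLeft_graftHom :
    graftUnitLeft γ v p ≫ γ.obj.graftHom (fun _ => Y) (toStarFamily γ p) = p :=
  CGraph.hom_ext_heq (funext fun _ => γ.property.1.unique trivial trivial) rfl fun x =>
    (eqToHom_comp_heq (p.q x ≫ 𝟙 (γ.obj.color x)) rfl).trans (comp_eqToHom_heq (p.q x) rfl)

/-- The morphism `graftUnitLeft` as a non-contracting morphism. -/
noncomputable def graftUnitLeftBij :
    (⟨Y⟩ : BijGraph C) ⟶ ⟨γ.obj.graft (fun _ => Y) (toStarFamily γ p)⟩ :=
  ⟨graftUnitLeft γ v p, graftUnitLeft_nonContracting γ v p⟩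

/-- Identifies the factorwise maps in `brace` with those by which the colimit relates `Y` to the
grafted graph. -/
theorem corollaMap_graftUnitLeft (w : Y.Vert) :
    corollaMap (graftUnitLeftBij γ v p) w =
      graftCorolla γ.obj (fun _ => Y) (toStarFamily γ p) v w := by
  have key : ∀ z : ((γ.obj.graft (fun _ => Y) (toStarFamily γ p)).star ⟨v, w⟩).Flag,
      (graftEmb γ.obj (fun _ => Y) (toStarFamily γ p) z.1).2 =
        ((graftCorolla γ.obj (fun _ => Y) (toStarFamily γ p) v w).hom.flag z).1 := fun z =>
    congrArg Sigma.snd (graftCorolla_flag γ.obj (fun _ => Y) (toStarFamily γ p) v w z)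
  refine Corolla.hom_ext_heq (fun z => Subtype.ext (key z)) fun z => ?_
  exact eqToHom_heq_of_eq rfl
    (graftCorolla_color γ.obj (fun _ => Y) (toStarFamily γ p) v w z) (congrArg Y.color (key z))

end UnitLeft

/-! ### Grafting corollas -/

section UnitRight

variable (Γ : CGraph C)

/-- Corollas contribute no edges, so the second summand of `GraftFlag` is empty and the flags of `Γ`
remain. -/
theorem snd_graftEmb_star_bijective : Function.Bijective fun z : GraftFlag Γ Γ.star =>
    (graftEmb Γ Γ.star (fun v => 𝟙 (Γ.star v)) z).2.1 := by
  constructor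
  · rintro (x | ⟨v, y, hy⟩) (x' | ⟨v', y', hy'⟩) h
    · exact congrArg Sum.inl h
    · exact absurd rfl hy'
    · exact absurd rfl hy
    · exact absurd rfl hy
  · exact fun x => ⟨Sum.inl x, rfl⟩

/-- The isomorphism from a graph to the graph obtained by substituting the corollas of its vertices
for its vertices. -/
noncomputable def graftUnitRight : Γ ⟶ Γ.graft Γ.star fun v => 𝟙 (Γ.star v) :=
  CGraph.relabelHom (Γ' := Γ.graft Γ.star fun v => 𝟙 (Γ.star v))
    (Equiv.ofBijective _ (snd_graftEmb_star_bijective Γ))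
    ⟨fun v => ⟨v, PUnit.unit⟩, fun s => s.1, fun _ => rfl, fun _ => rfl⟩
    (fun z => by
      obtain x | ⟨v, y, hy⟩ := z
      · rfl
      · exact absurd rfl hy)
    (fun z => by
      obtain x | ⟨v, y, hy⟩ := z
      · rfl
      · exact absurd rfl hy)
    (fun w => rfl) (fun z => rfl)
    (fun z z' e hne => by
      obtain x | ⟨v, y, hy⟩ := z
      · obtain x' | y' := z'
        · exact heq_of_eq (pairing_id_aux (Γ.pairing x x' _ _))
        · exact absurd e Sum.inl_ne_inr
      · exact absurd rfl hy)

theorem graftUnitRight_nonContracting : nonContracting C (graftUnitRight Γ) :=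
  (snd_graftEmb_star_bijective Γ).2

theorem graftUnitRight_graftHom :
    graftUnitRight Γ ≫ Γ.graftHom Γ.star (fun v => 𝟙 (Γ.star v)) = 𝟙 Γ :=
  CGraph.hom_ext_heq rfl rfl fun x => eqToHom_comp_heq (𝟙 (Γ.color x)) rfl

/-- The morphism `graftUnitRight` as a non-contracting morphism. -/
noncomputable def graftUnitRightBij :
    (⟨Γ⟩ : BijGraph C) ⟶ ⟨Γ.graft Γ.star fun v => 𝟙 (Γ.star v)⟩ :=
  ⟨graftUnitRight Γ, graftUnitRight_nonContracting Γ⟩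

/-- The factor `toStar` is precisely the one built into `unitApp`, so the unit followed by grafting
is the action of `graftUnitRight`. -/
theorem corollaMap_graftUnitRight (v : Γ.Vert) :
    corollaMap (graftUnitRightBij Γ) v =
      toStar (Γ.corolla v) PUnit.unit ≫
        graftCorolla Γ Γ.star (fun v => 𝟙 (Γ.star v)) v PUnit.unit := by
  have key : ∀ z : ((Γ.graft Γ.star fun v => 𝟙 (Γ.star v)).star ⟨v, PUnit.unit⟩).Flag,
      (graftEmb Γ Γ.star (fun v => 𝟙 (Γ.star v)) z.1).2.1 =
        ((graftCorolla Γ Γ.star (fun v => 𝟙 (Γ.star v)) v PUnit.unit).hom.flag z).1.1 := fun z =>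
    congrArg (fun s : Σ v, (Γ.star v).Flag => s.2.1)
      (graftCorolla_flag Γ Γ.star (fun v => 𝟙 (Γ.star v)) v PUnit.unit z)
  refine Corolla.hom_ext_heq (fun z => Subtype.ext (key z)) fun z => ?_
  refine HEq.trans ?_ (comp_graftCorolla_q_heq Γ Γ.star _ v PUnit.unit _ z).symm
  exact eqToHom_heq_of_eq rfl rfl (congrArg Γ.color (key z))

end UnitRight

/-! ### Change of the base graph -/

section Base

variable {Γ Γ' : CGraph C} (g : Γ ⟶ Γ') (hg : nonContracting C g) (Y' : Γ'.Vert → CGraph C)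
  (f : ∀ v, Y' (g.vert v) ⟶ Γ.star v) (f' : ∀ v, Y' v ⟶ Γ'.star v)
  (H : ∀ v, f v ≫ starMap g hg v = f' (g.vert v))

/-- The relabelling of flags for a non-contracting morphism of base graphs. -/
noncomputable def graftBaseFlag (g : Γ ⟶ Γ') (hg : nonContracting C g) (Y' : Γ'.Vert → CGraph C) :
    GraftFlag Γ (fun v => Y' (g.vert v)) ≃ GraftFlag Γ' Y' :=
  Equiv.sumCongr (Equiv.ofBijective g.flag ⟨g.flag_injective, hg⟩).symm
    (Equiv.sigmaCongrLeft (β := fun v => {y : (Y' v).Flag // (Y' v).inv y ≠ y})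
      (Equiv.ofBijective g.vert (vert_bijective g hg)))

/-- An inner flag of the target is presented at a vertex of the form `g.vert v`; this avoids
transport along the inverse of the vertex bijection in every case distinction below. -/
theorem exists_graftBaseFlag (z : GraftFlag Γ' Y') :
    (∃ x, z = Sum.inl x ∧ (graftBaseFlag g hg Y').symm z = Sum.inl (g.flag x)) ∨
    ∃ (v : Γ.Vert) (y : {y : (Y' (g.vert v)).Flag // (Y' (g.vert v)).inv y ≠ y}),
      z = Sum.inr ⟨g.vert v, y⟩ ∧ (graftBaseFlag g hg Y').symm z = Sum.inr ⟨v, y⟩ := by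
  obtain ⟨t, rfl⟩ := (graftBaseFlag g hg Y').surjective z
  rw [Equiv.symm_apply_apply]
  obtain x | ⟨v, y⟩ := t
  · obtain ⟨x, rfl⟩ := hg x
    exact Or.inl ⟨x, congrArg Sum.inl (Equiv.ofBijective_symm_apply_apply g.flag _ x), rfl⟩
  · exact Or.inr ⟨v, y, rfl, rfl⟩

theorem graftInv_graftBaseFlag (z : GraftFlag Γ' Y') :
    graftInv Γ (fun v => Y' (g.vert v)) ((graftBaseFlag g hg Y').symm z) =
      (graftBaseFlag g hg Y').symm (graftInv Γ' Y' z) := by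
  obtain ⟨x, rfl, h⟩ | ⟨v, y, rfl, h⟩ := exists_graftBaseFlag g hg Y' z
  · rw [h]
    exact congrArg Sum.inl (g.inv_flag x)
  · rw [h]
    exact (Equiv.eq_symm_apply _).2 rfl

include H in
theorem graftEmb_graftBaseFlag (z : GraftFlag Γ' Y') :
    graftEmb Γ' Y' f' z =
      ⟨g.vert (graftEmb Γ (fun v => Y' (g.vert v)) f ((graftBaseFlag g hg Y').symm z)).1,
        (graftEmb Γ (fun v => Y' (g.vert v)) f ((graftBaseFlag g hg Y').symm z)).2⟩ := by
  -- The root of `x` equals `g.vert (Γ.root (g.flag x))` only propositionally; with a variable in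
  -- its place the equality can be substituted.
  have aux : ∀ (x : Γ'.Flag) (v : Γ'.Vert) (hv : Γ'.root x = v),
      (⟨Γ'.root x, (f' (Γ'.root x)).flag ⟨x, rfl⟩⟩ : Σ v, (Y' v).Flag) =
        ⟨v, (f' v).flag ⟨x, hv⟩⟩ := by
    intro x v hv
    subst hv
    rfl
  obtain ⟨x, rfl, h⟩ | ⟨v, y, rfl, h⟩ := exists_graftBaseFlag g hg Y' z
  · rw [h]
    refine (aux x _ (g.vert_root x).symm).trans ?_
    exact congrArg (Sigma.mk (g.vert (Γ.root (g.flag x))))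
      (congrArg (fun k : Y' (g.vert (Γ.root (g.flag x))) ⟶ Γ'.star (g.vert (Γ.root (g.flag x))) =>
        k.flag ⟨x, (g.vert_root x).symm⟩)
        (H (Γ.root (g.flag x)))).symm
  · rw [h]
    rfl

include H in
-- The color component of `H` at the flag `x`, moved to the vertex `Γ'.root x`.
theorem graftBase_q_heq (x : Γ'.Flag) :
    HEq ((f (Γ.root (g.flag x))).q ⟨g.flag x, rfl⟩ ≫ g.q x) ((f' (Γ'.root x)).q ⟨x, rfl⟩) := by
  have aux : ∀ (v : Γ'.Vert) (hv : Γ'.root x = v),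
      HEq ((f' v).q ⟨x, hv⟩) ((f' (Γ'.root x)).q ⟨x, rfl⟩) := by
    intro v hv
    subst hv
    rfl
  refine HEq.trans ?_ (aux _ (g.vert_root x).symm)
  exact congr_arg_heq (fun k : Y' (g.vert (Γ.root (g.flag x))) ⟶
    Γ'.star (g.vert (Γ.root (g.flag x))) => k.q ⟨x, (g.vert_root x).symm⟩) (H (Γ.root (g.flag x)))

/-- The isomorphism of grafted graphs induced by a non-contracting morphism of base graphs. -/
noncomputable def graftBase : Γ.graft (fun v => Y' (g.vert v)) f ⟶ Γ'.graft Y' f' :=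
  CGraph.relabelHom (Γ := Γ.graft (fun v => Y' (g.vert v)) f) (Γ' := Γ'.graft Y' f')
    (graftBaseFlag g hg Y').symm
    (Equiv.sigmaCongrLeft (β := fun v => (Y' v).Vert)
      (Equiv.ofBijective g.vert (vert_bijective g hg)))
    (fun z => congrArg (fun s : Σ v, (Y' v).Flag => (⟨s.1, (Y' s.1).root s.2⟩ : Σ v, (Y' v).Vert))
      (graftEmb_graftBaseFlag g hg Y' f f' H z).symm)
    (graftInv_graftBaseFlag g hg Y')
    (fun p => rfl)
    (fun z => congrArg (fun s : Σ v, (Y' v).Flag => (Y' s.1).color s.2)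
      (graftEmb_graftBaseFlag g hg Y' f f' H z).symm)
    (fun z z' e hne => by
      have hc := fun t => congrArg (fun s : Σ v, (Y' v).Flag => (Y' s.1).color s.2)
        (graftEmb_graftBaseFlag g hg Y' f f' H t)
      obtain ⟨x, rfl, h⟩ | ⟨v, y, rfl, h⟩ := exists_graftBaseFlag g hg Y' z
      · obtain x' | y' := z'
        · have e' := Sum.inl.inj e
          have hne' : x ≠ x' := fun t => hne (congrArg Sum.inl t)
          refine HEq.trans (heq_of_eq ?_) (conj_heq (Γ'.pairing x x' e' hne')
            (hc (Sum.inl x)).symm (hc (Sum.inl x')).symm (graftBase_q_heq g hg Y' f f' H x)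
            (graftBase_q_heq g hg Y' f f' H x'))
          refine Eq.trans ?_ (comp_pairing_comp _ _ _ _ _).symm
          exact congrArg (fun t => (f (Γ.root (g.flag x))).q ⟨g.flag x, rfl⟩ ≫ t ≫
            dualMap ((f (Γ.root (g.flag x'))).q ⟨g.flag x', rfl⟩)) (g.pairing_comm x x' e' hne')
        · exact absurd e Sum.inl_ne_inr
      · obtain x' | y' := z'
        · exact absurd e Sum.inr_ne_inl
        · obtain rfl := Sum.inr.inj e
          have h' : (graftBaseFlag g hg Y').symm (Sum.inr (innerInv Γ' Y' ⟨g.vert v, y⟩)) =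
              Sum.inr (innerInv Γ (fun v => Y' (g.vert v)) ⟨v, y⟩) :=
            (Equiv.symm_apply_eq _).2 rfl
          refine (CGraph.pairing_heq (Γ.graft (fun v => Y' (g.vert v)) f) h h' _ _ rfl
            (fun t => y.2 (congrArg Subtype.val
              (eq_of_heq (Sigma.mk.inj (Sum.inr.inj t)).2)).symm)).trans ?_
          rfl)

theorem graftBase_nonContracting : nonContracting C (graftBase g hg Y' f f' H) :=
  (graftBaseFlag g hg Y').symm.surjective

theorem graftBase_graftHom : graftBase g hg Y' f f' H ≫ Γ'.graftHom Y' f' =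
    Γ.graftHom (fun v => Y' (g.vert v)) f ≫ g :=
  CGraph.hom_ext_heq rfl rfl fun x =>
    (eqToHom_comp_heq ((f' (Γ'.root x)).q ⟨x, rfl⟩)
      (congrArg (fun s : Σ v, (Y' v).Flag => (Y' s.1).color s.2)
        (graftEmb_graftBaseFlag g hg Y' f f' H (Sum.inl x)).symm)).trans
      (graftBase_q_heq g hg Y' f f' H x).symm

/-- The morphism `graftBase` as a non-contracting morphism. -/
noncomputable def graftBaseBij :
    (⟨Γ.graft (fun v => Y' (g.vert v)) f⟩ : BijGraph C) ⟶ ⟨Γ'.graft Y' f'⟩ :=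
  ⟨graftBase g hg Y' f f' H, graftBase_nonContracting g hg Y' f f' H⟩

/-- Changing the base leaves the substituted graphs alone, so the corolla of `w` is embedded in the
same way before and after. -/
theorem graftCorolla_graftBase (v : Γ.Vert) (w : (Y' (g.vert v)).Vert) :
    graftCorolla Γ (fun v => Y' (g.vert v)) f v w ≫
        corollaMap (graftBaseBij g hg Y' f f' H) ⟨v, w⟩ =
      graftCorolla Γ' Y' f' (g.vert v) w := by
  have key : ∀ z : ((Γ'.graft Y' f').star ⟨g.vert v, w⟩).Flag,
      ((graftCorolla Γ (fun v => Y' (g.vert v)) f v w).hom.flag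
        ((corollaMap (graftBaseBij g hg Y' f f' H) ⟨v, w⟩).hom.flag z)).1 =
      ((graftCorolla Γ' Y' f' (g.vert v) w).hom.flag z).1 := by
    intro z
    have h := graftCorolla_flag Γ (fun v => Y' (g.vert v)) f v w
      ((corollaMap (graftBaseBij g hg Y' f f' H) ⟨v, w⟩).hom.flag z)
    have h' := graftCorolla_flag Γ' Y' f' (g.vert v) w z
    have h'' := congrArg (fun s : Σ v, (Y' (g.vert v)).Flag => (⟨g.vert s.1, s.2⟩ : Σ v, (Y' v).Flag)) h
    exact eq_of_heq (Sigma.mk.inj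
      (h''.symm.trans ((graftEmb_graftBaseFlag g hg Y' f f' H z.1).symm.trans h'))).2
  refine Corolla.hom_ext_heq (fun z => Subtype.ext (key z)) fun z => ?_
  refine (graftCorolla_comp_q_heq Γ (fun v => Y' (g.vert v)) f v w _ z).trans ?_
  exact eqToHom_heq_of_eq (congrArg (fun s : Σ v, (Y' v).Flag => (Y' s.1).color s.2)
      (graftEmb_graftBaseFlag g hg Y' f f' H z.1).symm)
    (graftCorolla_color Γ' Y' f' (g.vert v) w z)
    ((graftCorolla_color Γ (fun v => Y' (g.vert v)) f v w
      ((corollaMap (graftBaseBij g hg Y' f f' H) ⟨v, w⟩).hom.flag z)).symm.trans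
      (congrArg (Y' (g.vert v)).color (key z)))

end Base

/-! ### Associativity of grafting -/

section Assoc

variable (Γ : CGraph C) (Y : Γ.Vert → CGraph C) (f : ∀ v, Y v ⟶ Γ.star v)
  (Z : (Σ v, (Y v).Vert) → CGraph C) (h : ∀ p, Z p ⟶ (Y p.1).star p.2)

/-- The structure maps for the substitution of graphs for the vertices of a grafted graph. -/
noncomputable abbrev graftGraftMap (p : Σ v, (Y v).Vert) : Z p ⟶ (Γ.graft Y f).star p :=
  h p ≫ (graftCorolla Γ Y f p.1 p.2).hom

/-- The graphs obtained by substituting the graphs `Z` for the vertices of the graphs `Y v`. -/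
abbrev innerGraft (v : Γ.Vert) : CGraph C :=
  (Y v).graft (fun w => Z ⟨v, w⟩) fun w => h ⟨v, w⟩

/-- The structure maps of the graphs `innerGraft`. -/
abbrev innerGraftMap (v : Γ.Vert) : innerGraft Γ Y Z h v ⟶ Γ.star v :=
  (Y v).graftHom (fun w => Z ⟨v, w⟩) (fun w => h ⟨v, w⟩) ≫ f v

/-- The relabelling of flags for an iterated substitution. -/
def graftAssocFlag : GraftFlag (Γ.graft Y f) Z ≃ GraftFlag Γ (innerGraft Γ Y Z h) where
  toFun z :=
    -- There are three kinds of flags: those of `Γ`, those on edges of the `Y v`, and those on edges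
    -- of the graphs `Z`. The two iterated substitutions nest these sets differently.
    match z with
    | Sum.inl (Sum.inl x) => Sum.inl x
    | Sum.inl (Sum.inr y) => Sum.inr ⟨y.1, Sum.inl y.2.1, fun e => y.2.2 (Sum.inl.inj e)⟩
    | Sum.inr z => Sum.inr ⟨z.1.1, Sum.inr ⟨z.1.2, z.2⟩, fun e =>
        z.2.2 (congrArg Subtype.val (eq_of_heq (Sigma.mk.inj (Sum.inr.inj e)).2))⟩
  invFun z :=
    match z with
    | Sum.inl x => Sum.inl (Sum.inl x)
    | Sum.inr ⟨v, Sum.inl y, hy⟩ => Sum.inl (Sum.inr ⟨v, y, fun e => hy (congrArg Sum.inl e)⟩)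
    | Sum.inr ⟨v, Sum.inr z, _⟩ => Sum.inr ⟨⟨v, z.1⟩, z.2⟩
  left_inv z := by
    obtain (x | y) | z := z <;> rfl
  right_inv z := by
    obtain x | ⟨v, y | z, hy⟩ := z <;> rfl

/-- The flag of one of the graphs `Z` which corresponds to a flag of one of the graphs
`innerGraft`. -/
def innerGraftEmb (s : Σ v, (innerGraft Γ Y Z h v).Flag) : Σ p, (Z p).Flag :=
  ⟨⟨s.1, (graftEmb (Y s.1) (fun w => Z ⟨s.1, w⟩) (fun w => h ⟨s.1, w⟩) s.2).1⟩,
    (graftEmb (Y s.1) (fun w => Z ⟨s.1, w⟩) (fun w => h ⟨s.1, w⟩) s.2).2⟩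

/-- The leg map of `graftGraftMap` passes through `graftCorolla`; at the root of the flag itself
that map is undone, leaving the structure map `h`. -/
theorem graftEmb_graftGraftMap_inl (x : GraftFlag Γ Y) :
    graftEmb (Γ.graft Y f) Z (graftGraftMap Γ Y f Z h) (Sum.inl x) =
      ⟨⟨(graftEmb Γ Y f x).1, (Y _).root (graftEmb Γ Y f x).2⟩,
        (h ⟨(graftEmb Γ Y f x).1, (Y _).root (graftEmb Γ Y f x).2⟩).flag
          ⟨(graftEmb Γ Y f x).2, rfl⟩⟩ :=
  congrArg (Sigma.mk _) (congrArg (h _).flag (graftCorolla_flag_mk Γ Y f x))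

theorem graftGraftMap_q_heq (x : GraftFlag Γ Y) :
    HEq ((graftGraftMap Γ Y f Z h ((Γ.graft Y f).root x)).q ⟨x, rfl⟩)
      ((h ((Γ.graft Y f).root x)).q ⟨(graftEmb Γ Y f x).2, rfl⟩) :=
  (comp_eqToHom_heq _ (graftCorolla_color Γ Y f (graftEmb Γ Y f x).1
    ((Y _).root (graftEmb Γ Y f x).2) ⟨x, rfl⟩)).trans
    (CGraph.Hom.q_heq (h _) (graftCorolla_flag_mk Γ Y f x))

/-- Under both substitutions a flag is represented by the same flag of the same graph `Z p`.
Agreement of roots and of colors follows by applying functions to this equation. -/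
theorem graftEmb_graftAssocFlag (z : GraftFlag (Γ.graft Y f) Z) :
    graftEmb (Γ.graft Y f) Z (graftGraftMap Γ Y f Z h) z =
      innerGraftEmb Γ Y Z h (graftEmb Γ (innerGraft Γ Y Z h) (innerGraftMap Γ Y f Z h)
        (graftAssocFlag Γ Y f Z h z)) := by
  obtain (x | y) | z := z
  · exact graftEmb_graftGraftMap_inl Γ Y f Z h (Sum.inl x)
  · exact graftEmb_graftGraftMap_inl Γ Y f Z h (Sum.inr y)
  · rfl

theorem graftAssoc_color (z : GraftFlag (Γ.graft Y f) Z) :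
    (Γ.graft (innerGraft Γ Y Z h) (innerGraftMap Γ Y f Z h)).color (graftAssocFlag Γ Y f Z h z) =
      ((Γ.graft Y f).graft Z (graftGraftMap Γ Y f Z h)).color z :=
  congrArg (fun s : Σ p, (Z p).Flag => (Z s.1).color s.2)
    (graftEmb_graftAssocFlag Γ Y f Z h z).symm

theorem graftInv_graftAssocFlag (z : GraftFlag (Γ.graft Y f) Z) :
    graftInv Γ (innerGraft Γ Y Z h) (graftAssocFlag Γ Y f Z h z) =
      graftAssocFlag Γ Y f Z h (graftInv (Γ.graft Y f) Z z) := by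
  obtain (x | y) | z := z <;> rfl

/-- The isomorphism between the two graphs obtained by an iterated substitution. -/
noncomputable def graftAssoc : Γ.graft (innerGraft Γ Y Z h) (innerGraftMap Γ Y f Z h) ⟶
    (Γ.graft Y f).graft Z (graftGraftMap Γ Y f Z h) :=
  CGraph.relabelHom (Γ := Γ.graft (innerGraft Γ Y Z h) (innerGraftMap Γ Y f Z h))
    (Γ' := (Γ.graft Y f).graft Z (graftGraftMap Γ Y f Z h))
    (graftAssocFlag Γ Y f Z h) (Equiv.sigmaAssoc fun v w => (Z ⟨v, w⟩).Vert).symm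
    (fun z => congrArg (fun s : Σ p, (Z p).Flag => (⟨s.1, (Z s.1).root s.2⟩ : Σ p, (Z p).Vert))
      (graftEmb_graftAssocFlag Γ Y f Z h z).symm)
    (graftInv_graftAssocFlag Γ Y f Z h) (fun _ => rfl) (graftAssoc_color Γ Y f Z h)
    (fun z z' e hne => by
      obtain z | z := z <;> obtain z' | z' := z'
      · have hq := fun t => (graftGraftMap_q_heq Γ Y f Z h t).symm
        have hc := fun t => graftAssoc_color Γ Y f Z h (Sum.inl t)
        obtain x | y := z <;> obtain x' | y' := z'
        · refine (heq_of_eq (comp_pairing_comp _ _ _ _ _)).trans ?_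
          exact conj_heq _ (hc (Sum.inl x)) (hc (Sum.inl x')) (hq (Sum.inl x)) (hq (Sum.inl x'))
        · exact absurd (Sum.inl.inj e) Sum.inl_ne_inr
        · exact absurd (Sum.inl.inj e) Sum.inr_ne_inl
        · obtain rfl := Sum.inr.inj (Sum.inl.inj e)
          refine (comp_eqToHom_heq _ _).trans ?_
          refine HEq.trans ?_ (conj_heq _ (hc (Sum.inr y)) (hc (Sum.inr (innerInv Γ Y y)))
            (hq (Sum.inr y)) (hq (Sum.inr (innerInv Γ Y y))))
          refine heq_of_eq ?_
          obtain ⟨v, y, hy⟩ := y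
          -- On an edge of `Y v` the pairing of the grafted graph is that of `Y v` followed by a
          -- cast, here an identity.
          exact congrArg (fun t : (Y v).color y ⟶ dualObj ((Y v).color ((Y v).inv y)) =>
            (h ⟨v, (Y v).root y⟩).q ⟨y, rfl⟩ ≫ t ≫
              dualMap ((h ⟨v, (Y v).root ((Y v).inv y)⟩).q ⟨(Y v).inv y, rfl⟩))
            (Category.comp_id _).symm
      · exact absurd e Sum.inl_ne_inr
      · exact absurd e Sum.inr_ne_inl
      · obtain rfl := Sum.inr.inj e
        exact comp_eqToHom_heq _ _)

theorem graftAssoc_nonContracting : nonContracting C (graftAssoc Γ Y f Z h) :=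
  (graftAssocFlag Γ Y f Z h).surjective

theorem graftAssoc_graftHom :
    graftAssoc Γ Y f Z h ≫ (Γ.graft Y f).graftHom Z (graftGraftMap Γ Y f Z h) ≫ Γ.graftHom Y f =
      Γ.graftHom (innerGraft Γ Y Z h) (innerGraftMap Γ Y f Z h) :=
  CGraph.hom_ext_heq rfl rfl fun x =>
    (eqToHom_comp_heq ((graftGraftMap Γ Y f Z h ((Γ.graft Y f).root (Sum.inl x))).q
      ⟨Sum.inl x, rfl⟩ ≫ (f (Γ.root x)).q ⟨x, rfl⟩)
      (graftAssoc_color Γ Y f Z h (Sum.inl (Sum.inl x)))).trans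
    (comp_heq_comp (graftAssoc_color Γ Y f Z h (Sum.inl (Sum.inl x))).symm rfl rfl
      (graftGraftMap_q_heq Γ Y f Z h (Sum.inl x)) HEq.rfl)

/-- The morphism `graftAssoc` as a non-contracting morphism. -/
noncomputable def graftAssocBij :
    (⟨Γ.graft (innerGraft Γ Y Z h) (innerGraftMap Γ Y f Z h)⟩ : BijGraph C) ⟶
      ⟨(Γ.graft Y f).graft Z (graftGraftMap Γ Y f Z h)⟩ :=
  ⟨graftAssoc Γ Y f Z h, graftAssoc_nonContracting Γ Y f Z h⟩

/-- Shows that the values of `V` are identified in the same way along the two iterated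
substitutions; this is the condition `comm` of `listTensorFlatMap_assoc`. -/
theorem graftCorolla_graftAssoc (v : Γ.Vert) (w : (Y v).Vert) (t : (Z ⟨v, w⟩).Vert) :
    graftCorolla (Y v) (fun w => Z ⟨v, w⟩) (fun w => h ⟨v, w⟩) w t ≫
        graftCorolla Γ (innerGraft Γ Y Z h) (innerGraftMap Γ Y f Z h) v ⟨w, t⟩ ≫
        corollaMap (graftAssocBij Γ Y f Z h) ⟨v, ⟨w, t⟩⟩ =
      graftCorolla (Γ.graft Y f) Z (graftGraftMap Γ Y f Z h) ⟨v, w⟩ t := by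
  have key : ∀ z : (((Γ.graft Y f).graft Z (graftGraftMap Γ Y f Z h)).star ⟨⟨v, w⟩, t⟩).Flag,
      ((graftCorolla (Y v) (fun w => Z ⟨v, w⟩) (fun w => h ⟨v, w⟩) w t).hom.flag
        ((graftCorolla Γ (innerGraft Γ Y Z h) (innerGraftMap Γ Y f Z h) v ⟨w, t⟩).hom.flag
          ((corollaMap (graftAssocBij Γ Y f Z h) ⟨v, ⟨w, t⟩⟩).hom.flag z))).1 =
      ((graftCorolla (Γ.graft Y f) Z (graftGraftMap Γ Y f Z h) ⟨v, w⟩ t).hom.flag z).1 := by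
    intro z
    have h₁ := graftCorolla_flag Γ (innerGraft Γ Y Z h) (innerGraftMap Γ Y f Z h) v ⟨w, t⟩
      ((corollaMap (graftAssocBij Γ Y f Z h) ⟨v, ⟨w, t⟩⟩).hom.flag z)
    have h₂ := graftCorolla_flag (Y v) (fun w => Z ⟨v, w⟩) (fun w => h ⟨v, w⟩) w t
      ((graftCorolla Γ (innerGraft Γ Y Z h) (innerGraftMap Γ Y f Z h) v ⟨w, t⟩).hom.flag
        ((corollaMap (graftAssocBij Γ Y f Z h) ⟨v, ⟨w, t⟩⟩).hom.flag z))
    have h₃ := graftCorolla_flag (Γ.graft Y f) Z (graftGraftMap Γ Y f Z h) ⟨v, w⟩ t z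
    have h₄ := congrArg (fun s : Σ w, (Z ⟨v, w⟩).Flag => (⟨⟨v, s.1⟩, s.2⟩ : Σ p, (Z p).Flag)) h₂
    exact eq_of_heq (Sigma.mk.inj (h₄.symm.trans ((congrArg (innerGraftEmb Γ Y Z h) h₁).symm.trans
      ((graftEmb_graftAssocFlag Γ Y f Z h z.1).symm.trans h₃)))).2
  refine Corolla.hom_ext_heq (fun z => Subtype.ext (key z)) fun z => ?_
  refine (graftCorolla_comp_q_heq (Y v) (fun w => Z ⟨v, w⟩) (fun w => h ⟨v, w⟩) w t _ z).trans ?_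
  refine (graftCorolla_comp_q_heq Γ (innerGraft Γ Y Z h) (innerGraftMap Γ Y f Z h) v ⟨w, t⟩ _
    z).trans ?_
  refine eqToHom_heq_of_eq (graftAssoc_color Γ Y f Z h z.1)
    (graftCorolla_color (Γ.graft Y f) Z (graftGraftMap Γ Y f Z h) ⟨v, w⟩ t z) ?_
  exact (graftAssoc_color Γ Y f Z h z.1).trans
    (graftCorolla_color (Γ.graft Y f) Z (graftGraftMap Γ Y f Z h) ⟨v, w⟩ t z).symm

end Assoc

end GraphIsomorphisms

section FlatMap

variable {E : Type w} [Category.{v} E] [MonoidalCategory E] [SymmetricCategory E]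
  {I : Type u} {J : I → Type u}

/-! ### Removing parentheses after applying a map to every factor -/

/-- The map from an iterated tensor product to a single one given by a morphism in every factor. -/
def listTensorFlatMap {X : ∀ i, J i → E} {Z : (Σ i, J i) → E} (g : ∀ i j, X i j ⟶ Z ⟨i, j⟩)
    (m : ∀ i, List (J i)) (l : List I) :
    listTensor (fun i => listTensor (X i) (m i)) l ⟶ listTensor Z (l.sigma m) :=
  listTensorMap (fun i => listTensorMap (g i) (m i)) l ≫ listTensorFlatten Z m l

theorem listTensorFlatMap_comp {X : ∀ i, J i → E} {Z Z' : (Σ i, J i) → E}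
    (g : ∀ i j, X i j ⟶ Z ⟨i, j⟩) (c : ∀ p, Z p ⟶ Z' p) (m : ∀ i, List (J i)) (l : List I) :
    listTensorFlatMap g m l ≫ listTensorMap c (l.sigma m) =
      listTensorFlatMap (fun i j => g i j ≫ c ⟨i, j⟩) m l := by
  rw [listTensorFlatMap, listTensorFlatMap, Category.assoc, ← listTensorFlatten_naturality,
    ← Category.assoc, ← listTensorMap_comp]
  simp only [listTensorMap_comp]

theorem comp_listTensorFlatMap {W X : ∀ i, J i → E} {Z : (Σ i, J i) → E}
    (h : ∀ i j, W i j ⟶ X i j) (g : ∀ i j, X i j ⟶ Z ⟨i, j⟩) (m : ∀ i, List (J i)) (l : List I) :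
    listTensorMap (fun i => listTensorMap (h i) (m i)) l ≫ listTensorFlatMap g m l =
      listTensorFlatMap (fun i j => h i j ≫ g i j) m l := by
  rw [listTensorFlatMap, listTensorFlatMap, ← Category.assoc, ← listTensorMap_comp]
  simp only [listTensorMap_comp]

theorem listTensorFlatMap_swap {X : ∀ i, J i → E} {Z : (Σ i, J i) → E}
    (g : ∀ i j, X i j ⟶ Z ⟨i, j⟩) (m : ∀ i, List (J i)) (a b : I) (l₂ l₁ : List I) :
    PermEq (listTensorSwap (fun i => listTensor (X i) (m i)) a b l₂ l₁ ≫
        listTensorFlatMap g m (l₁ ++ b :: a :: l₂))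
      (listTensorFlatMap g m (l₁ ++ a :: b :: l₂)) := by
  rw [listTensorFlatMap, ← Category.assoc, ← listTensorMap_swap, Category.assoc]
  exact (listTensorFlatten_perm m (IsPerm.listTensorSwap a b l₂ l₁)).comp_left _

/-- The square `comm` in each factor is the only input from the graphs; the rest is compatibility of
flattening with inner relabelling. `listTensorFlatMap_base` is the analogue for outer relabelling.
-/
theorem listTensorFlatMap_fiber {J' : I → Type u} (σ : ∀ i, J i → J' i) {X : ∀ i, J i → E}
    {X' : ∀ i, J' i → E} {Z : (Σ i, J i) → E} {Z' : (Σ i, J' i) → E}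
    (g : ∀ i j, X i j ⟶ Z ⟨i, j⟩) (g' : ∀ i j, X' i j ⟶ Z' ⟨i, j⟩)
    (h : ∀ i j, X i j ⟶ X' i (σ i j)) (c : ∀ p : Σ i, J i, Z p ⟶ Z' ⟨p.1, σ p.1 p.2⟩)
    (comm : ∀ i j, g i j ≫ c ⟨i, j⟩ = h i j ≫ g' i (σ i j)) (m : ∀ i, List (J i)) (l : List I) :
    PermEq (listTensorFlatMap g m l ≫ listTensorMap c (l.sigma m) ≫
        listTensorReindex (fun p : Σ i, J i => (⟨p.1, σ p.1 p.2⟩ : Σ i, J' i)) Z' (l.sigma m))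
      (listTensorMap (fun i => listTensorMap (h i) (m i) ≫ listTensorReindex (σ i) (X' i) (m i)) l ≫
        listTensorFlatMap g' (fun i => (m i).map (σ i)) l) := by
  rw [← Category.assoc, listTensorFlatMap_comp g c]
  simp only [comm]
  rw [← comp_listTensorFlatMap h (Z := fun p => Z' ⟨p.1, σ p.1 p.2⟩) (fun i j => g' i (σ i j)),
    listTensorMap_comp]
  simp only [listTensorFlatMap, Category.assoc]
  refine PermEq.comp_left _ (PermEq.symm ?_)
  have e : listTensorMap (fun i => listTensorReindex (σ i) (X' i) (m i)) l ≫
      listTensorMap (fun i => listTensorMap (g' i) ((m i).map (σ i))) l =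
      listTensorMap (fun i => listTensorMap (fun j => g' i (σ i j)) (m i)) l ≫
        listTensorMap (fun i => listTensorReindex (σ i) (fun j => Z' ⟨i, j⟩) (m i)) l := by
    rw [← listTensorMap_comp, ← listTensorMap_comp]
    simp only [listTensorMap_reindex]
  rw [reassoc_of% e]
  exact (listTensorFlatten_reindex_fiber σ Z' m l).comp_left _

theorem listTensorFlatMap_base {I' : Type u} {J' : I' → Type u} (σ : I → I')
    {X' : ∀ i, J' i → E} {Z : (Σ i, J' (σ i)) → E} {Z' : (Σ i, J' i) → E}
    (g : ∀ i j, X' (σ i) j ⟶ Z ⟨i, j⟩) (g' : ∀ i j, X' i j ⟶ Z' ⟨i, j⟩)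
    (c : ∀ p : Σ i, J' (σ i), Z p ⟶ Z' ⟨σ p.1, p.2⟩)
    (comm : ∀ i j, g i j ≫ c ⟨i, j⟩ = g' (σ i) j) (m : ∀ i, List (J' i)) (l : List I) :
    PermEq (listTensorFlatMap g (fun i => m (σ i)) l ≫
        listTensorMap c (l.sigma fun i => m (σ i)) ≫
        listTensorReindex (fun p : Σ i, J' (σ i) => (⟨σ p.1, p.2⟩ : Σ i, J' i)) Z'
          (l.sigma fun i => m (σ i)))
      (listTensorReindex σ (fun i => listTensor (X' i) (m i)) l ≫
        listTensorFlatMap g' m (l.map σ)) := by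
  rw [← Category.assoc, listTensorFlatMap_comp g c]
  simp only [comm]
  rw [listTensorFlatMap, listTensorFlatMap, ← Category.assoc (listTensorReindex σ _ l),
    listTensorMap_reindex σ (fun i => listTensorMap (g' i) (m i)), Category.assoc, Category.assoc]
  exact (listTensorFlatten_reindex σ Z' m l).symm.comp_left _

/-- Naturality gathers all factorwise maps on one side, where `comm` merges them into `g₃`; what is
left is `listTensorFlatten_assoc`. -/
theorem listTensorFlatMap_assoc {K : (Σ i, J i) → Type u} {X : ∀ p, K p → E}
    {A : ∀ i, (Σ j, K ⟨i, j⟩) → E} {B : (Σ i, Σ j, K ⟨i, j⟩) → E} {Z : (Σ p, K p) → E}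
    (g₁ : ∀ i j (k : K ⟨i, j⟩), X ⟨i, j⟩ k ⟶ A i ⟨j, k⟩) (g₂ : ∀ i q, A i q ⟶ B ⟨i, q⟩)
    (c : ∀ r : Σ i, Σ j, K ⟨i, j⟩, B r ⟶ Z ⟨⟨r.1, r.2.1⟩, r.2.2⟩)
    (g₃ : ∀ p k, X p k ⟶ Z ⟨p, k⟩)
    (comm : ∀ i j k, g₁ i j k ≫ g₂ i ⟨j, k⟩ ≫ c ⟨i, ⟨j, k⟩⟩ = g₃ ⟨i, j⟩ k)
    (m : ∀ i, List (J i)) (n : ∀ p, List (K p)) (l : List I) :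
    PermEq (listTensorFlatten (fun p => listTensor (X p) (n p)) m l ≫
        listTensorFlatMap g₃ n (l.sigma m))
      (listTensorMap (fun i => listTensorFlatMap (g₁ i) (fun j => n ⟨i, j⟩) (m i)) l ≫
        listTensorFlatMap g₂ (fun i => (m i).sigma fun j => n ⟨i, j⟩) l ≫
        listTensorMap c (l.sigma fun i => (m i).sigma fun j => n ⟨i, j⟩) ≫
        listTensorReindex (fun r : Σ i, Σ j, K ⟨i, j⟩ => (⟨⟨r.1, r.2.1⟩, r.2.2⟩ : Σ p, K p)) Z
          (l.sigma fun i => (m i).sigma fun j => n ⟨i, j⟩)) := by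
  have e₁ : listTensorFlatMap g₂ (fun i => (m i).sigma fun j => n ⟨i, j⟩) l ≫
      listTensorMap c (l.sigma fun i => (m i).sigma fun j => n ⟨i, j⟩) =
      listTensorFlatMap (fun i q => g₂ i q ≫ c ⟨i, q⟩)
        (fun i => (m i).sigma fun j => n ⟨i, j⟩) l :=
    listTensorFlatMap_comp g₂ c _ l
  have e₂ : listTensorMap (fun i => listTensorFlatMap (g₁ i) (fun j => n ⟨i, j⟩) (m i)) l ≫
      listTensorMap (fun i => listTensorMap (fun q => g₂ i q ≫ c ⟨i, q⟩)
        ((m i).sigma fun j => n ⟨i, j⟩)) l =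
      listTensorMap (fun i => listTensorMap (fun j => listTensorMap (g₃ ⟨i, j⟩) (n ⟨i, j⟩)) (m i)) l ≫
      listTensorMap (fun i => listTensorFlatten (fun q : Σ j, K ⟨i, j⟩ => Z ⟨⟨i, q.1⟩, q.2⟩)
        (fun j => n ⟨i, j⟩) (m i)) l := by
    rw [← listTensorMap_comp, ← listTensorMap_comp]
    refine congrArg (fun t => listTensorMap t l) (funext fun i => ?_)
    refine (listTensorFlatMap_comp (g₁ i) (fun q => g₂ i q ≫ c ⟨i, q⟩) _ _).trans ?_
    simp only [comm]
    rfl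
  rw [reassoc_of% e₁, listTensorFlatMap, listTensorFlatMap, Category.assoc, reassoc_of% e₂,
    ← Category.assoc, ← listTensorFlatten_naturality, Category.assoc]
  exact (listTensorFlatten_assoc Z m n l).comp_left _

theorem listTensorFlatMap_singleton {X : ∀ i, J i → E} {Z : (Σ i, J i) → E}
    (g : ∀ i j, X i j ⟶ Z ⟨i, j⟩) (m : ∀ i, List (J i)) (i : I) :
    PermEq ((ρ_ (listTensor (X i) (m i))).inv ≫ listTensorFlatMap g m [i])
      (listTensorMap (g i) (m i) ≫ listTensorReindex (Sigma.mk i) Z (m i)) := by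
  refine (((listTensorFlatten_singleton m i).comp_left
    (listTensorMap (fun i => listTensorMap (g i) (m i)) [i])).comp_left _).trans (.of_eq ?_)
  change (ρ_ _).inv ≫ (listTensorMap (g i) (m i) ⊗ₘ 𝟙 (𝟙_ E)) ≫ (ρ_ _).hom ≫ _ = _
  rw [tensorHom_id, rightUnitor_naturality_assoc, Iso.inv_hom_id_assoc]

theorem listTensorFlatMap_section {X : ∀ i, J i → E} {Z : (Σ i, J i) → E} (s : ∀ i, J i)
    {W : I → E} (g : ∀ i j, X i j ⟶ Z ⟨i, j⟩) (a : ∀ i, W i ⟶ X i (s i))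
    (b : ∀ i, W i ⟶ Z ⟨i, s i⟩) (comm : ∀ i, a i ≫ g i (s i) = b i) (l : List I) :
    PermEq (listTensorMap (fun i => a i ≫ (ρ_ (X i (s i))).inv) l ≫
        listTensorFlatMap g (fun i => [s i]) l)
      (listTensorMap b l ≫ listTensorReindex (fun i => (⟨i, s i⟩ : Σ i, J i)) Z l) := by
  have e : listTensorMap (fun i => listTensorMap (g i) [s i]) l ≫
      listTensorMap (fun i => (ρ_ (Z ⟨i, s i⟩)).hom) l =
      listTensorMap (fun i => (ρ_ (X i (s i))).hom) l ≫ listTensorMap (fun i => g i (s i)) l := by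
    refine (listTensorMap_comp _ _ l).symm.trans (Eq.trans ?_ (listTensorMap_comp _ _ l))
    refine congrArg (fun t => listTensorMap t l) (funext fun i => ?_)
    exact (congrArg (· ≫ _) (tensorHom_id _ _)).trans (rightUnitor_naturality _)
  have e' : listTensorMap (fun i => a i ≫ (ρ_ (X i (s i))).inv) l ≫
      listTensorMap (fun i => (ρ_ (X i (s i))).hom) l ≫ listTensorMap (fun i => g i (s i)) l =
      listTensorMap b l := by
    rw [← listTensorMap_comp, ← listTensorMap_comp]
    refine congrArg (fun t => listTensorMap t l) (funext fun i => ?_)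
    rw [Category.assoc, Iso.inv_hom_id_assoc, comm]
  refine ((listTensorFlatten_section s l).comp_left
    (listTensorMap (fun i => listTensorMap (g i) [s i]) l)).comp_left _ |>.trans (.of_eq ?_)
  refine (congrArg _ ((Category.assoc _ _ _).symm.trans (congrArg (· ≫ _) e))).trans ?_
  refine (Category.assoc _ _ _).symm.trans (congrArg (· ≫ _) ?_)
  exact e'

end FlatMap

section Braces

variable {C : Type u} [SmallCategory C] [CategoryWithDuality C]
  {E : Type w} [Category.{v} E] [MonoidalCategory E] [SymmetricCategory E]
  [HasColimitsOfSize.{u, u} E] [∀ X : E, PreservesColimitsOfSize.{u, u} (tensorLeft X)]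

/-! ### The generators of the colimits -/

/-- The canonical map from the ordered tensor product over the vertices of a graph over `δ` to the
colimit. -/
noncomputable def sliceGen (V : Corolla C ⥤ E) {δ : CGraph C} (G : CGraph C) (p : G ⟶ δ)
    (l : List G.Vert) (hl : IsOrdering l) :
    listTensor (fun w => V.obj (G.corolla w)) l ⟶ colimit (sliceDiagram V δ) :=
  unorderedTensor.ι (fun w => V.obj (G.corolla w)) l hl ≫ sliceι V ⟨G⟩ p

section Gen

variable (V : Corolla C ⥤ E) {δ : CGraph C}

theorem slice_gen_hom_ext {Z : E} {f g : colimit (sliceDiagram V δ) ⟶ Z}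
    (h : ∀ (G : CGraph C) (p : G ⟶ δ) (l : List G.Vert) (hl : IsOrdering l),
      sliceGen V G p l hl ≫ f = sliceGen V G p l hl ≫ g) : f = g :=
  slice_hom_ext fun Γ p => unorderedTensor.hom_ext fun l hl =>
    (Category.assoc _ _ _).symm.trans ((h Γ.obj p l hl).trans (Category.assoc _ _ _))

/-- The cocone condition on generators: a non-contracting morphism over `δ` identifies the generator
of its source with one of its target. Every comparison of grafted graphs enters the colimit here. -/
theorem sliceGen_map {G G' : CGraph C} (k : (⟨G⟩ : BijGraph C) ⟶ ⟨G'⟩) (p' : G' ⟶ δ)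
    (l : List G.Vert) (hl : IsOrdering l) :
    sliceGen V G (k.hom ≫ p') l hl =
      listTensorMap (fun w => V.map (corollaMap k w)) l ≫
        listTensorReindex k.hom.vert (fun w => V.obj (G'.corolla w)) l ≫
          sliceGen V G' p' (l.map k.hom.vert) (hl.map (vert_bijective k.hom k.property)) := by
  refine (congrArg (unorderedTensor.ι (fun w => V.obj (G.corolla w)) l hl ≫ ·)
    (sliceι_naturality V k p').symm).trans ((Category.assoc _ _ _).symm.trans ?_)
  refine (congrArg (· ≫ sliceι V ⟨G'⟩ p') (unorderedTensor.ι_map (X := fun w => V.obj (G.corolla w))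
    (Y := fun w => V.obj (G'.corolla w)) k.hom.vert
    (vert_bijective k.hom k.property) (fun w => V.map (corollaMap k w)) l hl)).trans ?_
  exact (Category.assoc _ _ _).trans (congrArg _ (Category.assoc _ _ _))

theorem sliceGen_sliceMap {δ' : CGraph C} (φ : δ ⟶ δ') (G : CGraph C) (p : G ⟶ δ)
    (l : List G.Vert) (hl : IsOrdering l) :
    sliceGen V G p l hl ≫ sliceMap V φ = sliceGen V G (p ≫ φ) l hl :=
  (Category.assoc _ _ _).trans (congrArg _ (sliceι_map V φ ⟨G⟩ p))

theorem sliceGen_sliceTrans {W : Corolla C ⥤ E} (α : V ⟶ W) (G : CGraph C) (p : G ⟶ δ)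
    (l : List G.Vert) (hl : IsOrdering l) :
    sliceGen V G p l hl ≫ sliceTrans α δ =
      listTensorMap (fun w => α.app (G.corolla w)) l ≫ sliceGen W G p l hl := by
  refine (Category.assoc _ _ _).trans ((congrArg _ (sliceι_trans α ⟨G⟩ p)).trans ?_)
  refine (Category.assoc _ _ _).symm.trans ((congrArg (· ≫ sliceι W ⟨G⟩ p)
    (unorderedTensor_ι_map_id (X := fun w => V.obj (G.corolla w))
      (X' := fun w => W.obj (G.corolla w)) (fun w => α.app (G.corolla w)) l hl)).trans ?_)
  exact Category.assoc _ _ _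

/-- The point where the permutations left open by the tensor lemmas are discarded. -/
theorem PermEq.comp_sliceGen {G : CGraph C} {A : E} {l l' : List G.Vert}
    {f : A ⟶ listTensor (fun w => V.obj (G.corolla w)) l}
    {g : A ⟶ listTensor (fun w => V.obj (G.corolla w)) l'} (e : PermEq f g) (p : G ⟶ δ)
    (hl : IsOrdering l) (hl' : IsOrdering l') :
    f ≫ sliceGen V G p l hl = g ≫ sliceGen V G p l' hl' :=
  (Category.assoc _ _ _).symm.trans ((congrArg (· ≫ sliceι V ⟨G⟩ p) (e.comp_ι hl hl')).trans
    (Category.assoc _ _ _))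

end Gen

/-! ### Erasing braces for given graphs -/

/-- The map from the iterated tensor product of the values of `V` at the corollas of the graphs
`Y v` to the colimit which belongs to the grafted graph. -/
noncomputable def brace (V : Corolla C ⥤ E) {δ : CGraph C} (Γ : CGraph C) (p : Γ ⟶ δ)
    (Y : Γ.Vert → CGraph C) (f : ∀ v, Y v ⟶ Γ.star v) (l : List Γ.Vert) (hl : IsOrdering l)
    (m : ∀ v, List (Y v).Vert) (hm : ∀ v, IsOrdering (m v)) :
    listTensor (fun v => listTensor (fun w => V.obj ((Y v).corolla w)) (m v)) l ⟶
      colimit (sliceDiagram V δ) :=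
  listTensorFlatMap (Z := fun u => V.obj ((Γ.graft Y f).corolla u))
      (fun v w => V.map (graftCorolla Γ Y f v w)) m l ≫
    sliceGen V (Γ.graft Y f) (Γ.graftHom Y f ≫ p) (l.sigma m) (hl.sigma hm)

section Brace

variable (V : Corolla C ⥤ E) {δ : CGraph C} (Γ : CGraph C) (p : Γ ⟶ δ)

theorem brace_sliceMap {δ' : CGraph C} (φ : δ ⟶ δ') (Y : Γ.Vert → CGraph C)
    (f : ∀ v, Y v ⟶ Γ.star v) (l : List Γ.Vert) (hl : IsOrdering l)
    (m : ∀ v, List (Y v).Vert) (hm : ∀ v, IsOrdering (m v)) :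
    brace V Γ p Y f l hl m hm ≫ sliceMap V φ = brace V Γ (p ≫ φ) Y f l hl m hm :=
  (Category.assoc _ _ _).trans (congrArg _ ((sliceGen_sliceMap V φ _ _ _ _).trans
    (congrArg (fun t => sliceGen V _ t _ _) (Category.assoc _ _ _))))

theorem brace_sliceTrans {W : Corolla C ⥤ E} (α : V ⟶ W) (Y : Γ.Vert → CGraph C)
    (f : ∀ v, Y v ⟶ Γ.star v) (l : List Γ.Vert) (hl : IsOrdering l)
    (m : ∀ v, List (Y v).Vert) (hm : ∀ v, IsOrdering (m v)) :
    brace V Γ p Y f l hl m hm ≫ sliceTrans α δ =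
      listTensorMap (fun v => listTensorMap (fun w => α.app ((Y v).corolla w)) (m v)) l ≫
        brace W Γ p Y f l hl m hm := by
  have e : listTensorFlatMap (Z := fun u => V.obj ((Γ.graft Y f).corolla u))
      (fun v w => V.map (graftCorolla Γ Y f v w)) m l ≫
      listTensorMap (fun u => α.app ((Γ.graft Y f).corolla u)) (l.sigma m) =
      listTensorMap (fun v => listTensorMap (fun w => α.app ((Y v).corolla w)) (m v)) l ≫
        listTensorFlatMap (Z := fun u => W.obj ((Γ.graft Y f).corolla u))
      (fun v w => W.map (graftCorolla Γ Y f v w)) m l := by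
    refine (listTensorFlatMap_comp _ _ m l).trans
      (Eq.trans ?_ (comp_listTensorFlatMap _ _ m l).symm)
    exact congrArg (fun t => listTensorFlatMap t m l)
      (funext fun v => funext fun w => α.naturality (graftCorolla Γ Y f v w))
  refine (Category.assoc _ _ _).trans ((congrArg _ (sliceGen_sliceTrans V α _ _ _ _)).trans ?_)
  exact (Category.assoc _ _ _).symm.trans ((congrArg (· ≫ _) e).trans (Category.assoc _ _ _))

/-- The graphs are unchanged; two blocks of factors are exchanged, which the unordered tensor
product of the grafted graph does not notice. -/
theorem brace_swap (Y : Γ.Vert → CGraph C) (f : ∀ v, Y v ⟶ Γ.star v) (l₁ : List Γ.Vert)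
    (a b : Γ.Vert) (l₂ : List Γ.Vert) (h : IsOrdering (l₁ ++ a :: b :: l₂))
    (h' : IsOrdering (l₁ ++ b :: a :: l₂)) (m : ∀ v, List (Y v).Vert)
    (hm : ∀ v, IsOrdering (m v)) :
    listTensorSwap (fun v => listTensor (fun w => V.obj ((Y v).corolla w)) (m v)) a b l₂ l₁ ≫
      brace V Γ p Y f _ h' m hm = brace V Γ p Y f _ h m hm :=
  (Category.assoc _ _ _).symm.trans
    ((listTensorFlatMap_swap (Z := fun u => V.obj ((Γ.graft Y f).corolla u))
      (fun v w => V.map (graftCorolla Γ Y f v w)) m a b l₂ l₁).comp_sliceGen V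
      (Γ.graftHom Y f ≫ p) (h'.sigma hm) (h.sigma hm))

/-- The grafted graphs are joined by the non-contracting `graftMap` over `δ`, so `sliceGen_map`
compares the generators; `listTensorFlatMap_fiber`, fed with `graftCorolla_graftMap`, compares the
tensor products. -/
theorem brace_graftMap {Y Y' : Γ.Vert → CGraph C} (h : ∀ v, (⟨Y v⟩ : BijGraph C) ⟶ ⟨Y' v⟩)
    (f' : ∀ v, Y' v ⟶ Γ.star v) (l : List Γ.Vert) (hl : IsOrdering l)
    (m : ∀ v, List (Y v).Vert) (hm : ∀ v, IsOrdering (m v)) :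
    brace V Γ p Y (fun v => (h v).hom ≫ f' v) l hl m hm =
      listTensorMap (fun v => listTensorMap (fun w => V.map (corollaMap (h v) w)) (m v) ≫
        listTensorReindex (h v).hom.vert (fun w => V.obj ((Y' v).corolla w)) (m v)) l ≫
      brace V Γ p Y' f' l hl (fun v => (m v).map (h v).hom.vert)
        fun v => (hm v).map (vert_bijective (h v).hom (h v).property) := by
  let k := graftBijMap Γ (fun v => (h v).hom) (fun v => (h v).property) f'
  have e₀ : Γ.graftHom Y (fun v => (h v).hom ≫ f' v) ≫ p = k.hom ≫ Γ.graftHom Y' f' ≫ p :=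
    (congrArg (· ≫ p) (graftMap_graftHom Γ (fun v => (h v).hom) (fun v => (h v).property)
      f').symm).trans (Category.assoc _ _ _)
  have e₁ := sliceGen_map V k (Γ.graftHom Y' f' ≫ p) (l.sigma m) (hl.sigma hm)
  have e₂ := (listTensorFlatMap_fiber (fun v => (h v).hom.vert)
    (Z := fun u => V.obj ((Γ.graft Y (fun v => (h v).hom ≫ f' v)).corolla u))
    (Z' := fun u => V.obj ((Γ.graft Y' f').corolla u))
    (fun v w => V.map (graftCorolla Γ Y (fun v => (h v).hom ≫ f' v) v w))
    (fun v w => V.map (graftCorolla Γ Y' f' v w)) (fun v w => V.map (corollaMap (h v) w))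
    (fun u => V.map (corollaMap k u)) (fun v w => (V.map_comp _ _).symm.trans
      ((congrArg V.map (graftCorolla_graftMap Γ (fun v => (h v).hom) (fun v => (h v).property)
        f' v w)).trans (V.map_comp _ _))) m l).comp_sliceGen V (Γ.graftHom Y' f' ≫ p)
    ((hl.sigma hm).map (vert_bijective k.hom k.property))
    (hl.sigma fun v => (hm v).map (vert_bijective (h v).hom (h v).property))
  refine (congrArg (fun t => _ ≫ sliceGen V _ t (l.sigma m) (hl.sigma hm)) e₀).trans ?_
  refine (congrArg (_ ≫ ·) e₁).trans (Eq.trans ?_ (e₂.trans (Category.assoc _ _ _)))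
  exact (congrArg _ (Category.assoc _ _ _).symm).trans (Category.assoc _ _ _).symm

/-- As for `brace_graftMap`, with `graftBase` and `listTensorFlatMap_base`. The family on `Γ` is
taken as a pullback from `Γ'`, so that corresponding graphs are literally equal. -/
theorem brace_graftBase {Γ' : CGraph C} (g : (⟨Γ⟩ : BijGraph C) ⟶ ⟨Γ'⟩) (p' : Γ' ⟶ δ)
    (Y' : Γ'.Vert → CGraph C) (f : ∀ v, Y' (g.hom.vert v) ⟶ Γ.star v)
    (f' : ∀ v, Y' v ⟶ Γ'.star v)
    (H : ∀ v, f v ≫ starMap g.hom g.property v = f' (g.hom.vert v))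
    (l : List Γ.Vert) (hl : IsOrdering l) (m : ∀ v, List (Y' v).Vert)
    (hm : ∀ v, IsOrdering (m v)) :
    brace V Γ (g.hom ≫ p') (fun v => Y' (g.hom.vert v)) f l hl (fun v => m (g.hom.vert v))
        (fun v => hm (g.hom.vert v)) =
      listTensorReindex g.hom.vert
        (fun v => listTensor (fun w => V.obj ((Y' v).corolla w)) (m v)) l ≫
      brace V Γ' p' Y' f' (l.map g.hom.vert) (hl.map (vert_bijective g.hom g.property)) m hm := by
  let k := graftBaseBij g.hom g.property Y' f f' H
  have e₀ : Γ.graftHom (fun v => Y' (g.hom.vert v)) f ≫ g.hom ≫ p' =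
      k.hom ≫ Γ'.graftHom Y' f' ≫ p' :=
    (Category.assoc _ _ _).symm.trans ((congrArg (· ≫ p') (graftBase_graftHom g.hom g.property Y' f
      f' H).symm).trans (Category.assoc _ _ _))
  have hlm := hl.sigma (m := fun v => m (g.hom.vert v)) (fun v => hm (g.hom.vert v))
  have e₁ := sliceGen_map V k (Γ'.graftHom Y' f' ≫ p') (l.sigma fun v => m (g.hom.vert v)) hlm
  have e₂ := (listTensorFlatMap_base (I' := Γ'.Vert) (J' := fun v => (Y' v).Vert) g.hom.vert
    (X' := fun v w => V.obj ((Y' v).corolla w))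
    (Z := fun u => V.obj ((Γ.graft (fun v => Y' (g.hom.vert v)) f).corolla u))
    (Z' := fun u => V.obj ((Γ'.graft Y' f').corolla u))
    (fun v w => V.map (graftCorolla Γ (fun v => Y' (g.hom.vert v)) f v w))
    (fun v w => V.map (graftCorolla Γ' Y' f' v w))
    (fun u => V.map (corollaMap k u)) (fun v w => (V.map_comp _ _).symm.trans
      (congrArg V.map (graftCorolla_graftBase g.hom g.property Y' f f' H v w)))
      m l).comp_sliceGen V (Γ'.graftHom Y' f' ≫ p')
    (hlm.map (vert_bijective k.hom k.property))
    ((hl.map (vert_bijective g.hom g.property)).sigma hm)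
  refine (congrArg (fun t => _ ≫ sliceGen V _ t (l.sigma _) hlm) e₀).trans ?_
  refine (congrArg (_ ≫ ·) e₁).trans (Eq.trans ?_ (e₂.trans (Category.assoc _ _ _)))
  exact (congrArg _ (Category.assoc _ _ _).symm).trans (Category.assoc _ _ _).symm

end Brace

/-! ### Erasing braces on colimits -/

section BraceColimit

variable (V : Corolla C ⥤ E) {δ : CGraph C} (Γ : CGraph C) (p : Γ ⟶ δ)

/-- The map from the tensor product of the values of `V` at the graphs `Y v` to the colimit which
belongs to the grafted graph. -/
noncomputable def braceExtend (Y : Γ.Vert → CGraph C) (f : ∀ v, Y v ⟶ Γ.star v) (l : List Γ.Vert)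
    (hl : IsOrdering l) :
    listTensor (fun v => (extend V).obj ⟨Y v⟩) l ⟶ colimit (sliceDiagram V δ) :=
  listTensorMap (fun v => unorderedTensor.map (fun w => w) Function.bijective_id
      fun w => V.map (graftCorolla Γ Y f v w)) l ≫
    unorderedFlatten (J := fun v => (Y v).Vert) (fun u => V.obj ((Γ.graft Y f).corolla u)) l hl ≫
      sliceι V ⟨Γ.graft Y f⟩ (Γ.graftHom Y f ≫ p)

theorem ι_braceExtend (Y : Γ.Vert → CGraph C) (f : ∀ v, Y v ⟶ Γ.star v) (l : List Γ.Vert)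
    (hl : IsOrdering l) (m : ∀ v, List (Y v).Vert) (hm : ∀ v, IsOrdering (m v)) :
    listTensorMap (fun v => unorderedTensor.ι (fun w => V.obj ((Y v).corolla w)) (m v) (hm v)) l ≫
      braceExtend V Γ p Y f l hl = brace V Γ p Y f l hl m hm := by
  have e₁ : listTensorMap (fun v => unorderedTensor.ι (fun w => V.obj ((Y v).corolla w)) (m v)
      (hm v)) l ≫ listTensorMap (fun v => unorderedTensor.map (fun w => w) Function.bijective_id
      fun w => V.map (graftCorolla Γ Y f v w)) l =
      listTensorMap (fun v => listTensorMap (fun w => V.map (graftCorolla Γ Y f v w)) (m v)) l ≫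
      listTensorMap (fun v => unorderedTensor.ι
        (fun w => V.obj ((Γ.graft Y f).corolla ⟨v, w⟩)) (m v) (hm v)) l := by
    refine (listTensorMap_comp _ _ l).symm.trans (Eq.trans ?_ (listTensorMap_comp _ _ l))
    exact congrArg (fun t => listTensorMap t l)
      (funext fun v => unorderedTensor_ι_map_id _ (m v) (hm v))
  have e₂ := ι_unorderedFlatten (J := fun v => (Y v).Vert)
    (fun u => V.obj ((Γ.graft Y f).corolla u)) l hl m hm
  refine (Category.assoc _ _ _).symm.trans ((congrArg (· ≫ _) e₁).trans ?_)
  refine (Category.assoc _ _ _).trans (Eq.trans (congrArg _ ?_) (Category.assoc _ _ _).symm)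
  exact (Category.assoc _ _ _).symm.trans ((congrArg (· ≫ _) e₂).trans (Category.assoc _ _ _))

/-- On orderings this is `brace_graftMap`. It is the compatibility needed to pass from given graphs
`Y v` to the colimits over the slices. -/
theorem braceExtend_naturality (Y Y' : Γ.Vert → CGraph C)
    (h : ∀ v, (⟨Y v⟩ : BijGraph C) ⟶ ⟨Y' v⟩) (f' : ∀ v, Y' v ⟶ Γ.star v) (l : List Γ.Vert)
    (hl : IsOrdering l) :
    listTensorMap (fun v => (extend V).map (h v)) l ≫ braceExtend V Γ p Y' f' l hl =
      braceExtend V Γ p Y (fun v => (h v).hom ≫ f' v) l hl := by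
  refine listTensor_unordered_hom_ext (J := fun v => (Y v).Vert)
    (fun v w => V.obj ((Y v).corolla w)) hl fun m hm => ?_
  refine Eq.trans ?_ ((brace_graftMap V Γ p h f' l hl m hm).symm.trans
    (ι_braceExtend V Γ p Y _ l hl m hm).symm)
  refine Eq.trans ?_ (congrArg _ (ι_braceExtend V Γ p Y' f' l hl _ _))
  refine (Category.assoc _ _ _).symm.trans (Eq.trans (congrArg (· ≫ _) ?_) (Category.assoc _ _ _))
  refine (listTensorMap_comp _ _ l).symm.trans (Eq.trans ?_ (listTensorMap_comp _ _ l))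
  refine congrArg (fun t => listTensorMap t l) (funext fun v => ?_)
  exact (unorderedTensor.ι_map (X := fun w => V.obj ((Y v).corolla w))
    (Y := fun w => V.obj ((Y' v).corolla w)) (h v).hom.vert
    (vert_bijective (h v).hom (h v).property) (fun w => V.map (corollaMap (h v) w)) (m v)
    (hm v)).trans (Category.assoc _ _ _).symm

theorem exists_braceColimit (l : List Γ.Vert) (hl : IsOrdering l) :
    ∃ d : listTensor (fun v => colimit (sliceDiagram V (Γ.star v))) l ⟶
        colimit (sliceDiagram V δ),
      ∀ (Y : Γ.Vert → CGraph C) (f : ∀ v, Y v ⟶ Γ.star v),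
        listTensorMap (fun v => sliceι V ⟨Y v⟩ (f v)) l ≫ d = braceExtend V Γ p Y f l hl :=
  listTensor_slice_exists_desc V Γ.star hl (fun Y f => braceExtend V Γ p Y f l hl)
    fun Y Y' h f' => braceExtend_naturality V Γ p Y Y' h f' l hl

/-- The map from an ordered tensor product of colimits given by erasing braces. -/
noncomputable def braceColimit (l : List Γ.Vert) (hl : IsOrdering l) :
    listTensor (fun v => ((freeModular C E).obj V).obj (Γ.corolla v)) l ⟶
      colimit (sliceDiagram V δ) :=
  (exists_braceColimit V Γ p l hl).choose

theorem sliceGen_braceColimit (l : List Γ.Vert) (hl : IsOrdering l) (Y : Γ.Vert → CGraph C)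
    (f : ∀ v, Y v ⟶ Γ.star v) (m : ∀ v, List (Y v).Vert) (hm : ∀ v, IsOrdering (m v)) :
    listTensorMap (fun v => sliceGen V (Y v) (f v) (m v) (hm v)) l ≫ braceColimit V Γ p l hl =
      brace V Γ p Y f l hl m hm := by
  refine (listTensorMap_comp_assoc _ _ l _).trans ?_
  refine (congrArg _ ((exists_braceColimit V Γ p l hl).choose_spec Y f)).trans ?_
  exact ι_braceExtend V Γ p Y f l hl m hm

/-- On generators this is `brace_swap`; it allows the ordering of the vertices of `Γ` to be
forgotten. -/
theorem braceColimit_swap (l₁ : List Γ.Vert) (a b : Γ.Vert) (l₂ : List Γ.Vert)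
    (h : IsOrdering (l₁ ++ a :: b :: l₂)) (h' : IsOrdering (l₁ ++ b :: a :: l₂)) :
    listTensorSwap (fun v => ((freeModular C E).obj V).obj (Γ.corolla v)) a b l₂ l₁ ≫
      braceColimit V Γ p _ h' = braceColimit V Γ p _ h := by
  refine listTensor_slice_hom_ext V Γ.star h fun Y f m hm => ?_
  refine Eq.trans ?_ ((brace_swap V Γ p Y f l₁ a b l₂ h h' m hm).trans
    (sliceGen_braceColimit V Γ p _ h Y f m hm).symm)
  refine (Category.assoc _ _ _).symm.trans ((congrArg (· ≫ _) (listTensorMap_swap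
    (fun v => sliceGen V (Y v) (f v) (m v) (hm v)) a b l₂ l₁)).trans ?_)
  exact (Category.assoc _ _ _).trans (congrArg _ (sliceGen_braceColimit V Γ p _ h' Y f m hm))

/-- The map from the unordered tensor product of colimits given by erasing braces. -/
noncomputable def braceTensor :
    (extend ((freeModular C E).obj V)).obj ⟨Γ⟩ ⟶ colimit (sliceDiagram V δ) :=
  Multicoequalizer.desc
    (tensorIndex fun v => ((freeModular C E).obj V).obj (Γ.corolla v)) _
    (fun l => braceColimit V Γ p l.1 l.2) fun s =>
      (Category.id_comp _).trans (braceColimit_swap V Γ p s.l₁ s.a s.b s.l₂ _ _).symm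

theorem ι_braceTensor (l : List Γ.Vert) (hl : IsOrdering l) :
    unorderedTensor.ι (fun v => ((freeModular C E).obj V).obj (Γ.corolla v)) l hl ≫
      braceTensor V Γ p = braceColimit V Γ p l hl :=
  Multicoequalizer.π_desc _ _ _ _ _

theorem braceTensor_hom_ext {Z : E} {f g : (extend ((freeModular C E).obj V)).obj ⟨Γ⟩ ⟶ Z}
    (h : ∀ (l : List Γ.Vert) (hl : IsOrdering l) (Y : Γ.Vert → CGraph C)
      (y : ∀ v, Y v ⟶ Γ.star v) (m : ∀ v, List (Y v).Vert) (hm : ∀ v, IsOrdering (m v)),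
      listTensorMap (fun v => sliceGen V (Y v) (y v) (m v) (hm v)) l ≫
        unorderedTensor.ι (fun v => ((freeModular C E).obj V).obj (Γ.corolla v)) l hl ≫ f =
      listTensorMap (fun v => sliceGen V (Y v) (y v) (m v) (hm v)) l ≫
        unorderedTensor.ι (fun v => ((freeModular C E).obj V).obj (Γ.corolla v)) l hl ≫ g) :
    f = g :=
  unorderedTensor.hom_ext fun l hl =>
    listTensor_slice_hom_ext V Γ.star hl fun Y y m hm => h l hl Y y m hm

theorem sliceGen_braceTensor (l : List Γ.Vert) (hl : IsOrdering l) (Y : Γ.Vert → CGraph C)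
    (f : ∀ v, Y v ⟶ Γ.star v) (m : ∀ v, List (Y v).Vert) (hm : ∀ v, IsOrdering (m v)) :
    listTensorMap (fun v => sliceGen V (Y v) (f v) (m v) (hm v)) l ≫
        unorderedTensor.ι (fun v => ((freeModular C E).obj V).obj (Γ.corolla v)) l hl ≫
        braceTensor V Γ p =
      brace V Γ p Y f l hl m hm :=
  (congrArg _ (ι_braceTensor V Γ p l hl)).trans (sliceGen_braceColimit V Γ p l hl Y f m hm)

/-- Dependent families over the source of a bijection are restrictions of families over its target.
-/
theorem exists_comp_bijective {A B : Type*} {σ : A → B} (hσ : Function.Bijective σ)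
    {P : B → Type*} (a : ∀ i, P (σ i)) : ∃ a' : ∀ j, P j, ∀ i, a' (σ i) = a i :=
  ⟨Equiv.piCongrLeft P (Equiv.ofBijective σ hσ) a,
    fun i => Equiv.piCongrLeft_apply_apply P (Equiv.ofBijective σ hσ) a i⟩

theorem braceTensor_naturality {Γ' : CGraph C} (g : (⟨Γ⟩ : BijGraph C) ⟶ ⟨Γ'⟩) (p' : Γ' ⟶ δ) :
    (extend ((freeModular C E).obj V)).map g ≫ braceTensor V Γ' p' =
      braceTensor V Γ (g.hom ≫ p') := by
  refine braceTensor_hom_ext V Γ fun l hl Y f m hm => ?_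
  have hg := vert_bijective g.hom g.property
  -- Graphs, structure maps and orderings are rewritten as pulled back from `Γ'`; substituting these
  -- equations brings them into the form required by `brace_graftBase`.
  obtain ⟨Y', hY⟩ := exists_comp_bijective hg (P := fun _ => CGraph C) Y
  obtain rfl : (fun v => Y' (g.hom.vert v)) = Y := funext hY
  obtain ⟨f', hf⟩ := exists_comp_bijective hg (P := fun v => Y' v ⟶ Γ'.star v)
    fun v => f v ≫ starMap g.hom g.property v
  obtain ⟨m', hm'⟩ := exists_comp_bijective hg (P := fun v => List (Y' v).Vert) m
  obtain rfl : (fun v => m' (g.hom.vert v)) = m := funext hm'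
  have hmm : ∀ v, IsOrdering (m' v) := fun v => by
    obtain ⟨v, rfl⟩ := hg.2 v
    exact hm v
  refine Eq.trans ?_ (((brace_graftBase V Γ g p' Y' f f' (fun v => (hf v).symm) l hl m'
    hmm).symm).trans (sliceGen_braceTensor V Γ (g.hom ≫ p') l hl _ f _ hm).symm)
  have e₁ := unorderedTensor.ι_map (X := fun v => ((freeModular C E).obj V).obj (Γ.corolla v))
    (Y := fun v => ((freeModular C E).obj V).obj (Γ'.corolla v)) g.hom.vert hg
    (fun v => ((freeModular C E).obj V).map (corollaMap g v)) l hl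
  have e₂ : listTensorMap (fun v => sliceGen V (Y' (g.hom.vert v)) (f v) (m' (g.hom.vert v))
      (hm v)) l ≫ listTensorMap (fun v => ((freeModular C E).obj V).map (corollaMap g v)) l =
      listTensorMap (fun v => sliceGen V (Y' (g.hom.vert v)) (f' (g.hom.vert v))
        (m' (g.hom.vert v)) (hm v)) l := by
    refine (listTensorMap_comp _ _ l).symm.trans ?_
    refine congrArg (fun t => listTensorMap t l) (funext fun v => ?_)
    refine (sliceGen_sliceMap V (starMap g.hom g.property v) _ (f v) _ _).trans ?_
    exact congrArg (fun t => sliceGen V _ t _ _) (hf v).symm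
  have e₃ := listTensorMap_reindex g.hom.vert
    (fun v => sliceGen V (Y' v) (f' v) (m' v) (hmm v)) l
  have e₄ := sliceGen_braceTensor V Γ' p' (l.map g.hom.vert) (hl.map hg) Y' f' m' hmm
  refine (congrArg _ ((Category.assoc _ _ _).symm.trans ((congrArg (· ≫ _) e₁).trans
    (Category.assoc _ _ _)))).trans ?_
  refine (Category.assoc _ _ _).symm.trans ((congrArg (· ≫ _) e₂).trans ?_)
  refine (congrArg _ (Category.assoc _ _ _)).trans ?_
  refine (Category.assoc _ _ _).symm.trans ((congrArg (· ≫ _) e₃.symm).trans ?_)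
  exact (Category.assoc _ _ _).trans (congrArg _ e₄)

end BraceColimit
end Braces

section MonadLaws

variable {C : Type u} [SmallCategory C] [CategoryWithDuality C]
  {E : Type w} [Category.{v} E] [MonoidalCategory E] [SymmetricCategory E]
  [HasColimitsOfSize.{u, u} E] [∀ X : E, PreservesColimitsOfSize.{u, u} (tensorLeft X)]

theorem comp_eq_assoc {a b c d : E} {f : a ⟶ b} {g : b ⟶ c} {k : a ⟶ c} (e : f ≫ g = k)
    (t : c ⟶ d) : f ≫ g ≫ t = k ≫ t := by
  rw [← Category.assoc, e]

theorem comp_eq_comp_assoc {a b b' c d : E} {f : a ⟶ b} {g : b ⟶ c} {f' : a ⟶ b'} {g' : b' ⟶ c}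
    (e : f ≫ g = f' ≫ g') (t : c ⟶ d) : f ≫ g ≫ t = f' ≫ g' ≫ t := by
  rw [← Category.assoc, e, Category.assoc]

/-! ### The multiplication -/

section Multiplication

/-- The two-layer generators are jointly epimorphic onto `𝓜²V`. This gives uniqueness of `μ` and
reduces its naturality to generators. -/
theorem slice_slice_hom_ext (V : Corolla C ⥤ E) {δ : CGraph C} {Z : E}
    {f g : colimit (sliceDiagram ((freeModular C E).obj V) δ) ⟶ Z}
    (h : ∀ (Γ : CGraph C) (p : Γ ⟶ δ) (Y : Γ.Vert → CGraph C) (y : ∀ v, Y v ⟶ Γ.star v)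
      (l : List Γ.Vert) (hl : IsOrdering l) (m : ∀ v, List (Y v).Vert)
      (hm : ∀ v, IsOrdering (m v)),
      listTensorMap (fun v => sliceGen V (Y v) (y v) (m v) (hm v)) l ≫
        sliceGen ((freeModular C E).obj V) Γ p l hl ≫ f =
      listTensorMap (fun v => sliceGen V (Y v) (y v) (m v) (hm v)) l ≫
        sliceGen ((freeModular C E).obj V) Γ p l hl ≫ g) : f = g :=
  slice_gen_hom_ext ((freeModular C E).obj V) fun Γ p l hl =>
    listTensor_slice_hom_ext V Γ.star hl fun Y y m hm => h Γ p Y y l hl m hm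

/-- Erasing braces on the colimit. -/
noncomputable def braceApp (V : Corolla C ⥤ E) (δ : CGraph C) :
    colimit (sliceDiagram ((freeModular C E).obj V) δ) ⟶ colimit (sliceDiagram V δ) :=
  sliceDesc ((freeModular C E).obj V) (fun Γ p => braceTensor V Γ.obj p)
    fun Γ Γ' g p' => braceTensor_naturality V Γ.obj g p'

theorem sliceGen_braceApp (V : Corolla C ⥤ E) {δ : CGraph C} (Γ : CGraph C) (p : Γ ⟶ δ)
    (Y : Γ.Vert → CGraph C) (f : ∀ v, Y v ⟶ Γ.star v) (l : List Γ.Vert) (hl : IsOrdering l)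
    (m : ∀ v, List (Y v).Vert) (hm : ∀ v, IsOrdering (m v)) :
    listTensorMap (fun v => sliceGen V (Y v) (f v) (m v) (hm v)) l ≫
        sliceGen ((freeModular C E).obj V) Γ p l hl ≫ braceApp V δ =
      brace V Γ p Y f l hl m hm := by
  refine Eq.trans (congrArg _ ?_) (sliceGen_braceTensor V Γ p l hl Y f m hm)
  exact (Category.assoc _ _ _).trans (congrArg _ (sliceι_desc _ _ _ _ _))

/-- A morphism of the base acts only by composition on the structure map `p`, which grafting does
not touch. -/
theorem braceApp_sliceMap (V : Corolla C ⥤ E) {δ δ' : CGraph C} (φ : δ ⟶ δ') :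
    sliceMap ((freeModular C E).obj V) φ ≫ braceApp V δ' = braceApp V δ ≫ sliceMap V φ := by
  refine slice_slice_hom_ext V fun Γ p Y f l hl m hm => ?_
  have e := sliceGen_sliceMap ((freeModular C E).obj V) φ Γ p l hl
  refine (congrArg _ (comp_eq_assoc e (braceApp V δ'))).trans ?_
  refine (sliceGen_braceApp V Γ (p ≫ φ) Y f l hl m hm).trans ?_
  refine (brace_sliceMap V Γ p φ Y f l hl m hm).symm.trans ?_
  refine (congrArg (· ≫ sliceMap V φ) (sliceGen_braceApp V Γ p Y f l hl m hm).symm).trans ?_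
  exact (Category.assoc _ _ _).trans (congrArg _ (Category.assoc _ _ _))

theorem braceApp_sliceTrans {V W : Corolla C ⥤ E} (α : V ⟶ W) (δ : CGraph C) :
    sliceTrans ((freeModular C E).map α) δ ≫ braceApp W δ = braceApp V δ ≫ sliceTrans α δ := by
  refine slice_slice_hom_ext V fun Γ p Y f l hl m hm => ?_
  have e := sliceGen_sliceTrans ((freeModular C E).obj V) ((freeModular C E).map α) Γ p l hl
  have e' : listTensorMap (fun v => sliceGen V (Y v) (f v) (m v) (hm v)) l ≫
      listTensorMap (fun v => ((freeModular C E).map α).app (Γ.corolla v)) l =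
      listTensorMap (fun v => listTensorMap (fun w => α.app ((Y v).corolla w)) (m v)) l ≫
        listTensorMap (fun v => sliceGen W (Y v) (f v) (m v) (hm v)) l := by
    refine (listTensorMap_comp _ _ l).symm.trans (Eq.trans ?_ (listTensorMap_comp _ _ l))
    exact congrArg (fun t => listTensorMap t l)
      (funext fun v => sliceGen_sliceTrans V α (Y v) (f v) (m v) (hm v))
  refine (congrArg _ (comp_eq_comp_assoc e (braceApp W δ))).trans ?_
  refine (comp_eq_comp_assoc e' _).trans ?_
  refine (congrArg _ (sliceGen_braceApp W Γ p Y f l hl m hm)).trans ?_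
  refine (brace_sliceTrans V Γ p α Y f l hl m hm).symm.trans ?_
  refine (congrArg (· ≫ sliceTrans α δ) (sliceGen_braceApp V Γ p Y f l hl m hm).symm).trans ?_
  exact (Category.assoc _ _ _).trans (congrArg _ (Category.assoc _ _ _))

/-- The natural transformation `𝓜² ⟶ 𝓜` given by erasing braces. -/
noncomputable def eraseBraces (C : Type u) [SmallCategory C] [CategoryWithDuality C]
    (E : Type w) [Category.{v} E] [MonoidalCategory E] [SymmetricCategory E]
    [HasColimitsOfSize.{u, u} E] [∀ X : E, PreservesColimitsOfSize.{u, u} (tensorLeft X)] :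
    freeModular C E ⋙ freeModular C E ⟶ freeModular C E where
  app V :=
    { app := fun γ => braceApp V γ.obj
      naturality := fun γ γ' φ => braceApp_sliceMap V φ.hom }
  naturality V W α := NatTrans.ext (funext fun γ => braceApp_sliceTrans α γ.obj)

/-- The defining property of erasing braces in terms of the generators. -/
theorem isErasingBraces_iff (μ : freeModular C E ⋙ freeModular C E ⟶ freeModular C E) :
    IsErasingBraces μ ↔ ∀ (V : Corolla C ⥤ E) (γ : Corolla C) (Γ : CGraph C) (p : Γ ⟶ γ.obj)
      (Y : Γ.Vert → CGraph C) (f : ∀ v, Y v ⟶ Γ.star v) (l : List Γ.Vert) (hl : IsOrdering l)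
      (m : ∀ v, List (Y v).Vert) (hm : ∀ v, IsOrdering (m v)),
      listTensorMap (fun v => sliceGen V (Y v) (f v) (m v) (hm v)) l ≫
        sliceGen ((freeModular C E).obj V) Γ p l hl ≫ (μ.app V).app γ =
      brace V Γ p Y f l hl m hm := by
  refine forall_congr' fun V => forall_congr' fun γ => forall_congr' fun Γ => forall_congr' fun p =>
    forall_congr' fun Y => forall_congr' fun f => forall_congr' fun l => forall_congr' fun hl =>
    forall_congr' fun m => forall_congr' fun hm => ?_
  refine Iff.of_eq (congrArg₂ (· = ·) ?_ ?_)
  · exact congrArg _ (Category.assoc _ _ _).symm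
  · exact (Category.assoc _ _ _).symm

theorem existsUnique_isErasingBraces :
    ∃! μ : freeModular C E ⋙ freeModular C E ⟶ freeModular C E, IsErasingBraces μ := by
  refine ⟨eraseBraces C E, (isErasingBraces_iff _).2 fun V γ Γ p Y f l hl m hm =>
    sliceGen_braceApp V Γ p Y f l hl m hm, fun μ hμ => ?_⟩
  refine NatTrans.ext (funext fun V => NatTrans.ext (funext fun γ => ?_))
  refine slice_slice_hom_ext V fun Γ p Y f l hl m hm => ?_
  exact ((isErasingBraces_iff μ).1 hμ V γ Γ p Y f l hl m hm).trans
    (sliceGen_braceApp V Γ p Y f l hl m hm).symm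

end Multiplication

/-! ### The unit -/

section Unit

theorem isOrdering_singleton (γ : Corolla C) (v : γ.obj.Vert) : IsOrdering [v] :=
  ⟨List.nodup_singleton v, fun _ => List.mem_singleton.2 (γ.property.1.unique trivial trivial)⟩

/-- A morphism of corollas does not contract any edge. -/
theorem Corolla.nonContracting {γ γ' : Corolla C} (φ : γ ⟶ γ') :
    ModularOperad.nonContracting C φ.hom :=
  fun x => φ.hom.leg_mem x (γ.property.2 x)

theorem toStar_corollaMap {γ γ' : Corolla C} (φ : γ ⟶ γ') (v : γ.obj.Vert) :
    toStar γ v ≫ corollaMap (Γ := ⟨γ.obj⟩) (Γ' := ⟨γ'.obj⟩) ⟨φ.hom, Corolla.nonContracting φ⟩ v =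
      φ ≫ toStar γ' (φ.hom.vert v) :=
  Corolla.hom_ext_heq (fun x => rfl) fun x =>
    (eqToHom_comp_heq (φ.hom.q x.1) rfl).trans (comp_eqToHom_heq (φ.hom.q x.1) rfl).symm

theorem unit_square {a a' b b' c c' d d' : E} {f : a ⟶ a'} {i : a ⟶ b} {i' : a' ⟶ b'} {g : b ⟶ b'}
    {j : b ⟶ c} {j' : b' ⟶ c'} {h : c ⟶ c'} {k : c ⟶ d} {k' : c' ⟶ d'} {t : d ⟶ d'}
    (e₃ : i ≫ g = f ≫ i') (e₂ : j ≫ h = g ≫ j') (e₁ : k ≫ t = h ≫ k') :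
    f ≫ i' ≫ j' ≫ k' = (i ≫ j ≫ k) ≫ t := by
  rw [Category.assoc, Category.assoc, e₁, reassoc_of% e₂, reassoc_of% e₃]

/-- A morphism of corollas contracts nothing, so `φ` is a morphism in the slice over `γ'` from the
object `φ` to the object `id`. Naturality is the cocone condition for it. -/
theorem unitApp_naturality (V : Corolla C ⥤ E) {γ γ' : Corolla C} (φ : γ ⟶ γ') (v : γ.obj.Vert) :
    V.map φ ≫ unitApp V γ' (φ.hom.vert v) = unitApp V γ v ≫ sliceMap V φ.hom := by
  let k : (⟨γ.obj⟩ : BijGraph C) ⟶ ⟨γ'.obj⟩ := ⟨φ.hom, Corolla.nonContracting φ⟩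
  have e₁ : sliceGen V γ.obj (𝟙 γ.obj) [v] (isOrdering_singleton γ v) ≫ sliceMap V φ.hom =
      listTensorMap (fun w => V.map (corollaMap k w)) [v] ≫
        sliceGen V γ'.obj (𝟙 γ'.obj) [φ.hom.vert v] (isOrdering_singleton γ' _) := by
    refine (sliceGen_sliceMap V φ.hom _ _ _ _).trans (Eq.trans ?_ ((sliceGen_map V k (𝟙 γ'.obj) [v]
      (isOrdering_singleton γ v)).trans (congrArg _ ?_)))
    · exact congrArg (fun t => sliceGen V _ t _ _)
        ((Category.id_comp φ.hom).trans (Category.comp_id φ.hom).symm)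
    · refine (congrArg (· ≫ _) (MonoidalCategory.whiskerLeft_id _ _)).trans (Category.id_comp _)
  have e₂ : (ρ_ (V.obj (γ.obj.corolla v))).inv ≫
      listTensorMap (fun w => V.map (corollaMap k w)) [v] =
      V.map (corollaMap k v) ≫ (ρ_ (V.obj (γ'.obj.corolla (φ.hom.vert v)))).inv := by
    refine (congrArg _ (tensorHom_id _ _)).trans (rightUnitor_inv_naturality _).symm
  have e₃ : V.map (toStar γ v) ≫ V.map (corollaMap k v) =
      V.map φ ≫ V.map (toStar γ' (φ.hom.vert v)) :=
    (V.map_comp _ _).symm.trans ((congrArg V.map (toStar_corollaMap φ v)).trans (V.map_comp _ _))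
  exact unit_square e₃ e₂ e₁

theorem unitApp_sliceTrans {V W : Corolla C ⥤ E} (α : V ⟶ W) (γ : Corolla C) (v : γ.obj.Vert) :
    α.app γ ≫ unitApp W γ v = unitApp V γ v ≫ sliceTrans α γ.obj := by
  have e₁ := sliceGen_sliceTrans V α γ.obj (𝟙 γ.obj) [v] (isOrdering_singleton γ v)
  have e₂ : (ρ_ (V.obj (γ.obj.corolla v))).inv ≫
      listTensorMap (fun w => α.app (γ.obj.corolla w)) [v] =
      α.app (γ.obj.corolla v) ≫ (ρ_ (W.obj (γ.obj.corolla v))).inv := by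
    refine (congrArg _ (tensorHom_id _ _)).trans (rightUnitor_inv_naturality _).symm
  exact unit_square (α.naturality _) e₂ e₁

/-- The vertex of a corolla. -/
noncomputable def Corolla.vertex (γ : Corolla C) : γ.obj.Vert := γ.property.1.exists.choose

theorem Corolla.eq_vertex (γ : Corolla C) (v : γ.obj.Vert) : v = γ.vertex :=
  γ.property.1.unique trivial trivial

/-- The natural transformation `id ⟶ 𝓜` given by the identities of corollas. -/
noncomputable def unitTransformation (C : Type u) [SmallCategory C] [CategoryWithDuality C]
    (E : Type w) [Category.{v} E] [MonoidalCategory E] [SymmetricCategory E]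
    [HasColimitsOfSize.{u, u} E] [∀ X : E, PreservesColimitsOfSize.{u, u} (tensorLeft X)] :
    𝟭 (Corolla C ⥤ E) ⟶ freeModular C E where
  app V :=
    { app := fun γ => unitApp V γ γ.vertex
      naturality := fun γ γ' φ => by
        refine Eq.trans ?_ (unitApp_naturality V φ γ.vertex)
        rw [← Corolla.eq_vertex γ' (φ.hom.vert γ.vertex)]
        rfl }
  naturality V W α := NatTrans.ext (funext fun γ => unitApp_sliceTrans α γ γ.vertex)

theorem existsUnique_isUnitTransformation :
    ∃! η : 𝟭 (Corolla C ⥤ E) ⟶ freeModular C E, IsUnitTransformation η := by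
  refine ⟨unitTransformation C E, fun V γ v => ?_, fun η hη => ?_⟩
  · rw [Corolla.eq_vertex γ v]
    rfl
  · exact NatTrans.ext (funext fun V => NatTrans.ext (funext fun γ => hη V γ γ.vertex))

end Unit

/-! ### The laws of a monad -/

section Laws

theorem unit_left_aux {a b c d e x y : E} {s : a ⟶ b} {t : b ⟶ c} {r : a ⟶ c} {i : c ⟶ d}
    {j : a ⟶ e} {k : e ⟶ d} {q : d ⟶ x} {n : x ⟶ y} {u : e ⟶ y} (e₁ : s ≫ t = r)
    (e₂ : r ≫ i = j ≫ k) (e₃ : k ≫ q ≫ n = u) : s ≫ (t ≫ i ≫ q) ≫ n = j ≫ u := by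
  rw [Category.assoc, Category.assoc, reassoc_of% e₁, reassoc_of% e₂, e₃]

/-- Maps out of an iterated tensor product of colimits are determined by the generators. -/
theorem listTensor_nested_hom_ext {I : Type u} {J : I → Type u} (V : Corolla C ⥤ E)
    (δ : ∀ i, J i → CGraph C) {l : List I} (hl : IsOrdering l) {m : ∀ i, List (J i)}
    (hm : ∀ i, IsOrdering (m i)) {A : E}
    {f g : listTensor (fun i => listTensor (fun j => colimit (sliceDiagram V (δ i j))) (m i)) l ⟶ A}
    (h : ∀ (Z : (Σ i, J i) → CGraph C) (z : ∀ p, Z p ⟶ δ p.1 p.2) (n : ∀ p, List (Z p).Vert)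
      (hn : ∀ p, IsOrdering (n p)),
      listTensorMap (fun i => listTensorMap
        (fun j => sliceGen V (Z ⟨i, j⟩) (z ⟨i, j⟩) (n ⟨i, j⟩) (hn ⟨i, j⟩)) (m i)) l ≫ f =
      listTensorMap (fun i => listTensorMap
        (fun j => sliceGen V (Z ⟨i, j⟩) (z ⟨i, j⟩) (n ⟨i, j⟩) (hn ⟨i, j⟩)) (m i)) l ≫ g) :
    f = g := by
  let W : (Σ i, J i) → E := fun p => colimit (sliceDiagram V (δ p.1 p.2))
  -- Flattening is invertible, so the nested product may be replaced by a flat one over pairs, where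
  -- the test for slice colimits applies; flattening the source below restores the nested form of
  -- the generators.
  refine (cancel_epi (inv (listTensorFlatten W m l))).1 ?_
  refine listTensor_slice_hom_ext V (fun p : Σ i, J i => δ p.1 p.2) (hl.sigma hm)
    fun Z z n hn => ?_
  have e := listTensorFlatten_naturality (fun p => sliceGen V (Z p) (z p) (n p) (hn p)) m l
  refine (cancel_epi (listTensorFlatten
    (fun p : Σ i, J i => listTensor (fun w => V.obj ((Z p).corolla w)) (n p)) m l)).1 ?_
  refine Eq.trans ?_ ((h Z z n hn).trans ?_)
  · refine (comp_eq_comp_assoc e _).symm.trans (congrArg _ ?_)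
    exact IsIso.hom_inv_id_assoc (listTensorFlatten W m l) f
  · refine Eq.trans (congrArg _ ?_) (comp_eq_comp_assoc e _)
    exact (IsIso.hom_inv_id_assoc (listTensorFlatten W m l) g).symm

variable {η : 𝟭 (Corolla C ⥤ E) ⟶ freeModular C E}
  {μ : freeModular C E ⋙ freeModular C E ⟶ freeModular C E}

/-- On the generator of `Y` over `γ` the unit of `𝓜V` produces the braces with `γ` outside and `Y`
substituted for its vertex; erasing them returns `Y` up to `graftUnitLeft`. -/
theorem unit_left (hη : IsUnitTransformation η) (hμ : IsErasingBraces μ) (V : Corolla C ⥤ E) :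
     η.app ((freeModular C E).obj V) ≫ μ.app V = 𝟙 ((freeModular C E).obj V) := by
  refine NatTrans.ext (funext fun γ => slice_gen_hom_ext V fun Y p m hm => ?_)
  let v := γ.vertex
  have hv := isOrdering_singleton γ v
  let MV := (freeModular C E).obj V
  have e₁ : sliceGen V Y p m hm ≫ MV.map (toStar γ v) =
      sliceGen V Y (toStarFamily γ p v) m hm := sliceGen_sliceMap V (toStar γ v).hom Y p m hm
  have e₂ : sliceGen V Y (toStarFamily γ p v) m hm ≫ (ρ_ (MV.obj (γ.obj.corolla v))).inv =
      (ρ_ _).inv ≫ listTensorMap (fun v => sliceGen V Y (toStarFamily γ p v) m hm) [v] :=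
    (rightUnitor_inv_naturality _).trans (congrArg _ (tensorHom_id _ _).symm)
  have e₃ := (isErasingBraces_iff μ).1 hμ V γ γ.obj (𝟙 γ.obj) (fun _ => Y) (toStarFamily γ p) [v] hv
    (fun _ => m) fun _ => hm
  have e₄ := (listTensorFlatMap_singleton (J := fun _ : γ.obj.Vert => Y.Vert)
    (Z := fun u => V.obj ((γ.obj.graft (fun _ => Y) (toStarFamily γ p)).corolla u))
    (fun v w => V.map (graftCorolla γ.obj (fun _ => Y) (toStarFamily γ p) v w))
    (fun _ => m) v).comp_sliceGen V
      (γ.obj.graftHom (fun _ => Y) (toStarFamily γ p) ≫ 𝟙 γ.obj) (hv.sigma fun _ => hm)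
      (hm.map (vert_bijective _ (graftUnitLeft_nonContracting γ v p)))
  -- The colimit identifies the generators of `Y` and of the grafted graph along this relabelling.
  have e₅ := sliceGen_map V (graftUnitLeftBij γ v p)
    (γ.obj.graftHom (fun _ => Y) (toStarFamily γ p) ≫ 𝟙 γ.obj) m hm
  have e₆ : (graftUnitLeftBij γ v p).hom ≫ γ.obj.graftHom (fun _ => Y) (toStarFamily γ p) ≫
      𝟙 γ.obj = p :=
    (congrArg (_ ≫ ·) (Category.comp_id _)).trans (graftUnitLeft_graftHom γ v p)
  have e₇ : listTensorMap (fun w => V.map (graftCorolla γ.obj (fun _ => Y) (toStarFamily γ p) v w)) m =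
      listTensorMap (fun w => V.map (corollaMap (graftUnitLeftBij γ v p) w)) m :=
    congrArg (fun t => listTensorMap t m)
      (funext fun w => congrArg V.map (corollaMap_graftUnitLeft γ v p w).symm)
  have e₈ : sliceGen V Y p m hm ≫ (η.app MV).app γ ≫ (μ.app V).app γ = sliceGen V Y p m hm := by
    refine (congrArg (fun t => _ ≫ t ≫ _) (hη MV γ v)).trans ?_
    refine (unit_left_aux e₁ e₂ e₃).trans ?_
    refine ((Category.assoc _ _ _).symm.trans e₄).trans ?_
    refine (congrArg (fun t => (t ≫ _) ≫ _) e₇).trans ((Category.assoc _ _ _).trans ?_)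
    exact e₅.symm.trans (congrArg (fun t => sliceGen V Y t m hm) e₆)
  exact e₈.trans (Category.comp_id _).symm

/-- On the generator of `Γ` the map `𝓜η` puts braces around every vertex, that is, it substitutes
`γ(v)` for `v`; erasing them returns `Γ` up to `graftUnitRight`. -/
theorem unit_right (hη : IsUnitTransformation η) (hμ : IsErasingBraces μ) (V : Corolla C ⥤ E) :
     (freeModular C E).map (η.app V) ≫ μ.app V = 𝟙 ((freeModular C E).obj V) := by
  refine NatTrans.ext (funext fun γ => slice_gen_hom_ext V fun Γ p l hl => ?_)
  let MV := (freeModular C E).obj V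
  have e₁ : sliceGen V Γ p l hl ≫ ((freeModular C E).map (η.app V)).app γ =
      listTensorMap (fun v => (η.app V).app (Γ.corolla v)) l ≫ sliceGen MV Γ p l hl :=
    sliceGen_sliceTrans V (η.app V) Γ p l hl
  -- The component of `η` at `γ(v)` is `g v` followed by the generator of the graph `γ(v)` over
  -- itself.
  let g : ∀ v, V.obj (Γ.corolla v) ⟶ listTensor (fun w => V.obj ((Γ.star v).corolla w)) [PUnit.unit] :=
    fun v => V.map (toStar (Γ.corolla v) PUnit.unit) ≫
      (ρ_ (V.obj ((Γ.star v).corolla PUnit.unit))).inv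
  have hm : ∀ v, IsOrdering [(PUnit.unit : (Γ.star v).Vert)] :=
    fun v => isOrdering_singleton (Γ.corolla v) PUnit.unit
  have e₂ : listTensorMap (fun v => (η.app V).app (Γ.corolla v)) l = listTensorMap g l ≫
      listTensorMap (fun v => sliceGen V (Γ.star v) (𝟙 (Γ.star v)) [PUnit.unit] (hm v)) l := by
    refine Eq.trans ?_ (listTensorMap_comp _ _ l)
    refine congrArg (fun t => listTensorMap t l) (funext fun v => ?_)
    exact (hη V (Γ.corolla v) PUnit.unit).trans (Category.assoc _ _ _).symm
  have e₃ := (isErasingBraces_iff μ).1 hμ V γ Γ p Γ.star (fun v => 𝟙 (Γ.star v)) l hl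
    (fun v => [PUnit.unit]) hm
  have e₄ := (listTensorFlatMap_section (J := fun v => (Γ.star v).Vert)
    (Z := fun u => V.obj ((Γ.graft Γ.star fun v => 𝟙 (Γ.star v)).corolla u))
    (X := fun v w => V.obj ((Γ.star v).corolla w)) (fun v => PUnit.unit)
    (fun v w => V.map (graftCorolla Γ Γ.star (fun v => 𝟙 (Γ.star v)) v w))
    (fun v => V.map (toStar (Γ.corolla v) PUnit.unit))
    (fun v => V.map (corollaMap (graftUnitRightBij Γ) v))
    (fun v => (V.map_comp _ _).symm.trans
      (congrArg V.map (corollaMap_graftUnitRight Γ v).symm)) l).comp_sliceGen V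
      (Γ.graftHom Γ.star (fun v => 𝟙 (Γ.star v)) ≫ p) (hl.sigma hm)
      (hl.map (vert_bijective _ (graftUnitRight_nonContracting Γ)))
  have e₅ := sliceGen_map V (graftUnitRightBij Γ)
    (Γ.graftHom Γ.star (fun v => 𝟙 (Γ.star v)) ≫ p) l hl
  have e₆ : (graftUnitRightBij Γ).hom ≫ Γ.graftHom Γ.star (fun v => 𝟙 (Γ.star v)) ≫ p = p :=
    (Category.assoc _ _ _).symm.trans ((congrArg (· ≫ p) (graftUnitRight_graftHom Γ)).trans
      (Category.id_comp p))
  have e₈ : sliceGen V Γ p l hl ≫ ((freeModular C E).map (η.app V)).app γ ≫ (μ.app V).app γ =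
      sliceGen V Γ p l hl := by
    refine (comp_eq_comp_assoc e₁ _).trans ((congrArg (· ≫ sliceGen MV Γ p l hl ≫
      (μ.app V).app γ) e₂).trans ?_)
    refine (Category.assoc _ _ _).trans ((congrArg _ e₃).trans ?_)
    refine ((Category.assoc _ _ _).symm.trans e₄).trans ((Category.assoc _ _ _).trans ?_)
    exact e₅.symm.trans (congrArg (fun t => sliceGen V Γ t l hl) e₆)
  exact e₈.trans (Category.comp_id _).symm

theorem assoc_reassoc {a b c d e x : E} (s : a ⟶ b) (t : b ⟶ c) (i : c ⟶ d) (j : d ⟶ e)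
    (k : e ⟶ x) : s ≫ t ≫ i ≫ j ≫ k = (s ≫ t ≫ i ≫ j) ≫ k := by
  simp only [Category.assoc]

theorem assoc_path_aux {a b b' c c' d e x : E} {s : a ⟶ b} {s' : b ⟶ b'} {t : b' ⟶ c}
    {i : c ⟶ d} {j : d ⟶ x} {k : b' ⟶ c'} {r : c' ⟶ d} {u : a ⟶ e} {u' : e ⟶ c'} {y : e ⟶ x}
    (e₁ : t ≫ i = k ≫ r) (e₂ : s ≫ s' ≫ k = u ≫ u') (e₃ : u' ≫ r ≫ j = y) :
    s ≫ s' ≫ t ≫ i ≫ j = u ≫ y := by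
  rw [reassoc_of% e₁, reassoc_of% e₂, e₃]

theorem assoc_path_aux' {a b b' c d x y z : E} {s : a ⟶ b} {s' : b ⟶ b'} {t : b' ⟶ c}
    {i : c ⟶ d} {j : d ⟶ x} {k : b ⟶ y} {r : y ⟶ d} {u : a ⟶ z} {u' : z ⟶ y} {w : z ⟶ x}
    (e₁ : s' ≫ t ≫ i = k ≫ r) (e₂ : s ≫ k = u ≫ u') (e₃ : u' ≫ r ≫ j = w) :
    s ≫ s' ≫ t ≫ i ≫ j = u ≫ w := by
  rw [reassoc_of% e₁, reassoc_of% e₂, e₃]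

/-- On a three-layer generator one composite yields `Γ{Y_v{Z_w}}`, the other `Γ{Y_v}{Z_w}`. The
colimit identifies these graphs along `graftAssoc`, and the two ways of removing parentheses differ
by a permutation. -/
theorem assoc_law (hμ : IsErasingBraces μ) (V : Corolla C ⥤ E) :
    (freeModular C E).map (μ.app V) ≫ μ.app V = μ.app ((freeModular C E).obj V) ≫ μ.app V := by
  refine NatTrans.ext (funext fun γ => slice_slice_hom_ext ((freeModular C E).obj V)
    fun Γ p Y f l hl m hm => ?_)
  -- The third layer: graphs `Z` over the corollas of the vertices of the `Y v`.
  refine listTensor_nested_hom_ext V (fun v w => (Y v).star w) hl hm fun Z h n hn => ?_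
  have hμ' := (isErasingBraces_iff μ).1 hμ
  let MV := (freeModular C E).obj V
  let MMV := (freeModular C E).obj MV
  let G₁ := (Γ.graft Y f).graft Z (graftGraftMap Γ Y f Z h)
  let G₂ := Γ.graft (innerGraft Γ Y Z h) (innerGraftMap Γ Y f Z h)
  let k := graftAssocBij Γ Y f Z h
  have hmn : ∀ v, IsOrdering ((m v).sigma fun w => n ⟨v, w⟩) :=
    fun v => (hm v).sigma fun w => hn ⟨v, w⟩
  -- First composite: braces are erased inside each `Y v`, then in `Γ`.
  have e₁ : sliceGen MMV Γ p l hl ≫ ((freeModular C E).map (μ.app V)).app γ =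
      listTensorMap (fun v => (μ.app V).app (Γ.corolla v)) l ≫ sliceGen MV Γ p l hl :=
    sliceGen_sliceTrans MMV (μ.app V) Γ p l hl
  let F₁ := fun v => listTensorFlatMap
    (Z := fun u => V.obj ((innerGraft Γ Y Z h v).corolla u))
    (fun w t => V.map (graftCorolla (Y v) (fun w => Z ⟨v, w⟩) (fun w => h ⟨v, w⟩) w t))
    (fun w => n ⟨v, w⟩) (m v)
  have e₂ : listTensorMap (fun v => listTensorMap
        (fun w => sliceGen V (Z ⟨v, w⟩) (h ⟨v, w⟩) (n ⟨v, w⟩) (hn ⟨v, w⟩)) (m v)) l ≫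
      listTensorMap (fun v => sliceGen MV (Y v) (f v) (m v) (hm v)) l ≫
      listTensorMap (fun v => (μ.app V).app (Γ.corolla v)) l =
      listTensorMap F₁ l ≫ listTensorMap (fun v => sliceGen V (innerGraft Γ Y Z h v)
        (innerGraftMap Γ Y f Z h v) ((m v).sigma fun w => n ⟨v, w⟩) (hmn v)) l := by
    refine (congrArg _ (listTensorMap_comp _ _ l).symm).trans ((listTensorMap_comp _ _ l).symm.trans
      (Eq.trans ?_ (listTensorMap_comp _ _ l)))
    exact congrArg (fun t => listTensorMap t l) (funext fun v => hμ' V (Γ.corolla v) (Y v) (f v)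
      (fun w => Z ⟨v, w⟩) (fun w => h ⟨v, w⟩) (m v) (hm v) (fun w => n ⟨v, w⟩)
      fun w => hn ⟨v, w⟩)
  have e₃ := hμ' V γ Γ p (innerGraft Γ Y Z h) (innerGraftMap Γ Y f Z h) l hl
    (fun v => (m v).sigma fun w => n ⟨v, w⟩) hmn
  let q : G₁ ⟶ γ.obj :=
    (Γ.graft Y f).graftHom Z (graftGraftMap Γ Y f Z h) ≫ Γ.graftHom Y f ≫ p
  have e₄ : Γ.graftHom (innerGraft Γ Y Z h) (innerGraftMap Γ Y f Z h) ≫ p = k.hom ≫ q :=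
    (congrArg (· ≫ p) (graftAssoc_graftHom Γ Y f Z h).symm).trans
      ((Category.assoc _ _ _).trans (congrArg _ (Category.assoc _ _ _)))
  have e₅ := sliceGen_map V k q (l.sigma fun v => (m v).sigma fun w => n ⟨v, w⟩) (hl.sigma hmn)
  -- Second composite: the `Y v` are substituted first, after which the `Z` form a family over the
  -- vertices of `Γ.graft Y f`.
  have e₆ := hμ' MV γ Γ p Y f l hl m hm
  have e₇ : listTensorMap (fun v => listTensorMap
        (fun w => sliceGen V (Z ⟨v, w⟩) (h ⟨v, w⟩) (n ⟨v, w⟩) (hn ⟨v, w⟩)) (m v)) l ≫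
      listTensorFlatMap (Z := fun u => MV.obj ((Γ.graft Y f).corolla u))
        (fun v w => MV.map (graftCorolla Γ Y f v w)) m l =
      listTensorFlatten (fun u : Σ v, (Y v).Vert =>
        listTensor (fun t => V.obj ((Z u).corolla t)) (n u)) m l ≫
      listTensorMap (fun u => sliceGen V (Z u) (graftGraftMap Γ Y f Z h u) (n u) (hn u))
        (l.sigma m) := by
    refine (comp_listTensorFlatMap _ _ m l).trans
      (Eq.trans ?_ (listTensorFlatten_naturality (I := Γ.Vert) (J := fun v => (Y v).Vert)
        (Y := fun u => listTensor (fun t => V.obj ((Z u).corolla t)) (n u))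
        (Z := fun u => MV.obj ((Γ.graft Y f).corolla u))
        (fun u => sliceGen V (Z u) (graftGraftMap Γ Y f Z h u) (n u) (hn u)) m l))
    exact congrArg (fun t => listTensorFlatMap (X := fun v w =>
      listTensor (fun t => V.obj ((Z ⟨v, w⟩).corolla t)) (n ⟨v, w⟩)) t m l) (funext fun v => funext fun w =>
      sliceGen_sliceMap V (graftCorolla Γ Y f v w).hom _ _ _ _)
  have e₈ := hμ' V γ (Γ.graft Y f) (Γ.graftHom Y f ≫ p) Z (graftGraftMap Γ Y f Z h) (l.sigma m)
    (hl.sigma hm) n hn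
  have e₉ := (listTensorFlatMap_assoc (I := Γ.Vert) (J := fun v => (Y v).Vert)
    (K := fun u => (Z u).Vert) (X := fun u t => V.obj ((Z u).corolla t))
    (A := fun v u => V.obj ((innerGraft Γ Y Z h v).corolla u))
    (B := fun u => V.obj (G₂.corolla u)) (Z := fun u => V.obj (G₁.corolla u))
    (fun v w t => V.map
      (graftCorolla (Y v) (fun w => Z ⟨v, w⟩) (fun w => h ⟨v, w⟩) w t))
    (fun v u => V.map (graftCorolla Γ (innerGraft Γ Y Z h) (innerGraftMap Γ Y f Z h) v u))
    (fun u => V.map (corollaMap k u))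
    (fun u t => V.map (graftCorolla (Γ.graft Y f) Z (graftGraftMap Γ Y f Z h) u t))
    (fun v w t => (congrArg _ (V.map_comp _ _).symm).trans ((V.map_comp _ _).symm.trans
      (congrArg V.map (graftCorolla_graftAssoc Γ Y f Z h v w t)))) m n l).comp_sliceGen V q
    ((hl.sigma hm).sigma hn) ((hl.sigma hmn).map (vert_bijective k.hom k.property))
  -- The two paths now end at generators of `G₂` and `G₁`; `e₅` moves the former along `k`, and `e₉`
  -- matches the tensor products.
  refine (assoc_path_aux e₁ e₂ e₃).trans (Eq.trans ?_ (assoc_path_aux' e₆ e₇ e₈).symm)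
  refine Eq.trans ?_ (e₉.symm.trans (Category.assoc _ _ _))
  refine (congrArg (fun t => listTensorMap F₁ l ≫ _ ≫ sliceGen V G₂ t _ (hl.sigma hmn)) e₄).trans ?_
  refine (congrArg (fun t => listTensorMap F₁ l ≫ _ ≫ t) e₅).trans ?_
  exact assoc_reassoc _ _ _ _ _

end Laws
end MonadLaws

end ModularOperad

/-- For a small category with duality `C` and a cocomplete symmetric monoidal category `E` whose
tensor product preserves colimits in each variable, the endofunctor
`𝓜 V (γ) = colim_{Γ → γ} ⨂_{v} V(γ(v))` of the category of stable `C𝕊`-modules is a monad with the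
unit `η` given by `id_γ` and the multiplication `μ` given by erasing braces: both natural
transformations exist and are unique, and they satisfy the laws of a monad. -/
theorem mainTheorem6 {C : Type u} [SmallCategory C] [ModularOperad.CategoryWithDuality C]
    {E : Type w} [Category.{v} E] [MonoidalCategory E] [SymmetricCategory E]
    [HasColimitsOfSize.{u, u} E] [∀ X : E, PreservesColimitsOfSize.{u, u} (tensorLeft X)] :
    (∃! η : 𝟭 (ModularOperad.Corolla C ⥤ E) ⟶ ModularOperad.freeModular C E,
      ModularOperad.IsUnitTransformation η) ∧
    (∃! μ : ModularOperad.freeModular C E ⋙ ModularOperad.freeModular C E ⟶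
      ModularOperad.freeModular C E, ModularOperad.IsErasingBraces μ) ∧
    ∀ (η : 𝟭 (ModularOperad.Corolla C ⥤ E) ⟶ ModularOperad.freeModular C E)
      (μ : ModularOperad.freeModular C E ⋙ ModularOperad.freeModular C E ⟶
        ModularOperad.freeModular C E),
      ModularOperad.IsUnitTransformation η → ModularOperad.IsErasingBraces μ →
      (∀ V : ModularOperad.Corolla C ⥤ E,
        (ModularOperad.freeModular C E).map (μ.app V) ≫ μ.app V =
          μ.app ((ModularOperad.freeModular C E).obj V) ≫ μ.app V) ∧
      (∀ V : ModularOperad.Corolla C ⥤ E,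
        η.app ((ModularOperad.freeModular C E).obj V) ≫ μ.app V =
          𝟙 ((ModularOperad.freeModular C E).obj V)) ∧
      (∀ V : ModularOperad.Corolla C ⥤ E,
        (ModularOperad.freeModular C E).map (η.app V) ≫ μ.app V =
          𝟙 ((ModularOperad.freeModular C E).obj V)) := by
  exact ⟨ModularOperad.existsUnique_isUnitTransformation, ModularOperad.existsUnique_isErasingBraces,
    fun η μ hη hμ => ⟨ModularOperad.assoc_law hμ, ModularOperad.unit_left hη hμ,
      ModularOperad.unit_right hη hμ⟩⟩
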